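/- **Setting and definitions.** All flows are continuous flows on topological $3$-manifolds, and all maps are $C^0$. For an open set $U$ and $x\in U$, let $\mathcal O_U(x)$ be the orbit segment through $x$ inside $U$, i.e. the set of the $\phi_t(x)$ such that $\phi_s(x)\in U$ for all $s$ between $0$ and $t$. A *local orbital equivalence* $(\phi^1_t,U_1)\to(\phi^2_t,U_2)$ between open sets is a homeomorphism $H:U_1\to U_2$ that maps each $\mathcal O_{U_1}(x)$ homeomorphically onto $\mathcal O_{U_2}(H(x))$, preserving the orientation of orbits. For $i=1,2$ let $\gamma^i$ be a periodic orbit of a flow $\phi^i_t$ on $M_i$ which is of saddle type with orientable local invariant manifolds: some neighbourhood of $\gamma^i$ is locally orbitally equivalent to a neighbourhood of the orbit of the origin in the suspension of a linear map $\mathrm{diag}(\lambda,\mu)$ of $\mathbb R^2$ with $0<\lambda<1<\mu$. The local stable and unstable manifolds $W^s_{loc}(\gamma^i),W^u_{loc}(\gamma^i)$ are then the cylinders that correspond to the two coordinate axes. Fix an orientation of $M_i$ near $\gamma^i$. A *local Birkhoff section* at $\gamma=\gamma^i$ is the image $B$ of a topological immersion $\iota:[0,1)\times\mathbb R/\mathbb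 Z\to M_i$ such that $\iota(\{0\}\times\mathbb R/\mathbb Z)=\gamma$; $\iota$ restricted to $(0,1)\times\mathbb R/\mathbb Z$ is an embedding whose image $\mathring B=B\setminus\gamma$ is topologically transverse to the flow; the collars $\iota([0,\varepsilon)\times\mathbb R/\mathbb Z)$ are neighbourhoods of $\gamma$ in $B$; and for some $T>0$ and some neighbourhood $W$ of $\gamma$, every orbit segment $\phi_{[0,T]}(x)$ with $x\in W$ meets $B$. It has a first return map $P_B$, from the points of $\mathring B$ close to $\gamma$ to $\mathring B$. It is *tame* if there is a compact collar neighbourhood $U\subset B$ of $\gamma$ such that each of $U\cap W^s_{loc}(\gamma)$ and $U\cap W^u_{loc}(\gamma)$ is the union of $\gamma$ with finitely many compact segments, each of which meets $\gamma$ exactly at one of its extremities. In the homology of a punctured tubular neighbourhood of $\gamma$, let $a$ be the meridian (the boundary of a small disk transverse to $\gamma$, co-oriented by the flow) and let $b$ be the longitude (a curve in $W^u_{loc}(\gamma)\setminus\gamma$ parallel to $\gamma$). The *linking number* $n(\gamma,B)$ and the *multiplicity* $m(\gamma,B)$ are defined by $[\sigma]=n(\gamma,B)\,a+m(\gamma,B)\,b$,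 where $\sigma=\iota(\{r\}\times\mathbb R/\mathbb Z)$, $r$ small, is oriented as a boundary component of the band $\iota([0,r]\times\mathbb R/\mathbb Z)$, which is co-oriented by the flow. **Theorem.** For $i=1,2$ let $B_i$ be a tame local Birkhoff section at $\gamma^i$. Let $h:\mathring B_1\to\mathring B_2$ be a homeomorphism that sends points close to $\gamma^1$ to points close to $\gamma^2$ and satisfies $P_{B_2}\circ h(x)=h\circ P_{B_1}(x)$ for every $x\in\mathring B_1$ sufficiently close to $\gamma^1$. Let $W_1,W_2$ be open neighbourhoods of $\gamma^1,\gamma^2$, and let $H:W_1\setminus\gamma^1\to W_2\setminus\gamma^2$ be a homeomorphism such that (a) $H:(\phi^1_t,W_1\setminus\gamma^1)\to(\phi^2_t,W_2\setminus\gamma^2)$ is a local orbital equivalence, which preserves the orientations of the $M_i$ near $\gamma^1$; (b) $H(x)=h(x)$ for every $x\in\mathring B_1\cap W_1$. If $m(\gamma^1,B_1)=m(\gamma^2,B_2)$ and $n(\gamma^1,B_1)=n(\gamma^2,B_2)$, then for every neighbourhood $N\subset W_1$ of $\gamma^1$ there exists a homeomorphism $H_N:W_1\to W_2$ such that (a)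 $H_N$ is a local orbital equivalence $(\phi^1_t,W_1)\to(\phi^2_t,W_2)$ with $H_N(\gamma^1)=\gamma^2$; (b) $H_N(x)=H(x)$ for every $x\in W_1\setminus N$. -/

import Mathlib

open Set Filter Topology

noncomputable section

/-! ### Flows, orbit segments and orbital equivalences -/

/-- `γ` is a periodic orbit of `φ` (not reduced to a fixed point). -/
def IsPeriodicOrbit {M : Type*} [TopologicalSpace M] (φ : Flow ℝ M) (γ : Set M) : Prop :=
  ∃ x : M, γ = Set.range (fun t : ℝ => φ t x) ∧ (∃ T : ℝ, 0 < T ∧ φ T x = x) ∧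
    ∃ t : ℝ, φ t x ≠ x

/-- The interval of times during which the orbit of `x` stays in `U`, without interruption,
around time `0`. The orbit `𝒪_U(x)` of the restricted pseudo-flow `(φ, U)` is
`{φ t x | t ∈ stayTimes φ U x}`. -/
def stayTimes {M : Type*} [TopologicalSpace M] (φ : Flow ℝ M) (U : Set M) (x : M) : Set ℝ :=
  {t | ∀ s ∈ Set.uIcc 0 t, φ s x ∈ U}

/-- The homeomorphism `H` between the open sets `H.source` and `H.target` is a local orbital
equivalence between the pseudo-flows `(φ₁, H.source)` and `(φ₂, H.target)`: it maps the orbit of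
every `x` in `H.source` homeomorphically onto the orbit of `H x` in `H.target`, preserving the
orientation (`θ` is `H` read in the time parameters of the two orbits; an increasing bijection
between intervals is a homeomorphism). -/
def IsLocalOrbitalEquivalence {M₁ M₂ : Type*} [TopologicalSpace M₁] [TopologicalSpace M₂]
    (φ₁ : Flow ℝ M₁) (φ₂ : Flow ℝ M₂) (H : OpenPartialHomeomorph M₁ M₂) : Prop :=
  ∀ x ∈ H.source, ∃ θ : ℝ → ℝ, θ 0 = 0 ∧
    StrictMonoOn θ (stayTimes φ₁ H.source x) ∧
    θ '' stayTimes φ₁ H.source x = stayTimes φ₂ H.target (H x) ∧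
    ∀ t ∈ stayTimes φ₁ H.source x, H (φ₁ t x) = φ₂ (θ t) (H x)

/-! ### Saddle type periodic orbits with orientable local invariant manifolds -/

/-- The suspension of the linear map `diag (exp a, exp b)` of the plane `ℂ = ℝ²`, as a flow on
`ℂ × ℝ/ℤ` (the mapping torus, trivialised by the flow of linear maps
`diag (exp (a t), exp (b t))`). -/
def saddleFlow (a b : ℝ) : Flow ℝ (ℂ × UnitAddCircle) where
  toFun t q := (⟨Real.exp (a * t) * q.1.re, Real.exp (b * t) * q.1.im⟩, q.2 + ((t : ℝ) : UnitAddCircle))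
  cont' := by
    refine Continuous.prodMk ?_ ?_
    · have h : (fun p : ℝ × (ℂ × UnitAddCircle) =>
          (⟨Real.exp (a * p.1) * p.2.1.re, Real.exp (b * p.1) * p.2.1.im⟩ : ℂ)) =
          fun p => Complex.equivRealProdCLM.symm
            (Real.exp (a * p.1) * p.2.1.re, Real.exp (b * p.1) * p.2.1.im) := by
        funext p
        apply Complex.ext <;> simp
      change Continuous (fun p : ℝ × (ℂ × UnitAddCircle) =>
          (⟨Real.exp (a * p.1) * p.2.1.re, Real.exp (b * p.1) * p.2.1.im⟩ : ℂ))
      rw [h]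
      apply Complex.equivRealProdCLM.symm.continuous.comp
      have h1 : Continuous fun p : ℝ × (ℂ × UnitAddCircle) => p.2.1.re :=
        Complex.continuous_re.comp (continuous_fst.comp continuous_snd)
      have h2 : Continuous fun p : ℝ × (ℂ × UnitAddCircle) => p.2.1.im :=
        Complex.continuous_im.comp (continuous_fst.comp continuous_snd)
      fun_prop
    · exact (continuous_snd.comp continuous_snd).add
        ((AddCircle.continuous_mk' 1).comp continuous_fst)
  map_add' t₁ t₂ q := by
    refine Prod.ext (Complex.ext ?_ ?_) ?_
    · simp only [mul_add, Real.exp_add]; ring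
    · simp only [mul_add, Real.exp_add]; ring
    · simp only [AddCircle.coe_add]; abel
  map_zero' q := by
    refine Prod.ext (Complex.ext ?_ ?_) ?_ <;> simp

/-- A saddle chart at `γ`: a local orbital equivalence of the germ of `φ` at `γ` with the germ, at
its periodic orbit `{0} × ℝ/ℤ`, of the suspension of a diagonal linear map with eigenvalues
`0 < exp a < 1 < exp b`. The existence of such a chart means that `γ` is a (topological) saddle type
periodic orbit whose local invariant manifolds are cylinders.
A chart also orients `M` near `γ` (by the standard orientation of `ℂ × ℝ/ℤ`); both orientations
arise, since a chart can be composed with a reflection of `ℂ` in a coordinate axis. -/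
structure SaddleChart {M : Type*} [TopologicalSpace M] (φ : Flow ℝ M) (γ : Set M) where
  a : ℝ
  b : ℝ
  a_neg : a < 0
  b_pos : 0 < b
  chart : OpenPartialHomeomorph M (ℂ × UnitAddCircle)
  subset_source : γ ⊆ chart.source
  image_eq : chart '' γ = {q | q.1 = 0}
  orbital : IsLocalOrbitalEquivalence φ (saddleFlow a b) chart

namespace SaddleChart

variable {M : Type*} [TopologicalSpace M] {φ : Flow ℝ M} {γ : Set M}

/-- The local stable manifold of `γ`. -/
def stable (c : SaddleChart φ γ) : Set M := {x | x ∈ c.chart.source ∧ (c.chart x).1.im = 0}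

/-- The local unstable manifold of `γ`. -/
def unstable (c : SaddleChart φ γ) : Set M := {x | x ∈ c.chart.source ∧ (c.chart x).1.re = 0}

/-- The `1`-periodic curve `s` in the punctured neighbourhood of `γ` has homology class
`n • [meridian] + m • [longitude]`. In the chart, the meridian is a positively oriented circle
around `0` in `ℂ × {z}`, and the longitude is `{i ε} × ℝ/ℤ` (a curve of the local unstable
manifold, parallel to `γ`); thus `n` is the winding number of the `ℂ`-coordinate around `0`, and
`m` is the degree of the `ℝ/ℤ`-coordinate. -/
def HasClass (c : SaddleChart φ γ) (s : ℝ → M) (n m : ℤ) : Prop :=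
  ∃ (L : ℝ → ℂ) (Z : ℝ → ℝ), Continuous L ∧ Continuous Z ∧ ∀ t : ℝ,
    s t ∈ c.chart.source ∧ c.chart (s t) = (Complex.exp (L t), ((Z t : ℝ) : UnitAddCircle)) ∧
    L (t + 1) = L t + 2 * Real.pi * Complex.I * n ∧ Z (t + 1) = Z t + m

end SaddleChart

/-- `f` has local index `+1` at `p`: the image of every small positively oriented circle around `p`
winds exactly once around `f p`. For a map that is injective near `p`, this says that it preserves
the orientation. -/
def HasIndexOne (f : ℂ → ℂ) (p : ℂ) : Prop :=
  ∀ᶠ r : ℝ in 𝓝[>] 0, ∃ L : ℝ → ℂ, Continuous L ∧ ∀ t : ℝ,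
    f (p + r * Complex.exp (2 * Real.pi * Complex.I * t)) - f p = Complex.exp (L t) ∧
    L (t + 1) = L t + 2 * Real.pi * Complex.I

namespace SaddleChart

variable {M : Type*} [TopologicalSpace M] {φ : Flow ℝ M} {γ : Set M}

/-- The parametrised surface `f : ℂ → M` (defined near `p`, transverse to the flow, with image near
`γ`) is positively oriented at `p`, for the orientation that is given to surfaces transverse to the
flow by the orientation of `M` and the co-orientation by the flow. To test this, the surface is
projected to the plane along the flow lines of the model: `Z` is a local lift to `ℝ` of the
`ℝ/ℤ`-coordinate, and flowing the model for the time `-Z` leads to level `0`. -/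
def IsPositiveAt (c : SaddleChart φ γ) (f : ℂ → M) (p : ℂ) : Prop :=
  (∀ᶠ q in 𝓝 p, f q ∈ c.chart.source) ∧
  ∃ Z : ℂ → ℝ,
    (∀ᶠ q in 𝓝 p, ContinuousAt Z q ∧ (c.chart (f q)).2 = ((Z q : ℝ) : UnitAddCircle)) ∧
    HasIndexOne (fun q => (saddleFlow c.a c.b (-Z q) (c.chart (f q))).1) p

end SaddleChart

/-- The flow preserving map `H`, defined on a punctured neighbourhood of `γ₁`, preserves the
orientations of the ambient manifolds given by the charts. As `H` preserves the oriented orbits,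
it suffices to see that it carries the positively oriented transverse disks `ℂ × {z}` of
the first chart to positively oriented surfaces. -/
def PreservesOrientation {M₁ M₂ : Type*} [TopologicalSpace M₁] [TopologicalSpace M₂]
    {φ₁ : Flow ℝ M₁} {φ₂ : Flow ℝ M₂} {γ₁ : Set M₁} {γ₂ : Set M₂}
    (c₁ : SaddleChart φ₁ γ₁) (c₂ : SaddleChart φ₂ γ₂) (H : M₁ → M₂) : Prop :=
  ∀ᶠ x in 𝓝ˢ γ₁, x ∉ γ₁ →
    c₂.IsPositiveAt (fun v : ℂ => H (c₁.chart.symm (v, (c₁.chart x).2))) (c₁.chart x).1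

/-! ### Local Birkhoff sections -/

/-- The half-open annulus `[0, 1) × ℝ/ℤ`. -/
def halfOpenAnnulus : Set (ℝ × UnitAddCircle) := {p | 0 ≤ p.1 ∧ p.1 < 1}

/-- The open annulus `(0, 1) × ℝ/ℤ`. -/
def openAnnulus : Set (ℝ × UnitAddCircle) := {p | 0 < p.1 ∧ p.1 < 1}

/-- A local Birkhoff section at `γ`, given by a (topological) immersion `ι` of `[0, 1) × ℝ/ℤ`;
the values of `ι` outside `[0, 1) × ℝ/ℤ` play no role. -/
structure LocalBirkhoffSection {M : Type*} [TopologicalSpace M] (φ : Flow ℝ M) (γ : Set M) where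
  ι : ℝ × UnitAddCircle → M
  /-- `ι` is an immersion: it is locally an embedding, up to the boundary. -/
  immersion : ∀ p ∈ halfOpenAnnulus, ∃ V ∈ 𝓝 p,
    IsEmbedding ((V ∩ halfOpenAnnulus).domRestrict ι)
  boundary : ι '' {p | p.1 = 0} = γ
  /-- `ι` is an embedding on the interior. -/
  embedding : IsEmbedding (openAnnulus.domRestrict ι)
  /-- The interior is topologically transverse to the flow lines: the flow provides flow boxes
  around its points, in which it is a horizontal disk. -/
  transverse : ∀ p ∈ openAnnulus, ∃ V : Set (ℝ × UnitAddCircle), IsOpen V ∧ p ∈ V ∧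
    V ⊆ openAnnulus ∧ ∃ δ : ℝ, 0 < δ ∧
      IsOpenEmbedding (fun x : V × Set.Ioo (-δ) δ => φ (x.2 : ℝ) (ι x.1))
  /-- The collars `ι ([0, ε) × ℝ/ℤ)` are neighbourhoods of `γ` in the image of `ι`: the outer end of
  the annulus does not come back to `γ`. -/
  collar : ∀ ε : ℝ, 0 < ε → ∀ᶠ x in 𝓝ˢ γ, ∀ p ∈ halfOpenAnnulus, ι p = x → p.1 < ε
  /-- Orbits that start near `γ` meet the section in bounded time. -/
  return_time : ∃ T : ℝ, 0 < T ∧ ∀ᶠ x in 𝓝ˢ γ, ∃ t ∈ Set.Icc 0 T, φ t x ∈ ι '' halfOpenAnnulus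

/-- `τ` is the first positive time at which the orbit of `x` returns to `S`, and `y` is the point of
return: `y = P_S x`, where `P_S` is the first return map. -/
def IsFirstReturn {M : Type*} [TopologicalSpace M] (φ : Flow ℝ M) (S : Set M) (x y : M) : Prop :=
  ∃ τ : ℝ, 0 < τ ∧ φ τ x = y ∧ y ∈ S ∧ ∀ t : ℝ, 0 < t → t < τ → φ t x ∉ S

/-- A compact collar of the boundary circle in `[0, 1) × ℝ/ℤ`. -/
def IsCollar (U : Set (ℝ × UnitAddCircle)) : Prop :=
  U ⊆ halfOpenAnnulus ∧ (∃ ε : ℝ, 0 < ε ∧ ∀ p : ℝ × UnitAddCircle, 0 ≤ p.1 → p.1 < ε → p ∈ U) ∧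
    Nonempty (U ≃ₜ (Set.Icc (0 : ℝ) 1 × UnitAddCircle))

/-- `S` is the union of `γ` with finitely many compact segments, each of which meets `γ` exactly at
one of its extremities. -/
def IsUnionWithSegments {M : Type*} [TopologicalSpace M] (γ S : Set M) : Prop :=
  ∃ (k : ℕ) (w : Fin k → ℝ → M),
    (∀ i, ContinuousOn (w i) (Set.Icc 0 1) ∧ Set.InjOn (w i) (Set.Icc 0 1) ∧
      ∀ t ∈ Set.Icc (0 : ℝ) 1, w i t ∈ γ ↔ t = 0) ∧
    S = γ ∪ ⋃ i, w i '' Set.Icc 0 1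

namespace LocalBirkhoffSection

variable {M : Type*} [TopologicalSpace M] {φ : Flow ℝ M} {γ : Set M}

/-- The interior `B \ γ` of the section. -/
def interior (B : LocalBirkhoffSection φ γ) : Set M := B.ι '' openAnnulus

/-- The section is tame. -/
def IsTame (B : LocalBirkhoffSection φ γ) (c : SaddleChart φ γ) : Prop :=
  ∃ U, IsCollar U ∧ IsUnionWithSegments γ (B.ι '' U ∩ c.stable) ∧
    IsUnionWithSegments γ (B.ι '' U ∩ c.unstable)

/-- `n` is the linking number and `m` is the multiplicity of the section at `γ`: the circles
`σ = ι ({r} × ℝ/ℤ)` near `γ` have homology class `n • [meridian] + m • [longitude]`. Here `σ` is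
oriented as a part of the boundary of the band `ι ([0, r] × ℝ/ℤ)`, which the flow co-orients: the
sign `ε` is chosen such that `(r, θ) ↦ ι (r, ε θ)` is positively oriented, and then
`σ t = ι (r, ε t)`. -/
def HasLinkingNumberAndMultiplicity (B : LocalBirkhoffSection φ γ) (c : SaddleChart φ γ)
    (n m : ℤ) : Prop :=
  ∃ ε : ℝ, (ε = 1 ∨ ε = -1) ∧ ∀ᶠ r : ℝ in 𝓝[>] 0,
    (∀ θ : UnitAddCircle, c.IsPositiveAt
      (fun u : ℂ => B.ι (r + u.re, θ + ((ε * u.im : ℝ) : UnitAddCircle))) 0) ∧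
    c.HasClass (fun t : ℝ => B.ι (r, ((ε * t : ℝ) : UnitAddCircle))) n m

end LocalBirkhoffSection

/-- The homeomorphism `h` between the interiors is a local conjugation between the germs at `γ₁` and
`γ₂` of the first return maps: it sends points near `γ₁` to points near `γ₂`, and
`P₂ (h x) = h (P₁ x)` for every `x` sufficiently close to `γ₁`. -/
def IsLocalConjugation {M₁ M₂ : Type*} [TopologicalSpace M₁] [TopologicalSpace M₂]
    {φ₁ : Flow ℝ M₁} {φ₂ : Flow ℝ M₂} {γ₁ : Set M₁} {γ₂ : Set M₂}
    (B₁ : LocalBirkhoffSection φ₁ γ₁) (B₂ : LocalBirkhoffSection φ₂ γ₂)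
    (h : B₁.interior ≃ₜ B₂.interior) : Prop :=
  (∀ O ∈ 𝓝ˢ γ₂, ∀ᶠ x in 𝓝ˢ γ₁, ∀ hx : x ∈ B₁.interior, (h ⟨x, hx⟩ : M₂) ∈ O) ∧
  ∀ᶠ x in 𝓝ˢ γ₁, ∀ (hx : x ∈ B₁.interior) (y : B₁.interior),
    IsFirstReturn φ₁ B₁.interior x y → IsFirstReturn φ₂ B₂.interior (h ⟨x, hx⟩) (h y)

end

/-!
The map `H` is extended to the periodic orbits after a modification along the orbits of `φ₂`, which
consists in removing the drift of `H` along the longitude.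

In the saddle charts, `H` becomes an orbit preserving homeomorphism between punctured tubes around
`{0} × ℝ/ℤ` (`PuncturedEquiv`, `IsSectionEquiv.exists_puncturedEquiv`), which is lifted to the
universal covers (`TubeLift`). With the coordinates `(L, Z)`, where `exp L` is the transverse
coordinate and `Z` the longitudinal one, the quantity to control is the shift `Z ∘ H - Z`. If it is
a bounded function on a punctured tube, it can be truncated at a level that decreases slowly to `0`
near the periodic orbit (`TubeLift.exists_correction`); since the level varies slowly, the modified
map preserves the order on the orbits. The modification is realised by a time change of `φ₂`
(`exists_timeShift`, `exists_timeShift_equivalence`), and its result extends continuously to the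
periodic orbits by the longitudinal coordinate (`IsLocalOrbitalEquivalence.exists_extension`).

The shift is a function on the punctured tube if `H` acts trivially on its homology. The stable
manifold is preserved, since it consists of the orbits that converge to the periodic orbit, hence
the longitude is sent to `± 1` times the longitude, and the meridian to `± 1` times the meridian plus
`twist` times the longitude.

* The sign of the longitude is `1` (`TubeLift.long_eq_one`): by tameness, the section contains a path
  in the stable manifold that ends on the periodic orbit. Orbits of the stable manifold go from the
  lift of this path to its translates by positive multiples of the longitude; the image of the path
  has the same property.
* The sign of the meridian is `1` because the orientation is preserved (`TubeLift.merid_eq_one`).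
* The linking number `n` and the multiplicity `m` of a section do not vanish
  (`StripLift.link_ne_zero`, `StripLift.mult_ne_zero`), and `n Z - m (Im L) / 2π` is bounded on a lift
  of a tame section (`StripLift.exists_slope_bound`): it is invariant under the deck transformation
  of the lift, and the section can turn around the periodic orbit only by crossing the finitely many
  segments along which it meets the stable manifold.
* As the class `n • [meridian] + m • [longitude]` of the boundary curve is preserved and `n ≠ 0`, the
  twist vanishes. By the previous point and `n ≠ 0`, the shift is bounded on the section
  (`TubeLift.twist_eq_zero`), hence on a punctured tube, since the orbits meet the section in bounded
  time (`TubeLift.exists_shift_bound`).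
-/

noncomputable section

/-! ### Lifting along coverings, and integer valued functions -/

/-- Maps defined on convex sets lift to covering spaces. -/
theorem IsCoveringMap.exists_lift_of_convex {X E B : Type*} [NormedAddCommGroup X]
    [NormedSpace ℝ X] [TopologicalSpace E] [TopologicalSpace B] {p : E → B}
    (hp : IsCoveringMap p) (hs : Function.Surjective p) {U : Set X} (hU : Convex ℝ U)
    (f : C(U, B)) : ∃ F : C(U, E), ∀ x, p (F x) = f x := by
  rcases isEmpty_or_nonempty U with hE | ⟨⟨x₀⟩⟩
  · exact ⟨⟨fun x => (hE.false x).elim, by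
      rw [continuous_iff_continuousAt]; exact fun x => (hE.false x).elim⟩,
      fun x => (hE.false x).elim⟩
  · have hmem : ∀ q : unitInterval × U, (x₀ : X) + (q.1 : ℝ) • ((q.2 : X) - x₀) ∈ U := fun q =>
      hU.add_smul_sub_mem x₀.2 q.2.2 q.1.2
    let H : C(unitInterval × U, B) :=
      f.comp ⟨fun q => ⟨(x₀ : X) + (q.1 : ℝ) • ((q.2 : X) - x₀), hmem q⟩, by fun_prop⟩
    obtain ⟨e, he⟩ := hs (f x₀)
    have H0 : ∀ a, H (0, a) = p (ContinuousMap.const U e a) := by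
      intro a
      simp only [H, ContinuousMap.comp_apply, ContinuousMap.coe_mk, ContinuousMap.const_apply, he]
      congr 1
      ext
      simp
    refine ⟨(hp.liftHomotopy H (.const U e) H0).comp ⟨fun x => (1, x), by fun_prop⟩, fun x => ?_⟩
    have := congr_fun (hp.liftHomotopy_lifts H (.const U e) H0) (1, x)
    simp only [Function.comp_apply] at this
    simp only [ContinuousMap.comp_apply, ContinuousMap.coe_mk, this, H]
    congr 1
    ext
    simp

theorem exists_log_lift {X : Type*} [NormedAddCommGroup X] [NormedSpace ℝ X] {U : Set X}
    (hU : Convex ℝ U) {f : X → ℂ} (hf : ContinuousOn f U) (h0 : ∀ x ∈ U, f x ≠ 0) :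
    ∃ L : X → ℂ, ContinuousOn L U ∧ ∀ x ∈ U, Complex.exp (L x) = f x := by
  classical
  obtain ⟨F, hF⟩ := Complex.isCoveringMap_exp.exists_lift_of_convex
    (fun z => ⟨Complex.log z, Subtype.ext (Complex.exp_log z.2)⟩) hU
    ⟨fun x : U => (⟨f x, h0 x x.2⟩ : {z : ℂ // z ≠ 0}),
      (continuousOn_iff_continuous_domRestrict.1 hf).subtype_mk _⟩
  refine ⟨fun x => if h : x ∈ U then F ⟨x, h⟩ else 0, ?_, fun x hx => ?_⟩
  · rw [continuousOn_iff_continuous_domRestrict]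
    convert F.continuous using 1
    ext x
    simp
  · simp only [hx, dif_pos]
    exact congr_arg Subtype.val (hF ⟨x, hx⟩)

theorem exists_circle_lift {X : Type*} [NormedAddCommGroup X] [NormedSpace ℝ X] {U : Set X}
    (hU : Convex ℝ U) {f : X → UnitAddCircle} (hf : ContinuousOn f U) :
    ∃ Z : X → ℝ, ContinuousOn Z U ∧ ∀ x ∈ U, ((Z x : ℝ) : UnitAddCircle) = f x := by
  classical
  obtain ⟨F, hF⟩ := (AddCircle.isCoveringMap_coe (1 : ℝ)).exists_lift_of_convex
    (QuotientAddGroup.mk_surjective) hU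
    ⟨fun x : U => f x, continuousOn_iff_continuous_domRestrict.1 hf⟩
  refine ⟨fun x => if h : x ∈ U then F ⟨x, h⟩ else 0, ?_, fun x hx => ?_⟩
  · rw [continuousOn_iff_continuous_domRestrict]
    convert F.continuous using 1
    ext x
    simp
  · simp only [hx, dif_pos]
    exact hF ⟨x, hx⟩

theorem IsPreconnected.eq_of_int_valued {X : Type*} [TopologicalSpace X] {U : Set X}
    (hU : IsPreconnected U) {f : X → ℝ} (hf : ContinuousOn f U) (h : ∀ x ∈ U, ∃ k : ℤ, f x = k)
    {x y : X} (hx : x ∈ U) (hy : y ∈ U) : f x = f y := by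
  have hd : IsDiscrete (Set.range ((↑) : ℤ → ℝ)) := by
    have := Int.isClosedEmbedding_coe_real.isEmbedding.isInducing
    rw [isDiscrete_iff_discreteTopology]
    exact (Int.isClosedEmbedding_coe_real.isEmbedding.toHomeomorph.symm).isEmbedding.discreteTopology
  exact hU.constant_of_mapsTo hd hf (fun z hz => by
    obtain ⟨k, hk⟩ := h z hz
    exact ⟨k, hk.symm⟩) hx hy

theorem circle_coe_eq_iff {a b : ℝ} :
    ((a : ℝ) : UnitAddCircle) = (b : UnitAddCircle) ↔ ∃ k : ℤ, a = b + k := by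
  rw [← sub_eq_zero, ← AddCircle.coe_sub, AddCircle.coe_eq_zero_iff]
  refine exists_congr fun k => ?_
  simp only [zsmul_eq_mul, mul_one]
  constructor <;> intro h <;> linarith

/-- Two lifts of the same circle valued map on a preconnected set differ by a constant. -/
theorem IsPreconnected.exists_int_of_circle_lifts {X : Type*} [TopologicalSpace X] {U : Set X}
    (hU : IsPreconnected U) {f g : X → ℝ} (hf : ContinuousOn f U) (hg : ContinuousOn g U)
    (h : ∀ x ∈ U, ((f x : ℝ) : UnitAddCircle) = (g x : UnitAddCircle)) :
    ∃ k : ℤ, ∀ x ∈ U, f x = g x + k := by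
  rcases U.eq_empty_or_nonempty with rfl | ⟨x₀, hx₀⟩
  · exact ⟨0, fun x hx => hx.elim⟩
  · obtain ⟨k, hk⟩ := circle_coe_eq_iff.1 (h x₀ hx₀)
    refine ⟨k, fun x hx => ?_⟩
    have := hU.eq_of_int_valued (hf.sub hg) (fun y hy => by
      obtain ⟨j, hj⟩ := circle_coe_eq_iff.1 (h y hy)
      exact ⟨j, by simp [hj]⟩) hx hx₀
    simp only [Pi.sub_apply] at this
    linarith

theorem IsPreconnected.exists_int_of_log_lifts {X : Type*} [TopologicalSpace X] {U : Set X}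
    (hU : IsPreconnected U) {f g : X → ℂ} (hf : ContinuousOn f U) (hg : ContinuousOn g U)
    (h : ∀ x ∈ U, Complex.exp (f x) = Complex.exp (g x)) :
    ∃ k : ℤ, ∀ x ∈ U, f x = g x + k * (2 * Real.pi * Complex.I) := by
  rcases U.eq_empty_or_nonempty with rfl | ⟨x₀, hx₀⟩
  · exact ⟨0, fun x hx => hx.elim⟩
  · obtain ⟨k, hk⟩ := Complex.exp_eq_exp_iff_exists_int.1 (h x₀ hx₀)
    have hpi : (2 * Real.pi : ℝ) ≠ 0 := by positivity
    refine ⟨k, fun x hx => ?_⟩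
    have key := hU.eq_of_int_valued (f := fun x => (f x - g x).im / (2 * Real.pi))
      ((Complex.continuous_im.comp_continuousOn (hf.sub hg)).div_const _) (fun y hy => by
      obtain ⟨j, hj⟩ := Complex.exp_eq_exp_iff_exists_int.1 (h y hy)
      refine ⟨j, ?_⟩
      rw [div_eq_iff hpi, hj]
      simp) hx hx₀
    obtain ⟨j, hj⟩ := Complex.exp_eq_exp_iff_exists_int.1 (h x hx)
    rw [hj, hk, div_left_inj' hpi] at key
    simp only [add_sub_cancel_left] at key
    rw [hj, Complex.ext (by simp) key]

/-! ### Strictly monotone functions and flows -/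

theorem strictMono_of_local {f : ℝ → ℝ}
    (h : ∀ s, ∃ ε > 0, StrictMonoOn f (Ioo (s - ε) (s + ε))) : StrictMono f := by
  intro a b hab
  set E : Set ℝ := {t | t ∈ Icc a b ∧ StrictMonoOn f (Icc a t)} with hE
  have haE : a ∈ E := ⟨⟨le_rfl, hab.le⟩, by simp⟩
  have hbdd : BddAbove E := ⟨b, fun t ht => ht.1.2⟩
  obtain ⟨ε, hε, hmono⟩ := h (sSup E)
  obtain ⟨t, htE, ht⟩ := exists_lt_of_lt_csSup ⟨a, haE⟩ (show sSup E - ε < sSup E by linarith)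
  have htc := le_csSup hbdd htE
  -- `f` increases a bit beyond the supremum of `E`
  have hext : ∀ r, t ≤ r → r < sSup E + ε → StrictMonoOn f (Icc a r) := fun r htr hr => by
    rw [← Icc_union_Icc_eq_Icc htE.1.1 htr]
    exact htE.2.union (hmono.mono fun s hs => ⟨ht.trans_le hs.1, hs.2.trans_lt hr⟩)
      (isGreatest_Icc htE.1.1) (isLeast_Icc htr)
  have hcb : b < sSup E + ε := by
    by_contra! hcon
    have hmem : sSup E + ε / 2 ∈ E :=
      ⟨⟨by linarith [htE.1.1], by linarith⟩, hext _ (by linarith) (by linarith)⟩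
    linarith [le_csSup hbdd hmem]
  exact hext b htE.1.2 hcb ⟨le_rfl, hab.le⟩ ⟨hab.le, le_rfl⟩ hab

section TimeShift

variable {M : Type*} [TopologicalSpace M] (φ : Flow ℝ M) {X : Set M} {u : M → ℝ} {T : ℝ}

theorem timeShift_surjective (hinv : ∀ x ∈ X, ∀ t, φ t x ∈ X) (hu : ContinuousOn u X)
    (hT : ∀ x ∈ X, |u x| ≤ T) {x : M} (hx : x ∈ X) :
    Function.Surjective fun s => s + u (φ s x) := by
  have hc : Continuous fun s => s + u (φ s x) :=
    continuous_id.add (hu.comp_continuous (φ.continuous continuous_id continuous_const)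
      fun s => hinv x hx s)
  refine hc.surjective ?_ ?_
  · refine tendsto_atTop_mono (f := fun s => s + -T) (fun s => ?_)
      (tendsto_atTop_add_const_right _ _ tendsto_id)
    have := abs_le.1 (hT _ (hinv x hx s))
    linarith
  · refine tendsto_atBot_mono (g := fun s => s + u (φ s x)) (f := fun s => s + T) (fun s => ?_)
      (tendsto_atBot_add_const_right _ _ tendsto_id)
    have := abs_le.1 (hT _ (hinv x hx s))
    linarith

/-- A bounded continuous time shift which preserves the order on the orbits is a homeomorphism. -/
theorem exists_timeShift_homeo (hX : IsOpen X) (hinv : ∀ x ∈ X, ∀ t, φ t x ∈ X)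
    (hu : ContinuousOn u X) (hT : ∀ x ∈ X, |u x| ≤ T)
    (hmono : ∀ x ∈ X, StrictMono fun s => s + u (φ s x)) :
    ∃ Ψ : OpenPartialHomeomorph M M, Ψ.source = X ∧ Ψ.target = X ∧
      (∀ x ∈ X, Ψ x = φ (u x) x) ∧ ∀ x ∈ X, ∃ t, |t| ≤ T ∧ Ψ.symm x = φ t x := by
  classical
  have hsurj : ∀ x, ∃ s : ℝ, x ∈ X → s + u (φ s x) = 0 := fun x => by
    by_cases hx : x ∈ X
    · obtain ⟨s, hs⟩ := timeShift_surjective φ hinv hu hT hx 0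
      exact ⟨s, fun _ => hs⟩
    · exact ⟨0, fun h => (hx h).elim⟩
  choose v hv using hsurj
  have hvc : ContinuousOn v X := by
    intro x hx
    refine ContinuousAt.continuousWithinAt ?_
    have hval : ∀ a, ContinuousAt (fun z => a + u (φ a z)) x := fun a => by
      refine continuousAt_const.add (ContinuousAt.comp (f := fun z => φ a z) (g := u) ?_ ?_)
      · exact hu.continuousAt (hX.mem_nhds (hinv x hx a))
      · exact (φ.continuous continuous_const continuous_id).continuousAt
    refine tendsto_order.2 ⟨fun a ha => ?_, fun a ha => ?_⟩
    · have h1 : a + u (φ a x) < 0 := by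
        rw [← hv x hx]; exact hmono x hx ha
      filter_upwards [(hval a).eventually_lt_const h1, hX.mem_nhds hx] with z hz hzX
      by_contra hcon
      have := (hmono z hzX).monotone (not_lt.1 hcon)
      simp only [hv z hzX] at this
      linarith
    · have h1 : 0 < a + u (φ a x) := by
        rw [← hv x hx]; exact hmono x hx ha
      filter_upwards [(hval a).eventually_const_lt h1, hX.mem_nhds hx] with z hz hzX
      by_contra hcon
      have := (hmono z hzX).monotone (not_lt.1 hcon)
      simp only [hv z hzX] at this
      linarith
  have hvb : ∀ x ∈ X, |v x| ≤ T := fun x hx => by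
    have h1 := hv x hx
    have h2 := hT _ (hinv x hx (v x))
    rw [show v x = -u (φ (v x) x) by linarith, abs_neg]
    exact h2
  have hflow : Continuous fun q : ℝ × M => φ q.1 q.2 := φ.continuous continuous_fst continuous_snd
  refine ⟨{ toFun := fun x => φ (u x) x
            invFun := fun x => φ (v x) x
            source := X
            target := X
            map_source' := fun x hx => hinv x hx _
            map_target' := fun x hx => hinv x hx _
            left_inv' := fun x hx => ?_
            right_inv' := fun x hx => ?_
            open_source := hX
            open_target := hX
            continuousOn_toFun := hflow.comp_continuousOn (hu.prodMk continuousOn_id)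
            continuousOn_invFun := hflow.comp_continuousOn (hvc.prodMk continuousOn_id) },
    rfl, rfl, fun x _ => rfl, fun x hx => ⟨v x, hvb x hx, rfl⟩⟩
  · have h1 : v (φ (u x) x) = -u x := by
      apply (hmono _ (hinv x hx (u x))).injective
      simp only [hv _ (hinv x hx (u x))]
      rw [← φ.map_add, neg_add_cancel, φ.map_zero_apply, neg_add_cancel]
    rw [h1, ← φ.map_add, neg_add_cancel, φ.map_zero_apply]
  · rw [← φ.map_add, add_comm, hv x hx, φ.map_zero_apply]

end TimeShift

theorem Flow.eventually_nhdsSet_forall {M : Type*} [TopologicalSpace M] (φ : Flow ℝ M)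
    {γ : Set M} (hγ : ∀ x ∈ γ, ∀ t, φ t x ∈ γ) {O : Set M} (hO : O ∈ 𝓝ˢ γ) (T : ℝ) :
    ∀ᶠ x in 𝓝ˢ γ, ∀ t ∈ Icc (-T) T, φ t x ∈ O := by
  rw [eventually_nhdsSet_iff_forall]
  intro x hx
  have hO' := mem_nhdsSet_iff_forall.1 hO
  refine isCompact_Icc.eventually_forall_of_forall_eventually fun t _ => ?_
  exact ((φ.continuous continuous_snd continuous_fst).continuousAt (x := (x, t))).eventually
    (hO' _ (hγ x hx t))

/-! ### The model flow -/

section Model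

variable (a b : ℝ)

theorem saddleFlow_re (t : ℝ) (q : ℂ × UnitAddCircle) :
    (saddleFlow a b t q).1.re = Real.exp (a * t) * q.1.re := rfl

theorem saddleFlow_im (t : ℝ) (q : ℂ × UnitAddCircle) :
    (saddleFlow a b t q).1.im = Real.exp (b * t) * q.1.im := rfl

theorem saddleFlow_snd (t : ℝ) (q : ℂ × UnitAddCircle) :
    (saddleFlow a b t q).2 = q.2 + ((t : ℝ) : UnitAddCircle) := rfl

theorem saddleFlow_fst_eq_zero {t : ℝ} {q : ℂ × UnitAddCircle} :
    (saddleFlow a b t q).1 = 0 ↔ q.1 = 0 := by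
  simp [Complex.ext_iff, saddleFlow_re, saddleFlow_im]

theorem saddleFlow_injective (ha : a ≠ 0) (hb : b ≠ 0) {q : ℂ × UnitAddCircle} (hq : q.1 ≠ 0) :
    Function.Injective fun t => saddleFlow a b t q := by
  intro s t hst
  have h1 : Real.exp (a * s) * q.1.re = Real.exp (a * t) * q.1.re :=
    congr_arg (fun p : ℂ × UnitAddCircle => p.1.re) hst
  have h2 : Real.exp (b * s) * q.1.im = Real.exp (b * t) * q.1.im :=
    congr_arg (fun p : ℂ × UnitAddCircle => p.1.im) hst
  by_cases hre : q.1.re = 0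
  · have him : q.1.im ≠ 0 := fun h => hq (Complex.ext hre h)
    exact mul_left_cancel₀ hb (Real.exp_injective (mul_right_cancel₀ him h2))
  · exact mul_left_cancel₀ ha (Real.exp_injective (mul_right_cancel₀ hre h1))

theorem norm_saddleFlow_le {β : ℝ} (ha : |a| ≤ β) (hb : |b| ≤ β) (t : ℝ)
    (q : ℂ × UnitAddCircle) : ‖(saddleFlow a b t q).1‖ ≤ Real.exp (β * |t|) * ‖q.1‖ := by
  have hA : Real.exp (a * t) ≤ Real.exp (β * |t|) := Real.exp_le_exp.2 <|
    (le_abs_self _).trans (by rw [abs_mul]; gcongr)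
  have hB : Real.exp (b * t) ≤ Real.exp (β * |t|) := Real.exp_le_exp.2 <|
    (le_abs_self _).trans (by rw [abs_mul]; gcongr)
  refine le_of_sq_le_sq ?_ (by positivity)
  rw [mul_pow, Complex.sq_norm, Complex.sq_norm, Complex.normSq_apply, Complex.normSq_apply,
    saddleFlow_re, saddleFlow_im]
  have h1 : Real.exp (a * t) ^ 2 ≤ Real.exp (β * |t|) ^ 2 := by gcongr
  have h2 : Real.exp (b * t) ^ 2 ≤ Real.exp (β * |t|) ^ 2 := by gcongr
  nlinarith [mul_self_nonneg q.1.re, mul_self_nonneg q.1.im,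
    mul_le_mul_of_nonneg_right h1 (mul_self_nonneg q.1.re),
    mul_le_mul_of_nonneg_right h2 (mul_self_nonneg q.1.im)]

end Model

/-! ### Orbit segments -/

section Stay

variable {M : Type*} [TopologicalSpace M] {φ : Flow ℝ M} {U : Set M} {x : M}

theorem zero_mem_stayTimes (hx : x ∈ U) : (0 : ℝ) ∈ stayTimes φ U x := by
  intro s hs
  simp only [uIcc_self, mem_singleton_iff] at hs
  simpa [hs] using hx

theorem stayTimes_mem {t : ℝ} (ht : t ∈ stayTimes φ U x) : φ t x ∈ U := ht t right_mem_uIcc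

theorem ordConnected_stayTimes : (stayTimes φ U x).OrdConnected := by
  refine ⟨fun s hs t ht r hr z hz => ?_⟩
  rcases le_total 0 r with h | h
  · rw [uIcc_of_le h] at hz
    refine ht z ?_
    rw [uIcc_of_le (h.trans hr.2)]
    exact ⟨hz.1, hz.2.trans hr.2⟩
  · rw [uIcc_of_ge h] at hz
    refine hs z ?_
    rw [uIcc_of_ge (hr.1.trans h)]
    exact ⟨hr.1.trans hz.1, hz.2⟩

theorem add_mem_stayTimes {s t : ℝ} (hs : s ∈ stayTimes φ U x)
    (ht : t ∈ stayTimes φ U (φ s x)) : s + t ∈ stayTimes φ U x := by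
  intro r hr
  by_cases h : r ∈ uIcc 0 s
  · exact hs r h
  · have : r - s ∈ uIcc 0 t := by
      rw [mem_uIcc] at hr ⊢
      rw [mem_uIcc] at h
      push Not at h
      rcases hr with hr | hr
      · left
        constructor
        · by_contra hcon
          have := h.1 hr.1
          linarith
        · linarith
      · right
        constructor
        · linarith
        · by_contra hcon
          have := h.2 (by linarith)
          linarith
    have := ht _ this
    rwa [← φ.map_add, sub_add_cancel] at this

theorem stayTimes_univ_of_invariant (h : ∀ t, φ t x ∈ U) : stayTimes φ U x = univ :=
  eq_univ_of_forall fun _ s _ => h s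

theorem stayTimes_diff {γ : Set M} (h : ∀ t, φ t x ∉ γ) :
    stayTimes φ (U \ γ) x = stayTimes φ U x :=
  Set.ext fun _ => ⟨fun ht s hs => (ht s hs).1, fun ht s hs => ⟨ht s hs, h s⟩⟩

theorem Icc_subset_stayTimes {t : ℝ} (ht : 0 ≤ t) (h : ∀ s ∈ Icc 0 t, φ s x ∈ U) :
    t ∈ stayTimes φ U x := fun s hs => h s (by rwa [uIcc_of_le ht] at hs)

end Stay

/-- A strictly increasing map between intervals that is onto is continuous. -/
theorem StrictMonoOn.continuousOn_of_ordConnected_image {θ : ℝ → ℝ} {S : Set ℝ}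
    (h : StrictMonoOn θ S) (hS : S.OrdConnected) (hI : (θ '' S).OrdConnected) :
    ContinuousOn θ S := by
  rw [continuousOn_iff_continuous_domRestrict]
  exact continuous_subtype_val.comp (h.orderIso θ S).continuous

/-- The map `K` carries orbit segments in `S` to orbit segments, preserving the direction. -/
def CarriesOrbits {X Y : Type*} [TopologicalSpace X] [TopologicalSpace Y] (φ : Flow ℝ X)
    (ψ : Flow ℝ Y) (K : X → Y) (S : Set X) : Prop :=
  ∀ x t, 0 ≤ t → (∀ s ∈ Icc 0 t, φ s x ∈ S) → ∃ σ : ℝ → ℝ, σ 0 = 0 ∧ ContinuousOn σ (Icc 0 t) ∧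
    StrictMonoOn σ (Icc 0 t) ∧ ∀ s ∈ Icc 0 t, K (φ s x) = ψ (σ s) (K x)

section Carries

variable {X Y V : Type*} [TopologicalSpace X] [TopologicalSpace Y] [TopologicalSpace V]
  {φ : Flow ℝ X} {ψ : Flow ℝ Y} {χ : Flow ℝ V}

theorem CarriesOrbits.mono {K : X → Y} {S S' : Set X} (h : CarriesOrbits φ ψ K S)
    (hS : S' ⊆ S) : CarriesOrbits φ ψ K S' := fun x t ht hx =>
  h x t ht fun s hs => hS (hx s hs)

theorem CarriesOrbits.comp {K : X → Y} {K' : Y → V} {S : Set X} {S' : Set Y}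
    (h' : CarriesOrbits ψ χ K' S') (h : CarriesOrbits φ ψ K S) (hm : MapsTo K S S') :
    CarriesOrbits φ χ (K' ∘ K) S := by
  intro x t ht hx
  obtain ⟨σ, h0, hc, hmono, hσ⟩ := h x t ht hx
  have hpos : 0 ≤ σ t := h0 ▸ hmono.monotoneOn ⟨le_rfl, ht⟩ ⟨ht, le_rfl⟩ ht
  have himg : Icc 0 (σ t) ⊆ σ '' Icc 0 t := by
    simpa only [h0] using intermediate_value_Icc ht hc
  obtain ⟨σ', h0', hc', hmono', hσ'⟩ := h' (K x) (σ t) hpos fun r hr => by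
    obtain ⟨s, hs, rfl⟩ := himg hr
    rw [← hσ s hs]
    exact hm (hx s hs)
  have hmaps : MapsTo σ (Icc 0 t) (Icc 0 (σ t)) := fun s hs =>
    ⟨h0 ▸ hmono.monotoneOn ⟨le_rfl, ht⟩ hs hs.1, hmono.monotoneOn hs ⟨ht, le_rfl⟩ hs.2⟩
  exact ⟨σ' ∘ σ, by simp [h0, h0'], hc'.comp hc hmaps, hmono'.comp hmono hmaps, fun s hs => by
    simp only [Function.comp_apply, hσ s hs, hσ' _ (hmaps hs)]⟩

theorem IsLocalOrbitalEquivalence.symm {H : OpenPartialHomeomorph X Y}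
    (h : IsLocalOrbitalEquivalence φ ψ H) : IsLocalOrbitalEquivalence ψ φ H.symm := by
  intro y hy
  have hx : H.symm y ∈ H.source := H.map_target hy
  obtain ⟨θ, h0, hmono, himg, hθ⟩ := h _ hx
  rw [H.right_inv hy] at himg hθ
  have hinj := hmono.injOn
  set S := stayTimes φ H.source (H.symm y) with hS
  have hleft : ∀ t ∈ S, Function.invFunOn θ S (θ t) = t := fun t ht => hinj.leftInvOn_invFunOn ht
  refine ⟨Function.invFunOn θ S, ?_, ?_, ?_, ?_⟩
  · rw [← h0, hleft 0 (zero_mem_stayTimes hx), h0]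
  · rw [OpenPartialHomeomorph.symm_source, ← himg]
    rintro _ ⟨s, hs, rfl⟩ _ ⟨t, ht, rfl⟩ hst
    rw [hleft s hs, hleft t ht]
    exact (hmono.lt_iff_lt hs ht).1 hst
  · rw [OpenPartialHomeomorph.symm_source, OpenPartialHomeomorph.symm_target, ← himg, image_image]
    ext t
    constructor
    · rintro ⟨s, hs, rfl⟩
      simpa only [hleft s hs] using hs
    · intro ht
      exact ⟨t, ht, hleft t ht⟩
  · rw [OpenPartialHomeomorph.symm_source, ← himg]
    rintro _ ⟨s, hs, rfl⟩
    rw [hleft s hs, ← hθ s hs, H.left_inv (stayTimes_mem hs)]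

theorem IsLocalOrbitalEquivalence.carriesOrbits {H : OpenPartialHomeomorph X Y}
    (h : IsLocalOrbitalEquivalence φ ψ H) : CarriesOrbits φ ψ H H.source := by
  intro x t ht hx
  have hx0 : x ∈ H.source := by simpa using hx 0 ⟨le_rfl, ht⟩
  obtain ⟨θ, h0, hmono, himg, hθ⟩ := h x hx0
  have hsub : Icc 0 t ⊆ stayTimes φ H.source x :=
    ordConnected_stayTimes.out (zero_mem_stayTimes hx0) (Icc_subset_stayTimes ht hx)
  refine ⟨θ, h0, ?_, hmono.mono hsub, fun s hs => hθ s (hsub hs)⟩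
  exact (hmono.continuousOn_of_ordConnected_image ordConnected_stayTimes
    (himg ▸ ordConnected_stayTimes)).mono hsub

end Carries

/-! ### Periodic orbits and saddle charts -/

section Periodic

variable {M : Type*} [TopologicalSpace M] {φ : Flow ℝ M} {γ : Set M}

theorem IsPeriodicOrbit.flow_mem (hγ : IsPeriodicOrbit φ γ) {x : M} (hx : x ∈ γ) (t : ℝ) :
    φ t x ∈ γ := by
  obtain ⟨x₀, rfl, -⟩ := hγ
  obtain ⟨s, rfl⟩ := hx
  exact ⟨t + s, φ.map_add _ _ _⟩

theorem IsPeriodicOrbit.flow_mem_iff (hγ : IsPeriodicOrbit φ γ) {x : M} {t : ℝ} :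
    φ t x ∈ γ ↔ x ∈ γ := by
  refine ⟨fun h => ?_, fun h => hγ.flow_mem h t⟩
  have := hγ.flow_mem h (-t)
  rwa [← φ.map_add, neg_add_cancel, φ.map_zero_apply] at this

end Periodic

namespace SaddleChart

variable {M : Type*} [TopologicalSpace M] {φ : Flow ℝ M} {γ : Set M} (c : SaddleChart φ γ)

theorem mem_target_of_fst_eq_zero {q : ℂ × UnitAddCircle} (hq : q.1 = 0) : q ∈ c.chart.target := by
  have : q ∈ c.chart '' γ := c.image_eq ▸ hq
  obtain ⟨x, hx, rfl⟩ := this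
  exact c.chart.map_source (c.subset_source hx)

theorem fst_eq_zero_iff {x : M} (hx : x ∈ c.chart.source) : (c.chart x).1 = 0 ↔ x ∈ γ := by
  constructor
  · intro h
    have : c.chart x ∈ c.chart '' γ := c.image_eq ▸ h
    obtain ⟨y, hy, hxy⟩ := this
    rwa [← c.chart.injOn (c.subset_source hy) hx hxy]
  · intro h
    have : c.chart x ∈ c.chart '' γ := mem_image_of_mem _ h
    rwa [c.image_eq] at this

theorem symm_mem_iff {q : ℂ × UnitAddCircle} (hq : q ∈ c.chart.target) :
    c.chart.symm q ∈ γ ↔ q.1 = 0 := by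
  rw [← c.fst_eq_zero_iff (c.chart.map_target hq), c.chart.right_inv hq]

theorem source_mem_nhdsSet : c.chart.source ∈ 𝓝ˢ γ :=
  c.chart.open_source.mem_nhdsSet.2 c.subset_source

/-- Neighbourhoods of `γ` contain the preimages of thin tubes around `{0} × ℝ/ℤ`. -/
theorem exists_tube_subset {O : Set M} (hO : O ∈ 𝓝ˢ γ) :
    ∃ ε > 0, ∀ q : ℂ × UnitAddCircle, ‖q.1‖ < ε → q ∈ c.chart.target ∧ c.chart.symm q ∈ O := by
  have hev : ∀ z ∈ (univ : Set UnitAddCircle), ∀ᶠ p : ℂ × UnitAddCircle in 𝓝 (0, z),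
      p ∈ c.chart.target ∧ c.chart.symm p ∈ O := by
    intro z _
    have hz : ((0 : ℂ), z) ∈ c.chart.target := c.mem_target_of_fst_eq_zero rfl
    refine (c.chart.open_target.eventually_mem hz).and ?_
    exact (c.chart.continuousAt_symm hz).eventually
      (mem_nhdsSet_iff_forall.1 hO _ ((c.symm_mem_iff hz).2 rfl))
  have := isCompact_univ.eventually_forall_of_forall_eventually (x₀ := (0 : ℂ))
    (P := fun v z => (v, z) ∈ c.chart.target ∧ c.chart.symm (v, z) ∈ O) hev
  obtain ⟨ε, hε, h⟩ := Metric.eventually_nhds_iff.1 this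
  exact ⟨ε, hε, fun q hq => h (by simpa [dist_eq_norm] using hq) q.2 (mem_univ _)⟩

theorem eventually_norm_lt {ε : ℝ} (hε : 0 < ε) :
    ∀ᶠ x in 𝓝ˢ γ, x ∈ c.chart.source ∧ ‖(c.chart x).1‖ < ε := by
  rw [eventually_nhdsSet_iff_forall]
  intro x hx
  have hxs := c.subset_source hx
  refine (c.chart.open_source.eventually_mem hxs).and ?_
  have h0 : ‖(c.chart x).1‖ < ε := by rw [(c.fst_eq_zero_iff hxs).2 hx]; simpa using hε
  exact ((continuous_fst.norm.continuousAt).comp (c.chart.continuousAt hxs)).eventually_lt_const h0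

theorem eventually_nhdsSet_iff {P : M → Prop} : (∀ᶠ x in 𝓝ˢ γ, P x) ↔
    ∃ ε > 0, ∀ q : ℂ × UnitAddCircle, ‖q.1‖ < ε → q ∈ c.chart.target ∧ P (c.chart.symm q) := by
  refine ⟨fun h => c.exists_tube_subset h, fun ⟨ε, hε, h⟩ => ?_⟩
  filter_upwards [c.eventually_norm_lt hε] with x hx
  simpa [c.chart.left_inv hx.1] using (h _ hx.2).2

theorem isCompact_orbit (c : SaddleChart φ γ) : IsCompact γ := by
  have h : γ = c.chart.symm '' (({0} : Set ℂ) ×ˢ univ) := by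
    ext x
    constructor
    · intro hx
      refine ⟨c.chart x, ⟨(c.fst_eq_zero_iff (c.subset_source hx)).2 hx, mem_univ _⟩,
        c.chart.left_inv (c.subset_source hx)⟩
    · rintro ⟨q, ⟨hq, -⟩, rfl⟩
      exact (c.symm_mem_iff (c.mem_target_of_fst_eq_zero hq)).2 hq
  rw [h]
  refine (isCompact_singleton.prod isCompact_univ).image_of_continuousOn ?_
  exact c.chart.continuousOn_symm.mono fun q hq => c.mem_target_of_fst_eq_zero hq.1

/-- The model flow of a saddle chart. -/
abbrev model : Flow ℝ (ℂ × UnitAddCircle) := saddleFlow c.a c.b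

theorem model_injective {q : ℂ × UnitAddCircle} (hq : q.1 ≠ 0) :
    Function.Injective fun t => c.model t q :=
  saddleFlow_injective _ _ c.a_neg.ne c.b_pos.ne' hq

open Classical in
/-- The time of the model flow, as a function of the time of `φ` along the orbit of `x` in the
chart. -/
def clock (x : M) : ℝ → ℝ :=
  if hx : x ∈ c.chart.source then (c.orbital x hx).choose else 0

variable {c} {x : M}

theorem clock_zero (hx : x ∈ c.chart.source) : c.clock x 0 = 0 := by
  rw [clock, dif_pos hx]; exact (c.orbital x hx).choose_spec.1

theorem strictMonoOn_clock (hx : x ∈ c.chart.source) :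
    StrictMonoOn (c.clock x) (stayTimes φ c.chart.source x) := by
  rw [clock, dif_pos hx]; exact (c.orbital x hx).choose_spec.2.1

theorem image_clock (hx : x ∈ c.chart.source) :
    c.clock x '' stayTimes φ c.chart.source x =
      stayTimes c.model c.chart.target (c.chart x) := by
  rw [clock, dif_pos hx]; exact (c.orbital x hx).choose_spec.2.2.1

theorem chart_flow (hx : x ∈ c.chart.source) {t : ℝ} (ht : t ∈ stayTimes φ c.chart.source x) :
    c.chart (φ t x) = c.model (c.clock x t) (c.chart x) := by
  rw [clock, dif_pos hx]; exact (c.orbital x hx).choose_spec.2.2.2 t ht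

theorem continuousOn_clock (hx : x ∈ c.chart.source) :
    ContinuousOn (c.clock x) (stayTimes φ c.chart.source x) :=
  (strictMonoOn_clock hx).continuousOn_of_ordConnected_image ordConnected_stayTimes
    (image_clock hx ▸ ordConnected_stayTimes)

theorem clock_add (hx : x ∈ c.chart.source) (hxγ : x ∉ γ) {s t : ℝ}
    (hs : s ∈ stayTimes φ c.chart.source x)
    (ht : t ∈ stayTimes φ c.chart.source (φ s x)) :
    c.clock x (s + t) = c.clock x s + c.clock (φ s x) t := by
  have h0 : (c.chart x).1 ≠ 0 := fun h => hxγ ((c.fst_eq_zero_iff hx).1 h)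
  apply c.model_injective h0
  simp only
  rw [← chart_flow hx (add_mem_stayTimes hs ht), add_comm s t, φ.map_add,
    chart_flow (stayTimes_mem hs) ht, chart_flow hx hs, ← Flow.map_add, add_comm]

/-- The clock reading at a fixed time depends continuously on the orbit. -/
theorem continuousAt_clock {T : ℝ} (hT : T ∈ stayTimes φ c.chart.source x) :
    ContinuousAt (fun y => c.clock y T) x := by
  have hmem : ∀ s : unitInterval, ∀ y, T ∈ stayTimes φ c.chart.source y →
      s * T ∈ stayTimes φ c.chart.source y := fun s y hy => by
    have h0 : (0 : ℝ) ∈ stayTimes φ c.chart.source y :=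
      zero_mem_stayTimes (by simpa using hy 0 left_mem_uIcc)
    refine ordConnected_stayTimes.uIcc_subset h0 hy ?_
    rw [mem_uIcc]
    rcases le_total 0 T with h | h
    · exact Or.inl ⟨mul_nonneg s.2.1 h, mul_le_of_le_one_left h s.2.2⟩
    · exact Or.inr ⟨by nlinarith [s.2.1, s.2.2], by nlinarith [s.2.1, s.2.2]⟩
  set A : Set M := {y | T ∈ stayTimes φ c.chart.source y} with hA
  have hAs : ∀ y ∈ A, y ∈ c.chart.source := fun y hy => by simpa using hy 0 left_mem_uIcc
  have hAo : A ∈ 𝓝 x := by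
    have := isCompact_uIcc.eventually_forall_of_forall_eventually (x₀ := x) (K := uIcc 0 T)
      (P := fun y s => φ s y ∈ c.chart.source) fun s hs =>
        ((φ.continuous continuous_snd continuous_fst).continuousAt (x := (x, s))).eventually
          (c.chart.open_source.mem_nhds (hT s hs))
    exact this
  have hflow : Continuous fun q : unitInterval × A => φ (q.1 * T) (q.2 : M) :=
    φ.continuous (by fun_prop) (by fun_prop)
  have hsrc : ∀ q : unitInterval × A, φ (q.1 * T) (q.2 : M) ∈ c.chart.source := fun q =>
    stayTimes_mem (hmem q.1 q.2 q.2.2)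
  have hch : Continuous fun q : unitInterval × A => c.chart (φ (q.1 * T) (q.2 : M)) :=
    c.chart.continuousOn.comp_continuous hflow hsrc
  have hch0 : Continuous fun q : unitInterval × A => c.chart (q.2 : M) :=
    c.chart.continuousOn.comp_continuous (by fun_prop) fun q => hAs _ q.2.2
  let f : C(unitInterval × A, UnitAddCircle) :=
    ⟨fun q => (c.chart (φ (q.1 * T) (q.2 : M))).2 - (c.chart (q.2 : M)).2,
      hch.snd.sub hch0.snd⟩
  -- the clock lifts the increment of the circle coordinate, and lifts of paths depend continuously
  -- on parameters
  have hcov := AddCircle.isCoveringMap_coe (1 : ℝ)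
  have := hcov.isLocalHomeomorph.continuous_lift hcov.isSeparatedMap f
    (g := fun q => c.clock q.2 (q.1 * T)) (by
      ext q
      simp only [Function.comp_apply, f, ContinuousMap.coe_mk]
      rw [chart_flow (hAs _ q.2.2) (hmem q.1 q.2 q.2.2), saddleFlow_snd, add_sub_cancel_left])
    (by simpa using continuous_const.congr fun a : A => (clock_zero (hAs a a.2)).symm)
    (fun a => (continuousOn_clock (hAs a a.2)).comp_continuous (by fun_prop)
      fun s => hmem s a a.2)
  have h2 : ContinuousOn (fun y => c.clock y T) A := by
    rw [continuousOn_iff_continuous_domRestrict]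
    exact (this.comp (Continuous.prodMk_right (1 : unitInterval))).congr fun a => by simp
  exact h2.continuousAt hAo

end SaddleChart

/-! ### Equivalences between punctured tubes, and their lifts -/

/-- The punctured tube of radius `exp ℓ` around the periodic orbit of the model. -/
def puncturedTube (ℓ : ℝ) : Set (ℂ × UnitAddCircle) := {q | q.1 ≠ 0 ∧ ‖q.1‖ < Real.exp ℓ}

/-- The half space that is the universal cover of `puncturedTube ℓ`, in logarithmic coordinates. -/
def logTube (ℓ : ℝ) : Set (ℂ × ℝ) := {x | x.1.re < ℓ}

/-- The universal covering of the complement of the periodic orbit of the model. -/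
def logCover (x : ℂ × ℝ) : ℂ × UnitAddCircle := (Complex.exp x.1, (x.2 : UnitAddCircle))

/-- The deck transformations of `logCover`: `i` turns along the meridian and `j` turns along the
longitude. -/
def deck (i j : ℤ) (x : ℂ × ℝ) : ℂ × ℝ := (x.1 + i * (2 * Real.pi * Complex.I), x.2 + j)

theorem isOpen_puncturedTube (ℓ : ℝ) : IsOpen (puncturedTube ℓ) :=
  (isOpen_ne.preimage continuous_fst).inter (isOpen_lt continuous_fst.norm continuous_const)

theorem puncturedTube_mono {ℓ ℓ' : ℝ} (h : ℓ ≤ ℓ') : puncturedTube ℓ ⊆ puncturedTube ℓ' :=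
  fun _ hq => ⟨hq.1, hq.2.trans_le (Real.exp_le_exp.2 h)⟩

theorem isOpen_logTube (ℓ : ℝ) : IsOpen (logTube ℓ) :=
  isOpen_lt (Complex.continuous_re.comp continuous_fst) continuous_const

theorem convex_logTube (ℓ : ℝ) : Convex ℝ (logTube ℓ) :=
  convex_halfSpace_lt (f := fun x : ℂ × ℝ => x.1.re) ⟨fun _ _ => rfl, fun _ _ => by simp⟩ ℓ

theorem logTube_mono {ℓ ℓ' : ℝ} (h : ℓ ≤ ℓ') : logTube ℓ ⊆ logTube ℓ' :=
  fun _ hx => lt_of_lt_of_le hx h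

theorem continuous_logCover : Continuous logCover :=
  (Complex.continuous_exp.comp continuous_fst).prodMk
    ((AddCircle.continuous_mk' 1).comp continuous_snd)

theorem logCover_mem {ℓ : ℝ} {x : ℂ × ℝ} : logCover x ∈ puncturedTube ℓ ↔ x ∈ logTube ℓ := by
  simp [logCover, puncturedTube, logTube, Complex.norm_exp]

theorem exists_logCover_eq {q : ℂ × UnitAddCircle} (hq : q.1 ≠ 0) : ∃ x, logCover x = q := by
  obtain ⟨z, hz⟩ := QuotientAddGroup.mk_surjective q.2
  exact ⟨(Complex.log q.1, z), Prod.ext (Complex.exp_log hq) hz⟩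

theorem isOpenMap_logCover : IsOpenMap logCover := by
  have h1 : IsOpenMap Complex.exp := Complex.isOpenMap_exp
  have h2 : IsOpenMap ((↑) : ℝ → UnitAddCircle) := QuotientAddGroup.isOpenMap_coe
  exact h1.prodMap h2

theorem logCover_eq_iff {x y : ℂ × ℝ} : logCover x = logCover y ↔ ∃ i j, x = deck i j y := by
  simp only [logCover, Complex.exp_eq_exp_iff_exists_int, circle_coe_eq_iff, deck,
    Prod.ext_iff, exists_and_left, exists_and_right]

theorem logCover_deck (i j : ℤ) (x : ℂ × ℝ) : logCover (deck i j x) = logCover x :=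
  logCover_eq_iff.2 ⟨i, j, rfl⟩

@[simp] theorem deck_re (i j : ℤ) (x : ℂ × ℝ) : (deck i j x).1.re = x.1.re := by simp [deck]

@[simp] theorem deck_im (i j : ℤ) (x : ℂ × ℝ) :
    (deck i j x).1.im = x.1.im + 2 * Real.pi * i := by simp [deck, mul_comm]

@[simp] theorem deck_snd (i j : ℤ) (x : ℂ × ℝ) : (deck i j x).2 = x.2 + j := rfl

theorem logPoint_ext {x y : ℂ × ℝ} (h1 : x.1.re = y.1.re) (h2 : x.1.im = y.1.im)
    (h3 : x.2 = y.2) : x = y := Prod.ext (Complex.ext h1 h2) h3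

theorem deck_deck (i j i' j' : ℤ) (x : ℂ × ℝ) :
    deck i j (deck i' j' x) = deck (i + i') (j + j') x := by
  apply logPoint_ext <;> simp <;> ring

theorem deck_injective {i j i' j' : ℤ} {x : ℂ × ℝ} (h : deck i j x = deck i' j' x) :
    i = i' ∧ j = j' := by
  have h1 : (deck i j x).1.im = (deck i' j' x).1.im := by rw [h]
  have h2 : (deck i j x).2 = (deck i' j' x).2 := by rw [h]
  simp only [deck_im, deck_snd, add_right_inj] at h1 h2
  exact ⟨by exact_mod_cast mul_left_cancel₀ (by positivity) h1, by exact_mod_cast h2⟩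

theorem deck_mem {ℓ : ℝ} {i j : ℤ} {x : ℂ × ℝ} : deck i j x ∈ logTube ℓ ↔ x ∈ logTube ℓ := by
  simp [logTube]

theorem continuous_deck (i j : ℤ) : Continuous (deck i j) := by unfold deck; fun_prop

theorem deck_zero (x : ℂ × ℝ) : deck 0 0 x = x := by simp [deck]

/-- Two lifts of the same map on a preconnected set differ by a deck transformation. -/
theorem IsPreconnected.exists_deck {X : Type*} [TopologicalSpace X] {U : Set X}
    (hU : IsPreconnected U) {f g : X → ℂ × ℝ} (hf : ContinuousOn f U) (hg : ContinuousOn g U)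
    (h : ∀ x ∈ U, logCover (f x) = logCover (g x)) :
    ∃ i j, ∀ x ∈ U, f x = deck i j (g x) := by
  obtain ⟨i, hi⟩ := hU.exists_int_of_log_lifts (f := fun x => (f x).1) (g := fun x => (g x).1)
    hf.fst hg.fst fun x hx => congr_arg Prod.fst (h x hx)
  obtain ⟨j, hj⟩ := hU.exists_int_of_circle_lifts (f := fun x => (f x).2) (g := fun x => (g x).2)
    hf.snd hg.snd fun x hx => congr_arg Prod.snd (h x hx)
  exact ⟨i, j, fun x hx => Prod.ext (hi x hx) (hj x hx)⟩

theorem exists_logCover_lift {X : Type*} [NormedAddCommGroup X] [NormedSpace ℝ X] {U : Set X}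
    (hU : Convex ℝ U) {f : X → ℂ × UnitAddCircle} (hf : ContinuousOn f U)
    (h0 : ∀ x ∈ U, (f x).1 ≠ 0) :
    ∃ F : X → ℂ × ℝ, ContinuousOn F U ∧ ∀ x ∈ U, logCover (F x) = f x := by
  obtain ⟨L, hL, hL'⟩ := exists_log_lift hU hf.fst h0
  obtain ⟨Z, hZ, hZ'⟩ := exists_circle_lift hU hf.snd
  exact ⟨fun x => (L x, Z x), hL.prodMk hZ, fun x hx => Prod.ext (hL' x hx) (hZ' x hx)⟩

/-- A germ, at the punctured periodic orbits, of orbit preserving homeomorphisms between two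
models. The values of the two inverse maps away from the tubes play no role. -/
structure PuncturedEquiv (a₁ b₁ a₂ b₂ : ℝ) where
  toFun : ℂ × UnitAddCircle → ℂ × UnitAddCircle
  invFun : ℂ × UnitAddCircle → ℂ × UnitAddCircle
  ℓ₁ : ℝ
  ℓ₂ : ℝ
  cont : ContinuousOn toFun (puncturedTube ℓ₁)
  cont_inv : ContinuousOn invFun (puncturedTube ℓ₂)
  ne_zero : ∀ q ∈ puncturedTube ℓ₁, (toFun q).1 ≠ 0
  ne_zero_inv : ∀ q ∈ puncturedTube ℓ₂, (invFun q).1 ≠ 0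
  left_inv : ∀ q ∈ puncturedTube ℓ₁, invFun (toFun q) = q
  right_inv : ∀ q ∈ puncturedTube ℓ₂, toFun (invFun q) = q
  tends : ∀ r, ∃ r' ≤ ℓ₁, ∀ q ∈ puncturedTube r', toFun q ∈ puncturedTube r
  tends_inv : ∀ r, ∃ r' ≤ ℓ₂, ∀ q ∈ puncturedTube r', invFun q ∈ puncturedTube r
  orbits : CarriesOrbits (saddleFlow a₁ b₁) (saddleFlow a₂ b₂) toFun (puncturedTube ℓ₁)
  orbits_inv : CarriesOrbits (saddleFlow a₂ b₂) (saddleFlow a₁ b₁) invFun (puncturedTube ℓ₂)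

namespace PuncturedEquiv

variable {a₁ b₁ a₂ b₂ : ℝ}

/-- The inverse equivalence. -/
def symm (E : PuncturedEquiv a₁ b₁ a₂ b₂) : PuncturedEquiv a₂ b₂ a₁ b₁ where
  toFun := E.invFun
  invFun := E.toFun
  ℓ₁ := E.ℓ₂
  ℓ₂ := E.ℓ₁
  cont := E.cont_inv
  cont_inv := E.cont
  ne_zero := E.ne_zero_inv
  ne_zero_inv := E.ne_zero
  left_inv := E.right_inv
  right_inv := E.left_inv
  tends := E.tends_inv
  tends_inv := E.tends
  orbits := E.orbits_inv
  orbits_inv := E.orbits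

/-- Points of the stable manifold are sent to points of the stable manifold: their orbits converge to
the periodic orbit, which the orbits off the stable manifold do not. -/
theorem im_eq_zero (E : PuncturedEquiv a₁ b₁ a₂ b₂) (ha₁ : a₁ < 0) (hb₂ : 0 < b₂)
    {q : ℂ × UnitAddCircle} (hq : q ∈ puncturedTube E.ℓ₁) (him : q.1.im = 0) :
    (E.toFun q).1.im = 0 := by
  have hnorm : ∀ t, ‖(saddleFlow a₁ b₁ t q).1‖ = Real.exp (a₁ * t) * ‖q.1‖ := fun t => by
    have : (saddleFlow a₁ b₁ t q).1 = (Real.exp (a₁ * t) : ℝ) * q.1 := by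
      apply Complex.ext
      · rw [Complex.re_ofReal_mul, saddleFlow_re]
      · rw [Complex.im_ofReal_mul, saddleFlow_im, him, mul_zero, mul_zero]
    rw [this, norm_mul, Complex.norm_real, Real.norm_of_nonneg (Real.exp_pos _).le]
  by_contra hne
  obtain ⟨r', -, hr'⟩ := E.tends (Real.log |(E.toFun q).1.im|)
  have hlim : Tendsto (fun t => Real.exp (a₁ * t) * ‖q.1‖) atTop (𝓝 0) := by
    have h1 : Tendsto (fun t => a₁ * t) atTop atBot := tendsto_id.const_mul_atTop_of_neg ha₁
    simpa using (Real.tendsto_exp_atBot.comp h1).mul_const ‖q.1‖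
  obtain ⟨t, ht, ht0⟩ := ((hlim.eventually_lt_const (Real.exp_pos r')).and
    (eventually_ge_atTop 0)).exists
  obtain ⟨σ, h0, -, hmono, hσ⟩ := E.orbits q t ht0 fun s hs =>
    ⟨(saddleFlow_fst_eq_zero _ _).not.2 hq.1, by
      rw [hnorm]
      refine lt_of_le_of_lt (mul_le_of_le_one_left (norm_nonneg _) ?_) hq.2
      exact Real.exp_le_one_iff.2 (mul_nonpos_of_nonpos_of_nonneg ha₁.le hs.1)⟩
  have hσ0 : 0 ≤ σ t := h0 ▸ hmono.monotoneOn ⟨le_rfl, ht0⟩ ⟨ht0, le_rfl⟩ ht0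
  have h2 := (hr' (saddleFlow a₁ b₁ t q) ⟨(saddleFlow_fst_eq_zero _ _).not.2 hq.1, by
    rwa [hnorm]⟩).2
  rw [hσ t ⟨ht0, le_rfl⟩, Real.exp_log (abs_pos.2 hne)] at h2
  have h3 := (Complex.abs_im_le_norm _).trans_lt h2
  rw [saddleFlow_im, abs_mul, abs_of_pos (Real.exp_pos _)] at h3
  have h4 : 1 ≤ Real.exp (b₂ * σ t) := Real.one_le_exp (by positivity)
  nlinarith [abs_nonneg (E.toFun q).1.im]

end PuncturedEquiv

/-- A lift of a germ of equivalences to the universal covers. The integers describe its action on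
the homology of the punctured tube: the meridian is sent to `merid` meridians and `twist`
longitudes, and the longitude is sent to `long` longitudes. -/
structure TubeLift {a₁ b₁ a₂ b₂ : ℝ} (E : PuncturedEquiv a₁ b₁ a₂ b₂) where
  toFun : ℂ × ℝ → ℂ × ℝ
  cont : ContinuousOn toFun (logTube E.ℓ₁)
  lifts : ∀ x ∈ logTube E.ℓ₁, logCover (toFun x) = E.toFun (logCover x)
  merid : ℤ
  twist : ℤ
  long : ℤ
  equivariant : ∀ x ∈ logTube E.ℓ₁, ∀ i j : ℤ,
    toFun (deck i j x) = deck (merid * i) (twist * i + long * j) (toFun x)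

namespace PuncturedEquiv

variable {a₁ b₁ a₂ b₂ : ℝ} (E : PuncturedEquiv a₁ b₁ a₂ b₂)

/-- On a plane covering a half of the stable manifold, the angular coordinate of a lift is
constant. -/
theorem exists_im_lift_eq (ha₁ : a₁ < 0) (hb₂ : 0 < b₂) {Φ : ℂ × ℝ → ℂ × ℝ}
    (hc : ContinuousOn Φ (logTube E.ℓ₁))
    (hl : ∀ x ∈ logTube E.ℓ₁, logCover (Φ x) = E.toFun (logCover x)) (j : ℤ) :
    ∃ k : ℤ, ∀ x ∈ logTube E.ℓ₁, x.1.im = j * Real.pi → (Φ x).1.im = k * Real.pi := by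
  set U : Set (ℂ × ℝ) := logTube E.ℓ₁ ∩ {x | x.1.im = j * Real.pi} with hU
  have hconv : Convex ℝ U := (convex_logTube _).inter
    (convex_hyperplane (f := fun x : ℂ × ℝ => x.1.im) ⟨fun _ _ => rfl, fun _ _ => by simp⟩ _)
  have hint : ∀ x ∈ U, ∃ k : ℤ, (Φ x).1.im / Real.pi = k := by
    intro x hx
    have h1 : (logCover x).1.im = 0 := by
      simp only [logCover, Complex.exp_im]
      rw [show x.1.im = j * Real.pi from hx.2, Real.sin_int_mul_pi, mul_zero]
    have h2 := E.im_eq_zero ha₁ hb₂ (logCover_mem.2 hx.1) h1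
    rw [← hl x hx.1] at h2
    simp only [logCover, Complex.exp_im, mul_eq_zero, Real.exp_ne_zero, false_or] at h2
    obtain ⟨k, hk⟩ := Real.sin_eq_zero_iff.1 h2
    exact ⟨k, by rw [← hk]; field_simp⟩
  have hx₀ : ((⟨E.ℓ₁ - 1, j * Real.pi⟩ : ℂ), (0 : ℝ)) ∈ U := ⟨by simp [logTube], rfl⟩
  obtain ⟨k, hk⟩ := hint _ hx₀
  refine ⟨k, fun x hx him => ?_⟩
  have := hconv.isPreconnected.eq_of_int_valued (f := fun x => (Φ x).1.im / Real.pi)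
    ((Complex.continuous_im.comp_continuousOn (hc.mono inter_subset_left).fst).div_const _)
    hint ⟨hx, him⟩ hx₀
  rw [hk, div_eq_iff Real.pi_ne_zero] at this
  exact this

theorem exists_tubeLift (ha₁ : a₁ < 0) (hb₂ : 0 < b₂) : Nonempty (TubeLift E) := by
  obtain ⟨Φ, hc, hl⟩ := exists_logCover_lift (convex_logTube E.ℓ₁)
    (f := fun x => E.toFun (logCover x))
    (E.cont.comp continuous_logCover.continuousOn fun x hx => logCover_mem.2 hx)
    (fun x hx => E.ne_zero _ (logCover_mem.2 hx))
  have hdeck : ∀ i j : ℤ, ∃ i' j' : ℤ, ∀ x ∈ logTube E.ℓ₁, Φ (deck i j x) = deck i' j' (Φ x) :=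
    fun i j => (convex_logTube E.ℓ₁).isPreconnected.exists_deck
      (f := fun x => Φ (deck i j x))
      (hc.comp (continuous_deck i j).continuousOn fun x hx => deck_mem.2 hx) hc fun x hx => by
        rw [hl _ (deck_mem.2 hx), hl x hx, logCover_deck]
  have hx₀ : ((⟨E.ℓ₁ - 1, 0⟩ : ℂ), (0 : ℝ)) ∈ logTube E.ℓ₁ := by simp [logTube]
  choose P Q hPQ using hdeck
  have hadd : ∀ i j i' j', P (i + i') (j + j') = P i j + P i' j' ∧
      Q (i + i') (j + j') = Q i j + Q i' j' := fun i j i' j' => by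
    apply deck_injective (x := Φ ((⟨E.ℓ₁ - 1, 0⟩ : ℂ), (0 : ℝ)))
    rw [← hPQ _ _ _ hx₀, ← deck_deck, ← deck_deck, hPQ _ _ _ (deck_mem.2 hx₀), hPQ _ _ _ hx₀]
  let PA : ℤ × ℤ →+ ℤ := AddMonoidHom.mk' (fun v => P v.1 v.2) fun v w => (hadd _ _ _ _).1
  let QA : ℤ × ℤ →+ ℤ := AddMonoidHom.mk' (fun v => Q v.1 v.2) fun v w => (hadd _ _ _ _).2
  have hlin : ∀ (f : ℤ × ℤ →+ ℤ) (i j : ℤ), f (i, j) = f (1, 0) * i + f (0, 1) * j := by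
    intro f i j
    have : ((i, j) : ℤ × ℤ) = i • (1, 0) + j • (0, 1) := by simp
    rw [this, map_add, map_zsmul, map_zsmul, smul_eq_mul, smul_eq_mul, mul_comm, mul_comm j]
  -- on a plane over the stable manifold the angle is constant, so the longitude is sent to a multiple
  -- of the longitude
  have hP01 : P 0 1 = 0 := by
    obtain ⟨k, hk⟩ := E.exists_im_lift_eq ha₁ hb₂ hc hl 0
    have h1 := hk _ hx₀ (by simp)
    have h2 := hk _ (deck_mem (i := 0) (j := 1).2 hx₀) (by simp [deck])
    rw [hPQ _ _ _ hx₀, deck_im, h1] at h2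
    have : (P 0 1 : ℝ) = 0 := by
      have hpi := Real.pi_pos
      nlinarith
    exact_mod_cast this
  refine ⟨⟨Φ, hc, hl, P 1 0, Q 1 0, Q 0 1, fun x hx i j => ?_⟩⟩
  rw [hPQ i j x hx]
  have h1 := hlin PA i j
  have h2 := hlin QA i j
  simp only [PA, QA, AddMonoidHom.mk'_apply] at h1 h2
  rw [h1, h2, hP01, zero_mul, add_zero]

end PuncturedEquiv

namespace TubeLift

variable {a₁ b₁ a₂ b₂ : ℝ} {E : PuncturedEquiv a₁ b₁ a₂ b₂}

/-- Along the stable manifold, a lift sends orbits to orbits. -/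
theorem slice_flow (T : TubeLift E) (ha₁ : a₁ < 0) (hb₂ : 0 < b₂) {x : ℂ × ℝ} (hx : x ∈ logTube E.ℓ₁) {j : ℤ}
    (him : x.1.im = j * Real.pi) {t : ℝ} (ht : 0 ≤ t) : ∃ σ : ℝ, 0 ≤ σ ∧ (0 < t → 0 < σ) ∧
      T.toFun (x.1 + (a₁ * t : ℝ), x.2 + t) =
        ((T.toFun x).1 + (a₂ * σ : ℝ), (T.toFun x).2 + σ) := by
  -- the model flow is a translation on the planes that cover the stable manifold
  have hcov : ∀ (a b : ℝ) (y : ℂ × ℝ) (k : ℤ) (s : ℝ), y.1.im = k * Real.pi →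
      logCover (y.1 + (a * s : ℝ), y.2 + s) = saddleFlow a b s (logCover y) := by
    intro a b y k s hy
    have hsin : Real.sin y.1.im = 0 := by rw [hy, Real.sin_int_mul_pi]
    refine Prod.ext (Complex.ext ?_ ?_) ?_
    · simp only [logCover, saddleFlow_re, Complex.exp_re, Complex.add_re, Complex.add_im,
        Complex.ofReal_re, Complex.ofReal_im, add_zero, Real.exp_add]
      ring
    · simp only [logCover, saddleFlow_im, Complex.exp_im, Complex.add_re, Complex.add_im,
        Complex.ofReal_re, Complex.ofReal_im, add_zero, hsin, mul_zero]
    · simp [logCover, saddleFlow_snd]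
  obtain ⟨k, hk⟩ := E.exists_im_lift_eq ha₁ hb₂ T.cont T.lifts j
  have hmem : ∀ s ∈ Icc 0 t, (x.1 + (a₁ * s : ℝ), x.2 + s) ∈ logTube E.ℓ₁ := fun s hs => by
    have := mul_nonpos_of_nonpos_of_nonneg ha₁.le hs.1
    simp only [logTube, mem_ofPred_eq, Complex.add_re, Complex.ofReal_re] at hx ⊢
    linarith
  obtain ⟨σ, h0, hc, hmono, hσ⟩ := E.orbits (logCover x) t ht fun s hs => by
    rw [← hcov a₁ b₁ x j s him]
    exact logCover_mem.2 (hmem s hs)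
  obtain ⟨i, j', hij⟩ := isPreconnected_Icc.exists_deck
    (f := fun s => T.toFun (x.1 + (a₁ * s : ℝ), x.2 + s))
    (g := fun s => ((T.toFun x).1 + (a₂ * σ s : ℝ), (T.toFun x).2 + σ s))
    (T.cont.comp (Continuous.continuousOn (by fun_prop)) hmem)
    (by fun_prop) fun s hs => by
      rw [T.lifts _ (hmem s hs), hcov a₁ b₁ x j s him, hσ s hs, hcov a₂ b₂ _ k _ (hk x hx him),
        T.lifts x hx]
  have hz := hij 0 ⟨le_rfl, ht⟩
  simp only [mul_zero, Complex.ofReal_zero, add_zero, h0, Prod.mk.eta] at hz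
  obtain ⟨rfl, rfl⟩ := deck_injective ((deck_zero _).trans hz)
  refine ⟨σ t, h0 ▸ hmono.monotoneOn ⟨le_rfl, ht⟩ ⟨ht, le_rfl⟩ ht,
    fun h => h0 ▸ hmono ⟨le_rfl, ht⟩ ⟨ht, le_rfl⟩ h, ?_⟩
  have := hij t ⟨ht, le_rfl⟩
  rwa [deck_zero] at this

/-- The composition of a lift and a lift of the inverse is a deck transformation. -/
theorem exists_symm_comp (T : TubeLift E) (T' : TubeLift E.symm) :
    ∃ r ≤ E.ℓ₁, ∃ i j : ℤ, ∀ x ∈ logTube r, T.toFun x ∈ logTube E.ℓ₂ ∧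
      T'.toFun (T.toFun x) = deck i j x := by
  obtain ⟨r, hr, htr⟩ := E.tends E.ℓ₂
  have hmem : ∀ x ∈ logTube r, T.toFun x ∈ logTube E.ℓ₂ := fun x hx => by
    rw [← logCover_mem, T.lifts x (logTube_mono hr hx)]
    exact htr _ (logCover_mem.2 hx)
  obtain ⟨i, j, hij⟩ := (convex_logTube r).isPreconnected.exists_deck
    (f := fun x => T'.toFun (T.toFun x)) (g := id)
    (T'.cont.comp (T.cont.mono (logTube_mono hr)) hmem) continuousOn_id fun x hx => by
      rw [T'.lifts _ (hmem x hx), T.lifts x (logTube_mono hr hx)]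
      exact E.left_inv _ (logCover_mem.2 (logTube_mono hr hx))
  exact ⟨r, hr, i, j, fun x hx => ⟨hmem x hx, hij x hx⟩⟩

theorem merid_mul_long_mul (T : TubeLift E) (T' : TubeLift E.symm) :
    T'.merid * T.merid = 1 ∧ T'.long * T.long = 1 := by
  obtain ⟨r, hr, i, j, h⟩ := T.exists_symm_comp T'
  have hx : ((⟨r - 1, 0⟩ : ℂ), (0 : ℝ)) ∈ logTube r := by simp [logTube]
  have h1 := (h _ (deck_mem (i := 1) (j := 0).2 hx)).2
  have h2 := (h _ (deck_mem (i := 0) (j := 1).2 hx)).2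
  rw [T.equivariant _ (logTube_mono hr hx), T'.equivariant _ (h _ hx).1, (h _ hx).2,
    deck_deck, deck_deck] at h1 h2
  have h1' := deck_injective h1
  have h2' := deck_injective h2
  constructor <;> linarith [h1'.1, h2'.2]

end TubeLift

/-! ### The action on the homology of the punctured tubes -/

namespace TubeLift

variable {a₁ b₁ a₂ b₂ : ℝ} {E : PuncturedEquiv a₁ b₁ a₂ b₂}

theorem long_eq_one_or (T : TubeLift E) (T' : TubeLift E.symm) : T.long = 1 ∨ T.long = -1 :=
  Int.eq_one_or_neg_one_of_mul_eq_one' (T.merid_mul_long_mul T').2 |>.imp And.right And.right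

theorem merid_eq_one_or (T : TubeLift E) (T' : TubeLift E.symm) : T.merid = 1 ∨ T.merid = -1 :=
  Int.eq_one_or_neg_one_of_mul_eq_one' (T.merid_mul_long_mul T').1 |>.imp And.right And.right

/-- Only the half planes over one half of the stable manifold are sent to the half planes over its
image. -/
theorem exists_im_reflect (T : TubeLift E) (T' : TubeLift E.symm) (ha₁ : a₁ < 0) (hb₁ : 0 < b₁)
    (ha₂ : a₂ < 0) (hb₂ : 0 < b₂) : ∃ r ≤ E.ℓ₁, ∃ k : ℤ,
      (∀ x ∈ logTube E.ℓ₁, x.1.im = 0 → (T.toFun x).1.im = k * Real.pi) ∧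
      (∃ i j : ℤ, ∀ x ∈ logTube r, T.toFun x ∈ logTube E.ℓ₂ ∧
        T'.toFun (T.toFun x) = deck i j x) ∧
      ∀ x ∈ logTube r, ∀ j : ℤ, (T.toFun x).1.im = k * Real.pi + 2 * Real.pi * j →
        ∃ i : ℤ, x.1.im = 2 * Real.pi * i := by
  obtain ⟨r, hr, i, j, h⟩ := T.exists_symm_comp T'
  obtain ⟨k, hk⟩ := E.exists_im_lift_eq ha₁ hb₂ T.cont T.lifts 0
  simp only [Int.cast_zero, zero_mul] at hk
  obtain ⟨k', hk'⟩ := E.symm.exists_im_lift_eq ha₂ hb₁ T'.cont T'.lifts k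
  have hx₀ : ((⟨r - 1, 0⟩ : ℂ), (0 : ℝ)) ∈ logTube r := by simp [logTube]
  have h0 := h _ hx₀
  have h1 := hk' _ h0.1 (hk _ (logTube_mono hr hx₀) rfl)
  rw [h0.2, deck_im, zero_add] at h1
  refine ⟨r, hr, k, hk, ⟨i, j, h⟩, fun x hx l hl => ?_⟩
  have h2 := hk' (deck (-l) 0 (T.toFun x)) (deck_mem.2 (h x hx).1) (by
    rw [deck_im, hl]; push_cast; ring)
  rw [T'.equivariant _ (h x hx).1, (h x hx).2, deck_im, deck_im, ← h1] at h2
  refine ⟨T'.merid * l, ?_⟩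
  push_cast at h2 ⊢
  linarith

/-- The coordinate `Re L - a Z`: on a plane over the stable manifold, it is constant along the orbits,
and it separates them. -/
def orbitCoord (a : ℝ) (x : ℂ × ℝ) : ℝ := x.1.re - a * x.2

theorem orbitCoord_eq_of_eq (T : TubeLift E) (ha₁ : a₁ < 0) (hb₂ : 0 < b₂) {x y : ℂ × ℝ}
    (hx : x ∈ logTube E.ℓ₁) (hy : y ∈ logTube E.ℓ₁) {j : ℤ} (hxi : x.1.im = j * Real.pi)
    (hyi : y.1.im = j * Real.pi) (h : orbitCoord a₁ x = orbitCoord a₁ y) :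
    orbitCoord a₂ (T.toFun x) = orbitCoord a₂ (T.toFun y) := by
  wlog hxy : x.2 ≤ y.2 generalizing x y
  · exact (this hy hx hyi hxi h.symm (not_le.1 hxy).le).symm
  obtain ⟨σ, -, -, hσ⟩ := T.slice_flow ha₁ hb₂ hx hxi (sub_nonneg.2 hxy)
  have hxy' : (x.1 + (a₁ * (y.2 - x.2) : ℝ), x.2 + (y.2 - x.2)) = y := by
    unfold orbitCoord at h
    apply logPoint_ext
    · simp only [Complex.add_re, Complex.ofReal_re]; linarith
    · simp only [Complex.add_im, Complex.ofReal_im, add_zero, hxi, hyi]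
    · simp only; ring
  rw [hxy'] at hσ
  rw [hσ]
  simp only [orbitCoord, Complex.add_re, Complex.ofReal_re]
  ring

/-- When the longitude is preserved, the lift increases the coordinate of the orbits in the stable
manifold. -/
theorem strictMonoOn_orbitCoord (T : TubeLift E) (T' : TubeLift E.symm) (ha₁ : a₁ < 0)
    (hb₁ : 0 < b₁) (ha₂ : a₂ < 0) (hb₂ : 0 < b₂) (hlong : T.long = 1) {r : ℝ} (hr : r ≤ E.ℓ₁)
    {i j : ℤ} (hcomp : ∀ x ∈ logTube r, T.toFun x ∈ logTube E.ℓ₂ ∧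
        T'.toFun (T.toFun x) = deck i j x) (z : ℝ) :
    StrictMonoOn (fun s : ℝ => orbitCoord a₂ (T.toFun ((s : ℂ), z))) (Iio r) := by
  -- the point with orbit coordinate `c` on the cylinder of radius `exp (r - 1)`
  set P : ℝ → ℂ × ℝ := fun c => (((r - 1 : ℝ) : ℂ), (r - 1 - c) / a₁) with hP
  have hPr : ∀ c, P c ∈ logTube r := fun c => by simp [P, logTube]
  have hPi : ∀ c, (P c).1.im = (0 : ℤ) * Real.pi := fun c => by simp [P]
  have hPc : ∀ c, orbitCoord a₁ (P c) = c := fun c => by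
    simp only [P, orbitCoord, Complex.ofReal_re]
    field_simp [ha₁.ne]
    ring
  set e : ℝ → ℝ := fun c => orbitCoord a₂ (T.toFun (P c)) with he
  obtain ⟨k, hk⟩ := E.exists_im_lift_eq ha₁ hb₂ T.cont T.lifts 0
  have hec : Continuous e := by
    have h1 : Continuous fun c => T.toFun (P c) :=
      T.cont.comp_continuous (by fun_prop) fun c => logTube_mono hr (hPr c)
    exact (Complex.continuous_re.comp h1.fst).sub (continuous_const.mul h1.snd)
  have hinj : Function.Injective e := by
    intro c c' hcc
    have h1 := T'.orbitCoord_eq_of_eq ha₂ hb₁ (hcomp _ (hPr c)).1 (hcomp _ (hPr c')).1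
      (hk _ (logTube_mono hr (hPr c)) (hPi c)) (hk _ (logTube_mono hr (hPr c')) (hPi c')) hcc
    rw [(hcomp _ (hPr c)).2, (hcomp _ (hPr c')).2] at h1
    simp only [orbitCoord, deck_re, deck_snd] at h1
    have h2 := hPc c
    have h3 := hPc c'
    simp only [orbitCoord] at h2 h3
    linarith
  have hstep : ∀ c, e (c - a₁) = e c - a₂ := by
    intro c
    have h1 : P (c - a₁) = deck 0 1 (P c) := by
      apply logPoint_ext
      · simp [P]
      · simp [P]
      · simp only [P, deck_snd, Int.cast_one]
        field_simp [ha₁.ne]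
        ring
    simp only [e, h1, T.equivariant _ (logTube_mono hr (hPr c)), orbitCoord, deck_re, deck_snd,
      hlong]
    push_cast
    ring
  have hmono : StrictMono e := by
    refine (hec.strictMono_of_inj hinj).resolve_right fun h => ?_
    have := h (show (0 : ℝ) < 0 - a₁ by linarith)
    rw [hstep] at this
    linarith
  intro s hs s' hs' hss
  have key : ∀ u ∈ Iio r, orbitCoord a₂ (T.toFun ((u : ℂ), z)) = e (u - a₁ * z) := by
    intro u hu
    refine T.orbitCoord_eq_of_eq ha₁ hb₂ (j := 0) (logTube_mono hr (by simpa [logTube] using hu))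
      (logTube_mono hr (hPr _)) (by simp) (hPi _) ?_
    rw [hPc]
    simp [orbitCoord]
  simp only [key s hs, key s' hs']
  exact hmono (by linarith)

end TubeLift

/-- A closed curve that starts on the positive real axis, runs through the lower half plane to the
negative real axis and comes back without meeting the real axis, does not wind positively. -/
theorem not_winding_one {D : ℝ → ℂ} (hD : Continuous D) (h0 : D 0 = 0)
    (h1 : D 1 = 2 * Real.pi * Complex.I)
    (hlow : ∀ t ∈ Ioo (0 : ℝ) (1 / 2), (Complex.exp (D t)).im < 0)
    (hhalf : (Complex.exp (D (1 / 2))).re < 0) (hhalf' : (Complex.exp (D (1 / 2))).im = 0)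
    (hne : ∀ t ∈ Ioo (1 / 2 : ℝ) 1, (Complex.exp (D t)).im ≠ 0) : False := by
  have hpi := Real.pi_pos
  have hy : Continuous fun t => (D t).im := Complex.continuous_im.comp hD
  have hy0 : (D 0).im = 0 := by simp [h0]
  have hy1 : (D 1).im = 2 * Real.pi := by simp [h1]
  rw [Complex.exp_re] at hhalf
  rw [Complex.exp_im] at hhalf'
  have hcos : Real.cos (D (1 / 2)).im < 0 := by
    by_contra! hcon
    exact absurd hhalf (not_lt.2 (mul_nonneg (Real.exp_pos _).le hcon))
  have hsin : Real.sin (D (1 / 2)).im = 0 := by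
    simpa [Real.exp_ne_zero] using hhalf'
  obtain ⟨n, hn⟩ := Real.sin_eq_zero_iff.1 hsin
  rcases lt_or_ge (D (1 / 2)).im 0 with hneg | hpos
  · -- the argument vanishes between the times `1 / 2` and `1`
    obtain ⟨t, ht, hty⟩ := intermediate_value_Ioo (by norm_num : (1 / 2 : ℝ) ≤ 1) hy.continuousOn
      (show (0 : ℝ) ∈ Ioo _ _ from ⟨hneg, by rw [hy1]; positivity⟩)
    refine hne t ht ?_
    simp only at hty
    rw [Complex.exp_im, hty, Real.sin_zero, mul_zero]
  · have hn1 : (1 : ℝ) ≤ n := by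
      have h2 : 0 ≤ n := by
        by_contra! hcon
        have : (n : ℝ) < 0 := by exact_mod_cast hcon
        nlinarith
      have h3 : n ≠ 0 := by
        rintro rfl
        rw [← hn] at hcos
        simp at hcos
        linarith
      exact_mod_cast (show (1 : ℤ) ≤ n by omega)
    obtain ⟨t, ht, hty⟩ := intermediate_value_Ioo (by norm_num : (0 : ℝ) ≤ 1 / 2) hy.continuousOn
      (show Real.pi / 2 ∈ Ioo _ _ from ⟨by rw [hy0]; positivity, by simp only [← hn]; nlinarith⟩)
    have := hlow t ht
    simp only at hty
    rw [Complex.exp_im, hty, Real.sin_pi_div_two, mul_one] at this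
    exact absurd this (not_lt.2 (Real.exp_pos _).le)

/-- The map of punctured tubes preserves the orientation near some point of the stable manifold,
arbitrarily close to the periodic orbit: the transverse disk through this point is sent to a
positively oriented surface. -/
def PuncturedEquiv.IsPositive {a₁ b₁ a₂ b₂ : ℝ} (E : PuncturedEquiv a₁ b₁ a₂ b₂) : Prop :=
  ∀ r : ℝ, ∃ s < r, ∃ (z : UnitAddCircle) (ζ : ℂ → ℝ),
    (∀ᶠ v in 𝓝 ((Real.exp s : ℝ) : ℂ), ContinuousAt ζ v ∧
      (E.toFun (v, z)).2 = ((ζ v : ℝ) : UnitAddCircle)) ∧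
    HasIndexOne (fun v => (saddleFlow a₂ b₂ (-ζ v) (E.toFun (v, z))).1) ((Real.exp s : ℝ) : ℂ)

namespace TubeLift

variable {a₁ b₁ a₂ b₂ : ℝ} {E : PuncturedEquiv a₁ b₁ a₂ b₂}

/-- If the orientation is preserved, then the lift turns the side of the stable manifold with
positive angles to the side with positive angles. -/
theorem exists_im_gt (T : TubeLift E) (T' : TubeLift E.symm) (ha₁ : a₁ < 0) (hb₁ : 0 < b₁)
    (ha₂ : a₂ < 0) (hb₂ : 0 < b₂) (hlong : T.long = 1) (hor : E.IsPositive) {r : ℝ}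
    (hr : r ≤ E.ℓ₁) {k : ℤ}
    (hk : ∀ x ∈ logTube E.ℓ₁, x.1.im = 0 → (T.toFun x).1.im = k * Real.pi) {i j : ℤ}
    (hcomp : ∀ x ∈ logTube r, T.toFun x ∈ logTube E.ℓ₂ ∧ T'.toFun (T.toFun x) = deck i j x)
    (hrefl : ∀ x ∈ logTube r, ∀ j : ℤ, (T.toFun x).1.im = k * Real.pi + 2 * Real.pi * j →
        ∃ i : ℤ, x.1.im = 2 * Real.pi * i) :
    ∃ x ∈ logTube r, 0 < x.1.im ∧ x.1.im < 2 * Real.pi ∧ k * Real.pi < (T.toFun x).1.im ∧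
      (T.toFun x).1.im < k * Real.pi + 2 * Real.pi := by
  have hpi := Real.pi_pos
  obtain ⟨s, hs, z, ζ, hζ, hind⟩ := hor r
  obtain ⟨z, rfl⟩ := QuotientAddGroup.mk_surjective z
  set x₀ : ℝ := Real.exp s with hx₀
  have hx₀pos : 0 < x₀ := Real.exp_pos s
  have hslit : ((x₀ : ℝ) : ℂ) ∈ Complex.slitPlane := Or.inl hx₀pos
  -- near `x₀`, the lift is evaluated along the principal branch of the logarithm
  set Q : ℂ → ℂ × ℝ := fun v => (Complex.log v, z) with hQ
  have hQ0 : Q x₀ ∈ logTube r := by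
    simp only [Q, logTube, mem_ofPred_eq, Complex.log_re, Complex.norm_real]
    rwa [Real.norm_of_nonneg hx₀pos.le, hx₀, Real.log_exp]
  have hQc : ∀ v ∈ Complex.slitPlane, ContinuousAt Q v := fun v hv =>
    (continuousAt_clog hv).prodMk continuousAt_const
  have hQ0im : (Q x₀).1.im = 0 := by simp [Q, ← Complex.ofReal_log hx₀pos.le]
  have hTQ : ∀ v ∈ Complex.slitPlane, Q v ∈ logTube r → ContinuousAt (fun v => T.toFun (Q v)) v :=
    fun v hv hvr => ContinuousAt.comp (f := Q)
      (T.cont.continuousAt ((isOpen_logTube _).mem_nhds (logTube_mono hr hvr))) (hQc v hv)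
  have hclose : ∀ᶠ v in 𝓝 ((x₀ : ℝ) : ℂ), v ∈ Complex.slitPlane ∧ Q v ∈ logTube r ∧
      |(T.toFun (Q v)).1.im - k * Real.pi| < Real.pi := by
    refine (Complex.isOpen_slitPlane.eventually_mem hslit).and
      (((hQc _ hslit).eventually ((isOpen_logTube r).mem_nhds hQ0)).and ?_)
    have h1 : ContinuousAt (fun v => |(T.toFun (Q v)).1.im - k * Real.pi|) (x₀ : ℂ) :=
      ((Complex.continuous_im.continuousAt.comp (hTQ _ hslit hQ0).fst).sub
        continuousAt_const).abs
    refine h1.eventually_lt_const ?_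
    simp only [hk _ (logTube_mono hr hQ0) hQ0im, sub_self, abs_zero]
    exact hpi
  obtain ⟨δ, hδ, hball⟩ := Metric.eventually_nhds_iff_ball.1 (hclose.and hζ)
  by_contra! hcon
  -- otherwise the upper half disks are sent below the stable manifold
  have hup : ∀ v ∈ Metric.ball ((x₀ : ℝ) : ℂ) δ, 0 < v.im →
      (T.toFun (Q v)).1.im < k * Real.pi := by
    intro v hv him
    obtain ⟨⟨hsl, hvr, habs⟩, -⟩ := hball v hv
    rw [abs_lt] at habs
    have harg : 0 < (Q v).1.im ∧ (Q v).1.im < Real.pi := by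
      simp only [Q, Complex.log_im]
      exact ⟨(Complex.arg_nonneg_iff.2 him.le).lt_of_ne' fun h =>
        him.ne' (Complex.arg_eq_zero_iff.1 h).2, lt_of_le_of_ne (Complex.arg_le_pi v) fun h =>
        him.ne' (Complex.arg_eq_pi_iff.1 h).2⟩
    rcases lt_trichotomy (T.toFun (Q v)).1.im (k * Real.pi) with h | h | h
    · exact h
    · obtain ⟨n, hn⟩ := hrefl _ hvr 0 (by simpa using h)
      rw [hn] at harg
      have h2 : 0 < n := by
        by_contra! h3
        have : (n : ℝ) ≤ 0 := by exact_mod_cast h3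
        nlinarith
      have : (1 : ℝ) ≤ n := by exact_mod_cast h2
      nlinarith
    · have := hcon _ hvr harg.1 (by linarith) h
      linarith
  have hreal : ∀ v ∈ Metric.ball ((x₀ : ℝ) : ℂ) δ, v.im = 0 →
      (Q v).1.im = 0 ∧ (T.toFun (Q v)).1.im = k * Real.pi := by
    intro v hv him
    obtain ⟨⟨hsl, hvr, -⟩, -⟩ := hball v hv
    have h1 : (Q v).1.im = 0 := by
      simp only [Q, Complex.log_im, Complex.arg_eq_zero_iff]
      refine ⟨?_, him⟩
      rcases hsl with h | h
      · exact h.le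
      · exact (h him).elim
    exact ⟨h1, hk _ (logTube_mono hr hvr) h1⟩
  have hnonreal : ∀ v ∈ Metric.ball ((x₀ : ℝ) : ℂ) δ, v.im ≠ 0 →
      Real.sin ((T.toFun (Q v)).1.im - k * Real.pi) ≠ 0 := by
    intro v hv him hsin
    obtain ⟨⟨hsl, hvr, habs⟩, -⟩ := hball v hv
    rw [abs_lt] at habs
    have h0 := (Real.sin_eq_zero_iff_of_lt_of_lt habs.1 habs.2).1 hsin
    obtain ⟨n, hn⟩ := hrefl _ hvr 0 (by simp only [Int.cast_zero, mul_zero]; linarith)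
    have hlt : (Q v).1.im ∈ Ioo (-Real.pi) Real.pi := by
      simp only [Q, Complex.log_im]
      exact ⟨Complex.neg_pi_lt_arg v, (Complex.arg_le_pi v).lt_of_ne fun h =>
        him (Complex.arg_eq_pi_iff.1 h).2⟩
    rw [hn] at hlt
    have h2 : n = 0 := by
      have h3 : (n : ℝ) < 1 := by nlinarith [hlt.2]
      have h4 : (-1 : ℝ) < n := by nlinarith [hlt.1]
      have h3' : n < 1 := by exact_mod_cast h3
      have h4' : -1 < n := by exact_mod_cast h4
      omega
    rw [h2] at hn
    simp only [Q, Complex.log_im, Int.cast_zero, mul_zero, Complex.arg_eq_zero_iff] at hn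
    exact him hn.2
  -- the projection along the flow, in terms of the lift
  obtain ⟨n, hn⟩ := (convex_ball ((x₀ : ℝ) : ℂ) δ).isPreconnected.exists_int_of_circle_lifts
    (f := ζ) (g := fun v => (T.toFun (Q v)).2)
    (fun v hv => (hball v hv).2.1.continuousWithinAt)
    (fun v hv => (hTQ v (hball v hv).1.1 (hball v hv).1.2.1).snd.continuousWithinAt)
    fun v hv => by
      rw [← (hball v hv).2.2]
      have h1 := T.lifts _ (logTube_mono hr (hball v hv).1.2.1)
      have h2 : logCover (Q v) = (v, (z : UnitAddCircle)) := by
        simp only [Q, logCover, Complex.exp_log (Complex.slitPlane_ne_zero (hball v hv).1.1)]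
      rw [h2] at h1
      exact (congr_arg Prod.snd h1).symm
  set f : ℂ → ℂ := fun v => (saddleFlow a₂ b₂ (-ζ v) (E.toFun (v, (z : UnitAddCircle)))).1 with hf
  -- the sign of the half of the stable manifold that contains the image of `x₀`
  set κ : ℝ := Real.cos (k * Real.pi) with hκ
  have hsk : Real.sin (k * Real.pi) = 0 := Real.sin_int_mul_pi k
  have hκ2 : κ ^ 2 = 1 := by
    have := Real.sin_sq_add_cos_sq (k * Real.pi)
    rw [hsk] at this
    linarith
  have hfv : ∀ v ∈ Metric.ball ((x₀ : ℝ) : ℂ) δ,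
      (f v).re = κ * (Real.exp (orbitCoord a₂ (T.toFun (Q v)) - a₂ * n) *
        Real.cos ((T.toFun (Q v)).1.im - k * Real.pi)) ∧
      (f v).im = κ * (Real.exp (-b₂ * ζ v + (T.toFun (Q v)).1.re) *
        Real.sin ((T.toFun (Q v)).1.im - k * Real.pi)) := by
    intro v hv
    have h1 := T.lifts _ (logTube_mono hr (hball v hv).1.2.1)
    have h2 : logCover (Q v) = (v, (z : UnitAddCircle)) := by
      simp only [Q, logCover, Complex.exp_log (Complex.slitPlane_ne_zero (hball v hv).1.1)]
    rw [h2] at h1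
    have h3 := hn v hv
    simp only [f, ← h1, saddleFlow_re, saddleFlow_im, logCover, Complex.exp_re, Complex.exp_im,
      Real.cos_sub, Real.sin_sub, hsk, ← hκ, orbitCoord]
    constructor
    · rw [h3, ← mul_assoc, ← Real.exp_add]
      ring_nf
      rw [hκ2]
      ring
    · rw [← mul_assoc, ← Real.exp_add]
      ring_nf
      rw [hκ2]
      ring
  obtain ⟨ρ, hρ, hρδ, L, hLc, hL⟩ : ∃ ρ > 0, ρ < δ ∧ ∃ L : ℝ → ℂ, Continuous L ∧ ∀ t : ℝ,
      f (x₀ + ρ * Complex.exp (2 * Real.pi * Complex.I * t)) - f x₀ = Complex.exp (L t) ∧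
      L (t + 1) = L t + 2 * Real.pi * Complex.I := by
    obtain ⟨ρ, h1, h2, h3⟩ := (hind.and ((eventually_mem_nhdsWithin (a := (0 : ℝ))).and
      (eventually_nhdsWithin_of_eventually_nhds (eventually_lt_nhds hδ)))).exists
    exact ⟨ρ, h2, h3, h1⟩
  set p : ℝ → ℂ := fun t => x₀ + ρ * Complex.exp (2 * Real.pi * Complex.I * t) with hp
  have hpball : ∀ t, p t ∈ Metric.ball ((x₀ : ℝ) : ℂ) δ := fun t => by
    have : ‖Complex.exp (2 * Real.pi * Complex.I * t)‖ = 1 := by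
      rw [show 2 * Real.pi * Complex.I * (t : ℂ) = ((2 * Real.pi * t : ℝ) : ℂ) * Complex.I by
        push_cast; ring, Complex.norm_exp_ofReal_mul_I]
    simp [p, this, abs_of_pos hρ, hρδ]
  have hpim : ∀ t, (p t).im = ρ * Real.sin (2 * Real.pi * t) := fun t => by
    simp only [p]
    rw [show 2 * Real.pi * Complex.I * (t : ℂ) = ((2 * Real.pi * t : ℝ) : ℂ) * Complex.I by
        push_cast; ring, Complex.add_im, Complex.ofReal_im, Complex.im_ofReal_mul,
        Complex.exp_ofReal_mul_I_im, zero_add]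
  have hp0 : p 0 = ((x₀ + ρ : ℝ) : ℂ) := by simp [p]
  have hphalf : p (1 / 2) = ((x₀ - ρ : ℝ) : ℂ) := by
    simp only [p]
    rw [show 2 * (Real.pi : ℂ) * Complex.I * ((1 / 2 : ℝ) : ℂ) = Real.pi * Complex.I by
      push_cast; ring, Complex.exp_pi_mul_I]
    push_cast
    ring
  have hx₀ball : ((x₀ : ℝ) : ℂ) ∈ Metric.ball ((x₀ : ℝ) : ℂ) δ := Metric.mem_ball_self hδ
  -- on the real axis, `κ * f` is real and increasing
  have hreal' : ∀ y : ℝ, (y : ℂ) ∈ Metric.ball ((x₀ : ℝ) : ℂ) δ → 0 < y ∧ (f y).im = 0 ∧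
      (f y).re = κ * Real.exp (orbitCoord a₂ (T.toFun ((Real.log y : ℂ), z)) - a₂ * n) ∧
      Real.log y < r := by
    intro y hy
    have h1 := hreal y hy rfl
    have h2 := hfv y hy
    have hy0 : 0 < y := by
      rcases (hball y hy).1.1 with h | h
      · exact h
      · simp at h
    rw [h1.2] at h2
    have h3 : Q y = ((Real.log y : ℂ), z) := by simp [Q, Complex.ofReal_log hy0.le]
    refine ⟨hy0, by simpa using h2.2, by simpa [h3] using h2.1, ?_⟩
    have h4 := (hball y hy).1.2.1
    rw [h3] at h4
    simpa [logTube] using h4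
  have hinc : ∀ y y' : ℝ, (y : ℂ) ∈ Metric.ball ((x₀ : ℝ) : ℂ) δ →
      (y' : ℂ) ∈ Metric.ball ((x₀ : ℝ) : ℂ) δ → y < y' → ∃ c > 0, f y' - f y = ((κ * c : ℝ) : ℂ) := by
    intro y y' hy hy' hyy
    obtain ⟨h1, h2, h3, h4⟩ := hreal' y hy
    obtain ⟨h1', h2', h3', h4'⟩ := hreal' y' hy'
    have h5 := T.strictMonoOn_orbitCoord T' ha₁ hb₁ ha₂ hb₂ hlong hr hcomp z h4 h4'
      (Real.log_lt_log h1 hyy)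
    simp only at h5
    refine ⟨_, sub_pos.2 (Real.exp_lt_exp.2 (sub_lt_sub_right h5 (a₂ * n))), ?_⟩
    apply Complex.ext
    · rw [Complex.sub_re, h3, h3', Complex.ofReal_re]; ring
    · rw [Complex.sub_im, h2, h2', Complex.ofReal_im, sub_zero]
  obtain ⟨c₀, hc₀, hc₀'⟩ := hinc x₀ (x₀ + ρ) hx₀ball (hp0 ▸ hpball 0) (by linarith)
  obtain ⟨c₁, hc₁, hc₁'⟩ := hinc (x₀ - ρ) x₀ (hphalf ▸ hpball (1 / 2)) hx₀ball (by linarith)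
  have hL0 : Complex.exp (L 0) = ((κ * c₀ : ℝ) : ℂ) := by
    rw [← hc₀', ← hp0, ← (hL 0).1]
  have hLhalf : Complex.exp (L (1 / 2)) = ((-(κ * c₁) : ℝ) : ℂ) := by
    rw [← (hL (1 / 2)).1]
    change f (p (1 / 2)) - f x₀ = _
    rw [hphalf, Complex.ofReal_neg, ← hc₁']
    ring
  have hκ0 : κ ≠ 0 := fun h => by simp [h] at hκ2
  have hquot : ∀ t, Complex.exp (L t - L 0) = ((κ / c₀ : ℝ) : ℂ) * Complex.exp (L t) := fun t => by
    rw [Complex.exp_sub, hL0]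
    have h1 : (κ : ℂ) ^ 2 = 1 := by exact_mod_cast hκ2
    have h2 : (κ : ℂ) ≠ 0 := by exact_mod_cast hκ0
    have h3 : (c₀ : ℂ) ≠ 0 := by exact_mod_cast hc₀.ne'
    push_cast
    field_simp
    exact h1.symm
  have himt : ∀ t, (Complex.exp (L t - L 0)).im =
      (Real.exp (-b₂ * ζ (p t) + (T.toFun (Q (p t))).1.re) / c₀) *
        Real.sin ((T.toFun (Q (p t))).1.im - k * Real.pi) := fun t => by
    rw [hquot, Complex.im_ofReal_mul, ← (hL t).1]
    change κ / c₀ * (f (p t) - f x₀).im = _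
    rw [Complex.sub_im, (hreal' x₀ hx₀ball).2.1, (hfv _ (hpball t)).2, sub_zero]
    rw [show ∀ u v : ℝ, κ / c₀ * (κ * (u * v)) = κ ^ 2 * (u / c₀ * v) by intro u v; ring, hκ2,
      one_mul]
  -- the image of a small circle, seen from the image of its centre, runs through the lower half plane
  -- first
  refine not_winding_one (D := fun t => L t - L 0) (by fun_prop) (by simp) ?_ ?_ ?_ ?_ ?_
  · have := (hL 0).2
    rw [zero_add] at this
    simp [this]
  · intro t ht
    rw [himt]
    have h1 : 0 < (p t).im := by
      rw [hpim]
      exact mul_pos hρ (Real.sin_pos_of_pos_of_lt_pi (by have := ht.1; positivity)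
        (by nlinarith [ht.2]))
    have h2 := (abs_lt.1 (hball _ (hpball t)).1.2.2).1
    have h3 := hup _ (hpball t) h1
    refine mul_neg_of_pos_of_neg (by positivity) ?_
    exact Real.sin_neg_of_neg_of_neg_pi_lt (by linarith) h2
  · rw [hquot, hLhalf, ← Complex.ofReal_mul, Complex.ofReal_re]
    rw [show κ / c₀ * -(κ * c₁) = -(κ ^ 2 * (c₁ / c₀)) by ring, hκ2, one_mul]
    have : 0 < c₁ / c₀ := by positivity
    linarith
  · rw [hquot, hLhalf, ← Complex.ofReal_mul, Complex.ofReal_im]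
  · intro t ht
    rw [himt]
    refine mul_ne_zero (by positivity) (hnonreal _ (hpball t) ?_)
    rw [hpim]
    refine mul_ne_zero hρ.ne' (ne_of_lt ?_)
    have := Real.sin_pos_of_pos_of_lt_pi (x := 2 * Real.pi * t - Real.pi) (by nlinarith [ht.1])
      (by nlinarith [ht.2])
    rw [Real.sin_sub_pi] at this
    linarith

/-- An orientation preserving equivalence that preserves the longitude preserves the meridian, and
it moves the angular coordinate by a bounded amount. -/
theorem merid_eq_one (T : TubeLift E) (T' : TubeLift E.symm) (ha₁ : a₁ < 0) (hb₁ : 0 < b₁)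
    (ha₂ : a₂ < 0) (hb₂ : 0 < b₂) (hlong : T.long = 1) (hor : E.IsPositive) :
    T.merid = 1 ∧ ∃ r ≤ E.ℓ₁, ∃ A : ℝ, ∀ x ∈ logTube r, |(T.toFun x).1.im - x.1.im| ≤ A := by
  have hpi := Real.pi_pos
  obtain ⟨r, hr, k, hk, ⟨i, j, hcomp⟩, hrefl⟩ := T.exists_im_reflect T' ha₁ hb₁ ha₂ hb₂
  obtain ⟨x₁, hx₁, hx₁0, hx₁2, hlo, hhi⟩ :=
    T.exists_im_gt T' ha₁ hb₁ ha₂ hb₂ hlong hor hr hk hcomp hrefl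
  set U : Set (ℂ × ℝ) := logTube r ∩ {x | x.1.im ∈ Ioo 0 (2 * Real.pi)} with hU
  have hlin : IsLinearMap ℝ fun x : ℂ × ℝ => x.1.im := ⟨fun _ _ => rfl, fun _ _ => by simp⟩
  have hconv : Convex ℝ U := (convex_logTube _).inter
    ((convex_halfSpace_gt hlin _).inter (convex_halfSpace_lt hlin _))
  have hcU : ContinuousOn (fun x => (T.toFun x).1.im) U := Complex.continuous_im.comp_continuousOn
    (T.cont.mono (inter_subset_left.trans (logTube_mono hr))).fst
  -- over the slab of angles in `(0, 2 * π)`, the image does not meet the planes over its boundary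
  have hno : ∀ n : ℤ, k * Real.pi + 2 * Real.pi * n ∉ (fun x => (T.toFun x).1.im) '' U := by
    rintro n ⟨x, hx, hxn⟩
    obtain ⟨m, hm⟩ := hrefl x hx.1 n hxn
    have h1 := hx.2
    simp only [mem_ofPred_eq, hm] at h1
    have h2 : (0 : ℝ) < m := by
      by_contra! hcon
      nlinarith [h1.1]
    have h3 : (m : ℝ) < 1 := by nlinarith [h1.2]
    have h2' : 0 < m := by exact_mod_cast h2
    have h3' : m < 1 := by exact_mod_cast h3
    omega
  have hsub : ∀ x ∈ U, (T.toFun x).1.im ∈ Ioo (k * Real.pi) (k * Real.pi + 2 * Real.pi) := by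
    intro x hx
    have hpre := (hconv.isPreconnected.image _ hcU).ordConnected
    have h1 : (T.toFun x₁).1.im ∈ (fun x => (T.toFun x).1.im) '' U := ⟨x₁, ⟨hx₁, hx₁0, hx₁2⟩, rfl⟩
    have h2 : (T.toFun x).1.im ∈ (fun x => (T.toFun x).1.im) '' U := ⟨x, hx, rfl⟩
    constructor
    · by_contra! hcon
      refine hno 0 (hpre.out h2 h1 ⟨?_, ?_⟩) <;> simp <;> linarith
    · by_contra! hcon
      refine hno 1 (hpre.out h1 h2 ⟨?_, ?_⟩) <;> simp <;> linarith
  have hmer : T.merid = 1 := by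
    refine (T.merid_eq_one_or T').resolve_right fun hneg => ?_
    -- the limit of the image as the angle tends to `2 * π`
    set q : ℝ → ℂ × ℝ := fun θ => ((⟨r - 1, θ⟩ : ℂ), (0 : ℝ)) with hq
    have hqr : ∀ θ, q θ ∈ logTube r := fun θ => by simp [q, logTube]
    have hqc : Continuous q := by
      have : Continuous fun θ : ℝ => (⟨r - 1, θ⟩ : ℂ) := by
        have h : (fun θ : ℝ => (⟨r - 1, θ⟩ : ℂ)) = fun θ : ℝ => ((r - 1 : ℝ) : ℂ) + θ * Complex.I := by
          funext θ; apply Complex.ext <;> simp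
        rw [h]; fun_prop
      exact this.prodMk continuous_const
    have hc : Continuous fun θ => (T.toFun (q θ)).1.im := Complex.continuous_im.comp
      (T.cont.comp_continuous hqc fun θ => logTube_mono hr (hqr θ)).fst
    have h1 : k * Real.pi ≤ (T.toFun (q (2 * Real.pi))).1.im := by
      have h2 : 2 * Real.pi ∈ closure (Ioo 0 (2 * Real.pi)) := by
        rw [closure_Ioo (by positivity)]; exact ⟨by positivity, le_rfl⟩
      have h3 : Ioo 0 (2 * Real.pi) ⊆ {θ | k * Real.pi ≤ (T.toFun (q θ)).1.im} := fun θ hθ =>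
        (hsub (q θ) ⟨hqr θ, hθ⟩).1.le
      exact closure_minimal h3 (isClosed_le continuous_const hc) h2
    have h4 : q (2 * Real.pi) = deck 1 0 (q 0) := by
      apply logPoint_ext <;> simp [q]
    rw [h4, T.equivariant _ (logTube_mono hr (hqr 0)), deck_im,
      hk _ (logTube_mono hr (hqr 0)) rfl, hneg] at h1
    push_cast at h1
    linarith
  refine ⟨hmer, r, hr, |k * Real.pi| + 2 * Real.pi, fun x hx => ?_⟩
  -- a deck transformation brings `x` to an angle in `[0, 2 * π)`
  set n : ℤ := ⌊x.1.im / (2 * Real.pi)⌋ with hn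
  have h1 : n * (2 * Real.pi) ≤ x.1.im := (le_div_iff₀ (by positivity)).1 (Int.floor_le _)
  have h2 : x.1.im < (n + 1) * (2 * Real.pi) :=
    (div_lt_iff₀ (by positivity)).1 (Int.lt_floor_add_one _)
  set y := deck (-n) 0 x with hy
  have hyr : y ∈ logTube r := deck_mem.2 hx
  have hyi : y.1.im = x.1.im - 2 * Real.pi * n := by
    rw [hy, deck_im]; push_cast; ring
  have hTy : (T.toFun y).1.im = (T.toFun x).1.im - 2 * Real.pi * n := by
    rw [hy, T.equivariant _ (logTube_mono hr hx), deck_im, hmer]; push_cast; ring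
  have h3 : (T.toFun y).1.im ∈ Icc (k * Real.pi) (k * Real.pi + 2 * Real.pi) := by
    rcases eq_or_lt_of_le (show 0 ≤ y.1.im by rw [hyi]; linarith) with h | h
    · rw [hk y (logTube_mono hr hyr) h.symm]
      exact ⟨le_rfl, by linarith⟩
    · exact Ioo_subset_Icc_self (hsub y ⟨hyr, h, by rw [hyi]; linarith⟩)
  rw [hTy] at h3
  have h4 := abs_le.1 (le_refl |k * Real.pi|)
  rw [abs_le]
  constructor <;> linarith [h3.1, h3.2, neg_abs_le (k * Real.pi), le_abs_self (k * Real.pi)]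

end TubeLift

/-! ### Local Birkhoff sections near the periodic orbit -/

namespace LocalBirkhoffSection

variable {M : Type*} [TopologicalSpace M] {φ : Flow ℝ M} {γ : Set M}
  (B : LocalBirkhoffSection φ γ)

theorem continuousOn_ι : ContinuousOn B.ι halfOpenAnnulus := by
  intro p hp
  obtain ⟨V, hV, hemb⟩ := B.immersion p hp
  have h1 : ContinuousOn B.ι (V ∩ halfOpenAnnulus) :=
    continuousOn_iff_continuous_domRestrict.2 hemb.continuous
  exact (h1 p ⟨mem_of_mem_nhds hV, hp⟩).mono_of_mem_nhdsWithin
    (inter_mem (mem_nhdsWithin_of_mem_nhds hV) self_mem_nhdsWithin)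

theorem ι_zero_mem (z : UnitAddCircle) : B.ι (0, z) ∈ γ := by
  have : B.ι (0, z) ∈ B.ι '' {p | p.1 = 0} := mem_image_of_mem _ rfl
  rwa [B.boundary] at this

theorem ι_mem_iff {p : ℝ × UnitAddCircle} (hp : p ∈ halfOpenAnnulus) :
    B.ι p ∈ γ ↔ p.1 = 0 := by
  refine ⟨fun h => le_antisymm (le_of_forall_pos_lt_add fun ε hε => ?_) hp.1, fun h => ?_⟩
  · rw [zero_add]
    exact (eventually_nhdsSet_iff_forall.1 (B.collar ε hε) _ h).self_of_nhds p hp rfl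
  · obtain ⟨r, z⟩ := p
    obtain rfl : r = 0 := h
    exact B.ι_zero_mem z

theorem notMem_of_mem_interior {x : M} (hx : x ∈ B.interior) : x ∉ γ := by
  obtain ⟨p, hp, rfl⟩ := hx
  rw [B.ι_mem_iff ⟨hp.1.le, hp.2⟩]
  exact hp.1.ne'

/-- The thin collars of the section are contained in any neighbourhood of the periodic orbit. -/
theorem exists_collar_subset {O : Set M} (hO : O ∈ 𝓝ˢ γ) :
    ∃ r₀ > 0, r₀ ≤ 1 ∧ ∀ p : ℝ × UnitAddCircle, 0 ≤ p.1 → p.1 < r₀ → B.ι p ∈ O := by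
  have hev : ∀ z ∈ (univ : Set UnitAddCircle), ∀ᶠ p : ℝ × UnitAddCircle in 𝓝 (0, z),
      0 ≤ p.1 → p.1 < 1 → B.ι p ∈ O := by
    intro z _
    have h1 := (B.continuousOn_ι (0, z) ⟨le_rfl, zero_lt_one⟩).eventually
      (mem_nhdsSet_iff_forall.1 hO _ (B.ι_zero_mem z))
    rw [eventually_nhdsWithin_iff] at h1
    filter_upwards [h1] with p hp h0 h1 using hp ⟨h0, h1⟩
  have := isCompact_univ.eventually_forall_of_forall_eventually (x₀ := (0 : ℝ))
    (P := fun r z => 0 ≤ r → r < 1 → B.ι (r, z) ∈ O) hev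
  obtain ⟨ε, hε, h⟩ := Metric.eventually_nhds_iff.1 this
  refine ⟨min ε 1, by positivity, min_le_right _ _, fun p h0 h1 => ?_⟩
  exact h (by rw [Real.dist_eq, sub_zero, abs_of_nonneg h0]; exact h1.trans_le (min_le_left _ _))
    p.2 (mem_univ _) h0 (h1.trans_le (min_le_right _ _))

theorem exists_hit (hγ : IsPeriodicOrbit φ γ) :
    ∃ T > 0, ∀ᶠ x in 𝓝ˢ γ, x ∉ γ → ∃ t ∈ Icc 0 T, φ t x ∈ B.interior := by
  obtain ⟨T, hT, h⟩ := B.return_time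
  refine ⟨T, hT, h.mono fun x hx hxγ => ?_⟩
  obtain ⟨t, ht, p, hp, hpt⟩ := hx
  refine ⟨t, ht, p, ⟨lt_of_le_of_ne hp.1 fun h0 => ?_, hp.2⟩, hpt⟩
  have := (B.ι_mem_iff hp).2 h0.symm
  rw [hpt] at this
  exact hxγ (hγ.flow_mem_iff.1 this)

theorem injOn_ι : InjOn B.ι openAnnulus := injOn_iff_injective.2 B.embedding.injective

end LocalBirkhoffSection

/-! ### Lifts of a section to the universal cover -/

/-- The strip `(0, r₀) × ℝ`. -/
def openStrip (r₀ : ℝ) : Set (ℝ × ℝ) := Ioo 0 r₀ ×ˢ univ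

/-- The strip `[0, r₀) × ℝ`. -/
def halfOpenStrip (r₀ : ℝ) : Set (ℝ × ℝ) := Ico 0 r₀ ×ˢ univ

theorem openStrip_mono {r r' : ℝ} (h : r ≤ r') : openStrip r ⊆ openStrip r' :=
  prod_mono (Ioo_subset_Ioo_right h) le_rfl

theorem convex_openStrip (r : ℝ) : Convex ℝ (openStrip r) := (convex_Ioo _ _).prod convex_univ

theorem openStrip_subset (r : ℝ) : openStrip r ⊆ halfOpenStrip r :=
  prod_mono Ioo_subset_Ico_self le_rfl

/-- A lift to the universal covers of a collar of a section, in a saddle chart. The collar is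
parametrised by `(r, s) ↦ ι (r, sign * s)`, and the angular coordinate of the lift extends
continuously to the boundary `r = 0`. -/
structure StripLift {M : Type*} [TopologicalSpace M] {φ : Flow ℝ M} {γ : Set M}
    (c : SaddleChart φ γ) (B : LocalBirkhoffSection φ γ) (n m : ℤ) where
  sign : ℝ
  sign_eq : sign = 1 ∨ sign = -1
  r₀ : ℝ
  pos : 0 < r₀
  le_one : r₀ ≤ 1
  toFun : ℝ × ℝ → ℂ × ℝ
  cont : ContinuousOn toFun (openStrip r₀)
  cont_snd : ContinuousOn (fun x => (toFun x).2) (halfOpenStrip r₀)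
  mem_source : ∀ x ∈ halfOpenStrip r₀,
    B.ι (x.1, ((sign * x.2 : ℝ) : UnitAddCircle)) ∈ c.chart.source
  lifts : ∀ x ∈ openStrip r₀,
    logCover (toFun x) = c.chart (B.ι (x.1, ((sign * x.2 : ℝ) : UnitAddCircle)))
  lifts_snd : ∀ x ∈ halfOpenStrip r₀, (((toFun x).2 : ℝ) : UnitAddCircle) =
    (c.chart (B.ι (x.1, ((sign * x.2 : ℝ) : UnitAddCircle)))).2
  equivariant : ∀ x ∈ openStrip r₀, toFun (x.1, x.2 + 1) = deck n m (toFun x)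

theorem circle_coe_add_sign {s : ℝ} (hs : s = 1 ∨ s = -1) (t : ℝ) (k : ℤ) :
    ((s * (t + k) : ℝ) : UnitAddCircle) = ((s * t : ℝ) : UnitAddCircle) := by
  rw [circle_coe_eq_iff]
  rcases hs with rfl | rfl
  · exact ⟨k, by ring⟩
  · exact ⟨-k, by push_cast; ring⟩

namespace LocalBirkhoffSection

variable {M : Type*} [TopologicalSpace M] {φ : Flow ℝ M} {γ : Set M}
  {c : SaddleChart φ γ} {B : LocalBirkhoffSection φ γ} {n m : ℤ}

theorem exists_stripLift (h : B.HasLinkingNumberAndMultiplicity c n m) :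
    Nonempty (StripLift c B n m) := by
  obtain ⟨sign, hsign, hev⟩ := h
  obtain ⟨r₀, hr₀, hr₁, hsrc⟩ := B.exists_collar_subset c.source_mem_nhdsSet
  set J : ℝ × ℝ → M := fun x => B.ι (x.1, ((sign * x.2 : ℝ) : UnitAddCircle)) with hJ
  have hpar : Continuous fun x : ℝ × ℝ => (x.1, ((sign * x.2 : ℝ) : UnitAddCircle)) :=
    continuous_fst.prodMk ((AddCircle.continuous_mk' 1).comp (by fun_prop))
  have hJc : ContinuousOn J (halfOpenStrip r₀) := B.continuousOn_ι.comp hpar.continuousOn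
    fun x hx => ⟨hx.1.1, hx.1.2.trans_le hr₁⟩
  have hJs : ∀ x ∈ halfOpenStrip r₀, J x ∈ c.chart.source := fun x hx => hsrc _ hx.1.1 hx.1.2
  have hcJ : ContinuousOn (fun x => c.chart (J x)) (halfOpenStrip r₀) :=
    c.chart.continuousOn.comp hJc hJs
  have hconv : Convex ℝ (halfOpenStrip r₀) := (convex_Ico _ _).prod convex_univ
  obtain ⟨Z, hZ, hZl⟩ := exists_circle_lift hconv hcJ.snd
  obtain ⟨L, hL, hLl⟩ := exists_log_lift (convex_openStrip r₀)
    (hcJ.mono (openStrip_subset _)).fst fun x hx => by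
      rw [Ne, c.fst_eq_zero_iff (hJs x (openStrip_subset _ hx)), B.ι_mem_iff
        ⟨hx.1.1.le, hx.1.2.trans_le hr₁⟩]
      exact hx.1.1.ne'
  have hF : ContinuousOn (fun x => (L x, Z x)) (openStrip r₀) :=
    hL.prodMk (hZ.mono (openStrip_subset _))
  have hFl : ∀ x ∈ openStrip r₀, logCover (L x, Z x) = c.chart (J x) := fun x hx =>
    Prod.ext (hLl x hx) (hZl x (openStrip_subset _ hx))
  have hJ1 : ∀ x, J (x.1, x.2 + 1) = J x := fun x => by
    simpa [J] using congr_arg (fun z => B.ι (x.1, z)) (circle_coe_add_sign hsign x.2 1)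
  obtain ⟨i, j, hij⟩ := (convex_openStrip r₀).isPreconnected.exists_deck
    (f := fun x => (L (x.1, x.2 + 1), Z (x.1, x.2 + 1)))
    (hF.comp (f := fun x : ℝ × ℝ => (x.1, x.2 + 1)) (by fun_prop) fun x hx => ⟨hx.1, mem_univ _⟩)
    hF fun x hx => (hFl (x.1, x.2 + 1) ⟨hx.1, mem_univ _⟩).trans
      ((congr_arg c.chart (hJ1 x)).trans (hFl x hx).symm)
  -- the deck transformation is read on a circle on which the class is known
  obtain ⟨r, ⟨-, L', Z', hL', hZ', hLZ⟩, hr, hrr₀⟩ := (hev.and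
    ((eventually_mem_nhdsWithin (a := (0 : ℝ))).and
      (eventually_nhdsWithin_of_eventually_nhds (eventually_lt_nhds hr₀)))).exists
  have hrm : ∀ t : ℝ, (r, t) ∈ openStrip r₀ := fun t => ⟨⟨hr, hrr₀⟩, mem_univ _⟩
  obtain ⟨i', j', hij'⟩ := isPreconnected_univ.exists_deck
    (f := fun t : ℝ => (L (r, t), Z (r, t))) (g := fun t => (L' t, Z' t))
    (hF.comp (f := fun t : ℝ => (r, t)) (by fun_prop) fun t _ => hrm t)
    (hL'.prodMk hZ').continuousOn fun t _ => by
      rw [hFl _ (hrm t)]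
      exact (hLZ t).2.1
  have hnm : i = n ∧ j = m := by
    have h1 := hij _ (hrm 0)
    have h2 := hij' 0 (mem_univ _)
    have h3 := hij' (0 + 1) (mem_univ _)
    simp only at h1 h2 h3
    have h4 : (L' (0 + 1), Z' (0 + 1)) = deck n m (L' 0, Z' 0) :=
      Prod.ext ((hLZ 0).2.2.1.trans (by simp [deck]; ring)) (hLZ 0).2.2.2
    rw [h3, h2, h4, deck_deck, deck_deck] at h1
    have := deck_injective h1
    constructor <;> linarith [this.1, this.2]
  obtain ⟨rfl, rfl⟩ := hnm
  exact ⟨⟨sign, hsign, r₀, hr₀, hr₁, fun x => (L x, Z x), hF, hZ, hJs, hFl, hZl, hij⟩⟩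

end LocalBirkhoffSection

/-- A continuous function is not injective near a maximum. -/
theorem exists_ne_of_isMax {f : ℝ → ℝ} (hf : Continuous f) {s : ℝ} (hs : ∀ t, f t ≤ f s) {δ : ℝ}
    (hδ : 0 < δ) : ∃ u v, u ≠ v ∧ |u - s| ≤ δ ∧ |v - s| ≤ δ ∧ f u = f v := by
  rcases eq_or_ne (max (f (s - δ)) (f (s + δ))) (f s) with h | h
  · rcases max_choice (f (s - δ)) (f (s + δ)) with h' | h'
    · exact ⟨s - δ, s, by linarith, by simp [abs_of_pos hδ], by simp [hδ.le], by rw [← h', h]⟩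
    · exact ⟨s + δ, s, by linarith, by simp [abs_of_pos hδ], by simp [hδ.le], by rw [← h', h]⟩
  · obtain ⟨u, hu, huy⟩ := intermediate_value_Icc (show s - δ ≤ s by linarith) hf.continuousOn
      ⟨le_max_left _ _, max_le (hs _) (hs _)⟩
    obtain ⟨v, hv, hvy⟩ := intermediate_value_Icc' (show s ≤ s + δ by linarith) hf.continuousOn
      ⟨le_max_right _ _, max_le (hs _) (hs _)⟩
    refine ⟨u, v, fun huv => h ?_, ?_, ?_, huy.trans hvy.symm⟩
    · have : u = s := le_antisymm hu.2 (huv ▸ hv.1)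
      rw [← huy, this]
    · rw [abs_le]; constructor <;> linarith [hu.1, hu.2]
    · rw [abs_le]; constructor <;> linarith [hv.1, hv.2]

namespace StripLift

variable {M : Type*} [TopologicalSpace M] {φ : Flow ℝ M} {γ : Set M}
  {c : SaddleChart φ γ} {B : LocalBirkhoffSection φ γ} {n m : ℤ} (S : StripLift c B n m)

theorem equivariant_int (k : ℤ) : ∀ x ∈ openStrip S.r₀,
    S.toFun (x.1, x.2 + k) = deck (n * k) (m * k) (S.toFun x) := by
  induction k using Int.induction_on with
  | zero => intro x _; simp [deck_zero]
  | succ k ih =>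
    intro x hx
    have h1 := S.equivariant (x.1, x.2 + k) ⟨hx.1, mem_univ _⟩
    have h2 := ih x hx
    simp only at h1
    push_cast at h2 ⊢
    rw [← add_assoc, h1, h2, deck_deck]
    congr 1 <;> ring
  | pred k ih =>
    intro x hx
    have h1 := S.equivariant (x.1, x.2 + (-(k : ℝ) - 1)) ⟨hx.1, mem_univ _⟩
    have h2 := ih x hx
    simp only at h1
    push_cast at h2 ⊢
    rw [show x.2 + (-(k : ℝ) - 1) + 1 = x.2 + -(k : ℝ) by ring, h2] at h1
    have h3 := congr_arg (deck (-n) (-m)) h1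
    rw [deck_deck, deck_deck, neg_add_cancel, neg_add_cancel, deck_zero] at h3
    rw [← h3]
    congr 1 <;> ring

/-- The multiplicity does not vanish: the boundary of the section is a locally injective curve. -/
theorem mult_ne_zero (S : StripLift c B n m) : m ≠ 0 := by
  rintro rfl
  have hconv : Convex ℝ (halfOpenStrip S.r₀) := (convex_Ico _ _).prod convex_univ
  have hmem : ∀ s : ℝ, ((0 : ℝ), s) ∈ halfOpenStrip S.r₀ := fun s =>
    ⟨⟨le_rfl, S.pos⟩, mem_univ _⟩
  obtain ⟨j, hj⟩ := hconv.isPreconnected.exists_int_of_circle_lifts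
    (f := fun x => (S.toFun (x.1, x.2 + 1)).2) (g := fun x => (S.toFun x).2)
    (S.cont_snd.comp (f := fun x : ℝ × ℝ => (x.1, x.2 + 1)) (by fun_prop)
      fun x hx => ⟨hx.1, mem_univ _⟩) S.cont_snd fun x hx => by
      have := circle_coe_add_sign S.sign_eq x.2 1
      rw [Int.cast_one] at this
      exact (S.lifts_snd (x.1, x.2 + 1) ⟨hx.1, mem_univ _⟩).trans
        ((congr_arg (fun z => (c.chart (B.ι (x.1, z))).2) this).trans (S.lifts_snd x hx).symm)
  have hj0 : j = 0 := by
    have hx : (S.r₀ / 2, (0 : ℝ)) ∈ openStrip S.r₀ :=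
      ⟨⟨half_pos S.pos, half_lt_self S.pos⟩, mem_univ _⟩
    have h1 := hj _ (openStrip_subset _ hx)
    simp only at h1
    rw [S.equivariant _ hx, deck_snd] at h1
    have := add_left_cancel h1
    exact_mod_cast this.symm
  -- the longitudinal coordinate on the boundary is periodic, hence it is not injective near its
  -- maximum; but on `γ`, a point is determined by this coordinate
  set f : ℝ → ℝ := fun s => (S.toFun (0, s)).2 with hf
  have hfc : Continuous f := S.cont_snd.comp_continuous (by fun_prop) hmem
  have hper : Function.Periodic f 1 := fun s => by simpa [f, hj0] using hj _ (hmem s)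
  obtain ⟨s, -, hs⟩ := (isCompact_Icc (a := (0 : ℝ)) (b := 1)).exists_isMaxOn
    (nonempty_Icc.2 zero_le_one) hfc.continuousOn
  have hmax : ∀ t, f t ≤ f s := fun t => by
    obtain ⟨u, hu, hut⟩ := hper.exists_mem_Ico₀ zero_lt_one t
    rw [hut]
    exact hs (Ico_subset_Icc_self hu)
  obtain ⟨V, hV, hemb⟩ := B.immersion (0, ((S.sign * s : ℝ) : UnitAddCircle))
    ⟨le_rfl, zero_lt_one⟩
  have hcont : Continuous fun u : ℝ => ((0 : ℝ), ((S.sign * u : ℝ) : UnitAddCircle)) :=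
    continuous_const.prodMk ((AddCircle.continuous_mk' 1).comp (by fun_prop))
  obtain ⟨δ, hδ, hδV⟩ := Metric.eventually_nhds_iff.1 (hcont.continuousAt.eventually_mem hV)
  -- the bound `1 / 3` ensures that `u` and `v` differ by less than a period
  obtain ⟨u, v, huv, hu, hv, hfuv⟩ := exists_ne_of_isMax hfc hmax
    (show 0 < min (δ / 2) (1 / 3) by positivity)
  refine huv ?_
  have hmin := min_le_left (δ / 2) (1 / 3)
  have hmin' := min_le_right (δ / 2) (1 / 3)
  have hmemV : ∀ w, |w - s| ≤ min (δ / 2) (1 / 3) →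
      ((0 : ℝ), ((S.sign * w : ℝ) : UnitAddCircle)) ∈ V ∩ halfOpenAnnulus := fun w hw =>
    ⟨hδV (by rw [Real.dist_eq]; linarith), ⟨le_rfl, zero_lt_one⟩⟩
  have hι : B.ι (0, ((S.sign * u : ℝ) : UnitAddCircle)) =
      B.ι (0, ((S.sign * v : ℝ) : UnitAddCircle)) := by
    apply c.chart.injOn (S.mem_source _ (hmem u)) (S.mem_source _ (hmem v))
    refine Prod.ext ?_ ?_
    · rw [(c.fst_eq_zero_iff (S.mem_source _ (hmem u))).2 (B.ι_zero_mem _),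
        (c.fst_eq_zero_iff (S.mem_source _ (hmem v))).2 (B.ι_zero_mem _)]
    · rw [← S.lifts_snd _ (hmem u), ← S.lifts_snd _ (hmem v)]
      exact congr_arg _ hfuv
  have hinj := injOn_iff_injective.2 hemb.injective (hmemV u hu) (hmemV v hv) hι
  obtain ⟨k, hk⟩ := circle_coe_eq_iff.1 (congr_arg Prod.snd hinj)
  rw [abs_le] at hu hv
  have hk1 : |(k : ℝ)| < 1 := by
    rw [show (k : ℝ) = S.sign * (u - v) by linarith, abs_mul]
    rcases S.sign_eq with h | h <;> rw [h] <;> simp only [abs_one, abs_neg, one_mul] <;>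
      rw [abs_lt] <;> constructor <;> linarith
  have hk0 : k = 0 := by
    rw [← Int.cast_abs] at hk1
    have : |k| < 1 := by exact_mod_cast hk1
    exact Int.abs_lt_one_iff.1 this
  rw [hk0] at hk
  rcases S.sign_eq with h | h <;> rw [h] at hk <;> simp at hk <;> linarith

/-- The longitudinal coordinate on the strip grows linearly. -/
theorem exists_snd_bound : ∃ r > 0, r ≤ S.r₀ ∧ ∃ K, ∀ x ∈ openStrip r,
    |(S.toFun x).2 - m * x.2| ≤ K := by
  have hc : ContinuousOn (fun x => |(S.toFun x).2 - m * x.2|) (Icc 0 (S.r₀ / 2) ×ˢ Icc 0 1) :=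
    ((S.cont_snd.mono fun x hx => ⟨⟨hx.1.1, hx.1.2.trans_lt (half_lt_self S.pos)⟩,
      mem_univ _⟩).sub (by fun_prop)).abs
  obtain ⟨K, hK⟩ := (isCompact_Icc.prod isCompact_Icc).bddAbove_image hc
  refine ⟨S.r₀ / 2, half_pos S.pos, by linarith [S.pos], K, fun x hx => ?_⟩
  have hx' : (x.1, Int.fract x.2) ∈ openStrip S.r₀ :=
    ⟨⟨hx.1.1, hx.1.2.trans (half_lt_self S.pos)⟩, mem_univ _⟩
  have h1 := S.equivariant_int ⌊x.2⌋ _ hx'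
  simp only [Int.fract_add_floor] at h1
  have h2 : |(S.toFun (x.1, Int.fract x.2)).2 - m * Int.fract x.2| ≤ K :=
    hK ⟨(x.1, Int.fract x.2), ⟨⟨hx.1.1.le, hx.1.2.le⟩, Int.fract_nonneg _,
      (Int.fract_lt_one _).le⟩, rfl⟩
  rw [show x = (x.1, x.2) from rfl, h1, deck_snd]
  rw [show ((x.1, x.2) : ℝ × ℝ).2 = x.2 from rfl]
  convert h2 using 2
  have := Int.floor_add_fract x.2
  push_cast
  linear_combination (m : ℝ) * this

/-- The point of the section with the coordinates `x` in the strip. -/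
def point (x : ℝ × ℝ) : M := B.ι (x.1, ((S.sign * x.2 : ℝ) : UnitAddCircle))

theorem point_mem_source {x : ℝ × ℝ} (hx : x ∈ openStrip S.r₀) : S.point x ∈ c.chart.source :=
  S.mem_source x (openStrip_subset _ hx)

theorem chart_point {x : ℝ × ℝ} (hx : x ∈ openStrip S.r₀) :
    c.chart (S.point x) = logCover (S.toFun x) := (S.lifts x hx).symm

theorem point_mem_interior {x : ℝ × ℝ} (hx : x ∈ openStrip S.r₀) : S.point x ∈ B.interior :=
  ⟨_, ⟨hx.1.1, hx.1.2.trans_le S.le_one⟩, rfl⟩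

theorem continuousOn_point : ContinuousOn S.point (openStrip S.r₀) :=
  B.continuousOn_ι.comp (f := fun x : ℝ × ℝ => (x.1, ((S.sign * x.2 : ℝ) : UnitAddCircle)))
    (continuous_fst.prodMk ((AddCircle.continuous_mk' 1).comp (by fun_prop))).continuousOn
    fun _ hx => ⟨hx.1.1.le, hx.1.2.trans_le S.le_one⟩

theorem sign_mul_self : S.sign * S.sign = 1 := by
  rcases S.sign_eq with h | h <;> rw [h] <;> norm_num

theorem point_eq_iff {x y : ℝ × ℝ} (hx : x ∈ openStrip S.r₀) (hy : y ∈ openStrip S.r₀) :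
    S.point x = S.point y ↔ ∃ k : ℤ, x = (y.1, y.2 + k) := by
  constructor
  · intro h
    have := B.injOn_ι ⟨hx.1.1, hx.1.2.trans_le S.le_one⟩ ⟨hy.1.1, hy.1.2.trans_le S.le_one⟩ h
    obtain ⟨k, hk⟩ := circle_coe_eq_iff.1 (congr_arg Prod.snd this)
    have h1 : x.1 = y.1 := (Prod.ext_iff.1 this).1
    rcases S.sign_eq with hs | hs <;> rw [hs] at hk
    · exact ⟨k, Prod.ext h1 (by simpa using hk)⟩
    · exact ⟨-k, Prod.ext h1 (by push_cast; linarith)⟩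
  · rintro ⟨k, rfl⟩
    simp only [point, circle_coe_add_sign S.sign_eq]

/-- Maps to a thin collar of the section, from a convex set, lift to the strip. -/
theorem exists_lift {X : Type*} [NormedAddCommGroup X] [NormedSpace ℝ X] {U : Set X}
    (hU : Convex ℝ U) {w : X → M} (hw : ContinuousOn w U) {ρ : ℝ}
    (hmem : ∀ x ∈ U, ∃ p ∈ openAnnulus, p.1 < ρ ∧ B.ι p = w x) :
    ∃ f : X → ℝ × ℝ, ContinuousOn f U ∧ ∀ x ∈ U, f x ∈ openStrip ρ ∧ S.point (f x) = w x := by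
  have hmem' : ∀ x, ∃ p, x ∈ U → p ∈ openAnnulus ∧ p.1 < ρ ∧ B.ι p = w x := fun x => by
    by_cases hx : x ∈ U
    · obtain ⟨p, h⟩ := hmem x hx
      exact ⟨p, fun _ => h⟩
    · exact ⟨(0, 0), fun h => (hx h).elim⟩
  choose p hp using hmem'
  have hpc : ContinuousOn p U := by
    rw [continuousOn_iff_continuous_domRestrict]
    have h1 : Continuous fun x : U => (⟨p x, (hp x x.2).1⟩ : openAnnulus) := by
      rw [B.embedding.continuous_iff]
      refine (continuousOn_iff_continuous_domRestrict.1 hw).congr fun x => ?_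
      exact (hp x x.2).2.2.symm
    exact continuous_subtype_val.comp h1
  obtain ⟨Z, hZ, hZl⟩ := exists_circle_lift hU hpc.snd
  refine ⟨fun x => ((p x).1, S.sign * Z x), hpc.fst.prodMk (continuousOn_const.mul hZ),
    fun x hx => ⟨⟨⟨(hp x hx).1.1, (hp x hx).2.1⟩, mem_univ _⟩, ?_⟩⟩
  simp only [point]
  rw [← mul_assoc, S.sign_mul_self, one_mul, hZl x hx]
  exact (hp x hx).2.2

end StripLift

namespace LocalBirkhoffSection

variable {M : Type*} [TopologicalSpace M] {φ : Flow ℝ M} {γ : Set M}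
  {c : SaddleChart φ γ} {B : LocalBirkhoffSection φ γ} {n m : ℤ}

/-- A path in the stable manifold that starts on the periodic orbit has a lift with constant angular
coordinate and bounded longitudinal coordinate. -/
theorem exists_segment_lift {w : ℝ → M} (hw : ContinuousOn w (Icc 0 1))
    (hγ : ∀ t ∈ Icc (0 : ℝ) 1, w t ∈ γ ↔ t = 0)
    (hst : ∀ t ∈ Icc (0 : ℝ) 1, w t ∈ c.stable) :
    ∃ P : ℝ → ℂ × ℝ, ContinuousOn P (Ioc 0 1) ∧
      (∀ t ∈ Ioc (0 : ℝ) 1, logCover (P t) = c.chart (w t)) ∧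
      (∃ k : ℤ, ∀ t ∈ Ioc (0 : ℝ) 1, (P t).1.im = k * Real.pi) ∧
      (∃ K, ∀ t ∈ Ioc (0 : ℝ) 1, |(P t).2| ≤ K) ∧
      Tendsto (fun t => (P t).1.re) (𝓝[>] 0) atBot := by
  have hc : ContinuousOn (fun t => c.chart (w t)) (Icc 0 1) :=
    c.chart.continuousOn.comp hw fun t ht => (hst t ht).1
  have hpos : ∀ t ∈ Ioc (0 : ℝ) 1, (c.chart (w t)).1 ≠ 0 := fun t ht => by
    rw [Ne, c.fst_eq_zero_iff (hst t (Ioc_subset_Icc_self ht)).1, hγ t (Ioc_subset_Icc_self ht)]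
    exact ht.1.ne'
  obtain ⟨L, hL, hLl⟩ := exists_log_lift (convex_Ioc 0 1) (hc.mono Ioc_subset_Icc_self).fst hpos
  obtain ⟨Z, hZ, hZl⟩ := exists_circle_lift (convex_Icc 0 1) hc.snd
  obtain ⟨K, hK⟩ := isCompact_Icc.bddAbove_image hZ.abs
  have hint : ∀ t ∈ Ioc (0 : ℝ) 1, ∃ k : ℤ, (L t).im / Real.pi = k := by
    intro t ht
    have h2 := (hst t (Ioc_subset_Icc_self ht)).2
    rw [← hLl t ht] at h2
    simp only [Complex.exp_im, mul_eq_zero, Real.exp_ne_zero, false_or] at h2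
    obtain ⟨k, hk⟩ := Real.sin_eq_zero_iff.1 h2
    exact ⟨k, by rw [← hk]; field_simp⟩
  refine ⟨fun t => (L t, Z t), hL.prodMk (hZ.mono Ioc_subset_Icc_self),
    fun t ht => Prod.ext (hLl t ht) (hZl t (Ioc_subset_Icc_self ht)), ?_,
    ⟨K, fun t ht => hK ⟨t, Ioc_subset_Icc_self ht, rfl⟩⟩, ?_⟩
  · obtain ⟨k, hk⟩ := hint 1 ⟨zero_lt_one, le_rfl⟩
    refine ⟨k, fun t ht => ?_⟩
    have := isPreconnected_Ioc.eq_of_int_valued (f := fun t => (L t).im / Real.pi)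
      ((Complex.continuous_im.comp_continuousOn hL).div_const _) hint ht ⟨zero_lt_one, le_rfl⟩
    rw [hk, div_eq_iff Real.pi_ne_zero] at this
    exact this
  · have h0 : Tendsto (fun t => ‖(c.chart (w t)).1‖) (𝓝[>] 0) (𝓝 0) := by
      have h1 := (hc 0 ⟨le_rfl, zero_le_one⟩).fst.norm.tendsto
      have h2 : (c.chart (w 0)).1 = 0 :=
        (c.fst_eq_zero_iff (hst 0 ⟨le_rfl, zero_le_one⟩).1).2 ((hγ 0 ⟨le_rfl, zero_le_one⟩).2 rfl)
      rw [h2, norm_zero] at h1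
      rw [← nhdsWithin_Ioc_eq_nhdsGT zero_lt_one]
      exact h1.mono_left (nhdsWithin_mono _ Ioc_subset_Icc_self)
    have h3 : Tendsto (fun t => Real.exp (L t).re) (𝓝[>] 0) (𝓝 0) := by
      refine h0.congr' ?_
      filter_upwards [Ioc_mem_nhdsGT zero_lt_one] with t ht
      rw [← hLl t ht, Complex.norm_exp]
    exact Real.tendsto_exp_comp_nhds_zero.1 h3

end LocalBirkhoffSection

namespace StripLift

variable {M : Type*} [TopologicalSpace M] {φ : Flow ℝ M} {γ : Set M}
  {c : SaddleChart φ γ} {B : LocalBirkhoffSection φ γ} {n m : ℤ} (S : StripLift c B n m)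

/-- On a fundamental domain of the strip, the angular coordinate of the points that lie on a given
segment of the stable manifold is bounded. -/
theorem exists_angle_bound_segment {w : ℝ → M} (hw : ContinuousOn w (Icc 0 1))
    (hγ : ∀ t ∈ Icc (0 : ℝ) 1, w t ∈ γ ↔ t = 0)
    (hst : ∀ t ∈ Icc (0 : ℝ) 1, w t ∈ c.stable)
    (hB : ∀ t ∈ Icc (0 : ℝ) 1, w t ∈ B.ι '' halfOpenAnnulus) :
    ∃ ρ > 0, ∃ A, ∀ x ∈ openStrip ρ, x ∈ openStrip S.r₀ → x.2 ∈ Icc (0 : ℝ) 1 →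
      S.point x ∈ w '' Icc 0 1 → |(S.toFun x).1.im| ≤ A := by
  obtain ⟨P, hPc, hPl, ⟨k, hk⟩, ⟨K, hK⟩, -⟩ := LocalBirkhoffSection.exists_segment_lift hw hγ hst
  have hopen : ∀ t ∈ Ioc (0 : ℝ) 1, ∃ p ∈ openAnnulus, B.ι p = w t := fun t ht => by
    obtain ⟨p, hp, hpw⟩ := hB t (Ioc_subset_Icc_self ht)
    refine ⟨p, ⟨lt_of_le_of_ne hp.1 fun h0 => ?_, hp.2⟩, hpw⟩
    have h1 := (B.ι_mem_iff hp).2 h0.symm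
    rw [hpw, hγ t (Ioc_subset_Icc_self ht)] at h1
    exact ht.1.ne' h1
  obtain ⟨r, hr, hrS, K', hK'⟩ := S.exists_snd_bound
  -- near the periodic orbit, the segment lifts to the strip
  obtain ⟨t₀, ht₀, hcol⟩ : ∃ t₀ ∈ Ioc (0 : ℝ) 1, ∀ t ∈ Ioc (0 : ℝ) t₀,
      ∃ p ∈ openAnnulus, p.1 < r ∧ B.ι p = w t := by
    have h1 := (hw 0 ⟨le_rfl, zero_le_one⟩).eventually (eventually_nhdsSet_iff_forall.1
      (B.collar r hr) _ ((hγ 0 ⟨le_rfl, zero_le_one⟩).2 rfl))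
    rw [nhdsWithin_Icc_eq_nhdsGE zero_lt_one] at h1
    obtain ⟨u, hu, hsub⟩ := mem_nhdsGE_iff_exists_Ico_subset.1 h1
    have hu0 : (0 : ℝ) < u := hu
    refine ⟨min (u / 2) 1, ⟨by positivity, min_le_right _ _⟩, fun t ht => ?_⟩
    have h2 := min_le_left (u / 2) 1
    obtain ⟨p, hp, hpw⟩ := hopen t ⟨ht.1, ht.2.trans (min_le_right _ _)⟩
    exact ⟨p, hp, hsub ⟨ht.1.le, by linarith [ht.2]⟩ p ⟨hp.1.le, hp.2⟩ hpw, hpw⟩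
  have hsub : Ioc 0 t₀ ⊆ Ioc (0 : ℝ) 1 := Ioc_subset_Ioc_right ht₀.2
  obtain ⟨f, hfc, hf⟩ := S.exists_lift (convex_Ioc 0 t₀)
    (hw.mono (hsub.trans Ioc_subset_Icc_self)) hcol
  have hfS : ∀ t ∈ Ioc 0 t₀, f t ∈ openStrip S.r₀ := fun t ht => openStrip_mono hrS (hf t ht).1
  obtain ⟨i, j, hij⟩ := isPreconnected_Ioc.exists_deck (f := fun t => S.toFun (f t)) (g := P)
    (S.cont.comp hfc hfS) (hPc.mono hsub) fun t ht => by
      rw [← S.chart_point (hfS t ht), (hf t ht).2, hPl t (hsub ht)]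
  -- away from the periodic orbit, the radial coordinate of the segment is bounded below
  obtain ⟨ρ, hρ, hρt⟩ : ∃ ρ > 0, ∀ t ∈ Icc t₀ 1, ∀ p ∈ openAnnulus, B.ι p = w t → ρ ≤ p.1 := by
    have hcpt : IsCompact (w '' Icc t₀ 1) :=
      isCompact_Icc.image_of_continuousOn (hw.mono (Icc_subset_Icc_left ht₀.1.le))
    choose! q hq hqw using hopen
    have hqc : ContinuousOn q (Icc t₀ 1) := by
      rw [continuousOn_iff_continuous_domRestrict]
      have hmem : ∀ t ∈ Icc t₀ 1, t ∈ Ioc (0 : ℝ) 1 := fun t ht => ⟨ht₀.1.trans_le ht.1, ht.2⟩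
      have h1 : Continuous fun t : Icc t₀ 1 => (⟨q t, hq t (hmem t t.2)⟩ : openAnnulus) := by
        rw [B.embedding.continuous_iff]
        refine (continuousOn_iff_continuous_domRestrict.1
          (hw.mono (Icc_subset_Icc_left ht₀.1.le))).congr fun t => ?_
        exact (hqw t (hmem t t.2)).symm
      exact continuous_subtype_val.comp h1
    obtain ⟨t', ht', hmin⟩ := isCompact_Icc.exists_isMinOn (nonempty_Icc.2 ht₀.2) hqc.fst
    refine ⟨(q t').1, (hq t' ⟨ht₀.1.trans_le ht'.1, ht'.2⟩).1, fun t ht p hp hpw => ?_⟩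
    have htm : t ∈ Ioc (0 : ℝ) 1 := ⟨ht₀.1.trans_le ht.1, ht.2⟩
    rw [B.injOn_ι hp (hq t htm) (hpw.trans (hqw t htm).symm)]
    exact hmin ht
  have hm : (1 : ℝ) ≤ |(m : ℝ)| := by
    rw [← Int.cast_abs]
    exact_mod_cast Int.one_le_abs S.mult_ne_zero
  -- a point of the strip over the segment is a translate, by a bounded number `l` of periods, of a
  -- point of the lifted segment
  refine ⟨ρ, hρ, |k * Real.pi + 2 * Real.pi * i| + 2 * Real.pi * |(n : ℝ)| * (K + |(j : ℝ)| + K' + 1),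
    fun x hxρ hx hx2 hxw => ?_⟩
  obtain ⟨t, ht, hwt⟩ := hxw
  have hxm := S.point_mem_interior hx
  have ht0 : 0 < t := lt_of_le_of_ne ht.1 fun h0 => B.notMem_of_mem_interior hxm
    (hwt ▸ (hγ t ht).2 h0.symm)
  have htt : t ∈ Ioc 0 t₀ := by
    refine ⟨ht0, not_lt.1 fun h => ?_⟩
    exact absurd (hρt t ⟨h.le, ht.2⟩ _ ⟨hx.1.1, hx.1.2.trans_le S.le_one⟩ hwt.symm)
      (not_le.2 hxρ.1.2)
  obtain ⟨l, hl⟩ := (S.point_eq_iff hx (hfS t htt)).1 (hwt.symm.trans (hf t htt).2.symm)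
  have h1 := S.equivariant_int l _ (hfS t htt)
  rw [← hl, hij t htt] at h1
  have h2 : (S.toFun x).1.im = k * Real.pi + 2 * Real.pi * i + 2 * Real.pi * n * l := by
    rw [h1, deck_im, deck_im, hk t (hsub htt)]; push_cast; ring
  have h3 : |(m : ℝ) * (f t).2| ≤ K + |(j : ℝ)| + K' := by
    have h4 := hK' _ (hf t htt).1
    rw [hij t htt, deck_snd] at h4
    have h5 := hK t (hsub htt)
    have h6 := abs_add_three (P t).2 (j : ℝ) (-((P t).2 + j - m * (f t).2))
    rw [abs_neg] at h6
    rw [show (m : ℝ) * (f t).2 = (P t).2 + j + -((P t).2 + j - m * (f t).2) by ring]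
    linarith
  have h7 : |(f t).2| ≤ K + |(j : ℝ)| + K' := by
    rw [abs_mul] at h3
    nlinarith [abs_nonneg (f t).2]
  have h8 : |(l : ℝ)| ≤ K + |(j : ℝ)| + K' + 1 := by
    have : (l : ℝ) = x.2 - (f t).2 := by rw [hl]; simp
    rw [this]
    have := abs_sub x.2 (f t).2
    have h9 : |x.2| ≤ 1 := abs_le.2 ⟨by linarith [hx2.1], hx2.2⟩
    linarith
  rw [h2]
  refine (abs_add_le _ _).trans (add_le_add le_rfl ?_)
  rw [abs_mul, abs_mul, abs_of_pos Real.two_pi_pos]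
  exact mul_le_mul_of_nonneg_left h8 (by positivity)

/-- Near the periodic orbit, the angular coordinate of a tame section is bounded on a fundamental
domain of the strip: the section meets the stable manifold only along finitely many segments. -/
theorem exists_angle_bound (hB : B.IsTame c) : ∃ ρ > 0, ρ ≤ S.r₀ ∧ ∃ A,
    ∀ x ∈ openStrip ρ, x.2 ∈ Icc (0 : ℝ) 1 → |(S.toFun x).1.im| ≤ A := by
  obtain ⟨U, ⟨hUsub, ⟨ε, hε, hεU⟩, -⟩, ⟨N, w, hw, hunion⟩, -⟩ := hB
  have hsub : ∀ i, ∀ t ∈ Icc (0 : ℝ) 1, w i t ∈ B.ι '' U ∩ c.stable := fun i t ht => by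
    rw [hunion]
    exact Or.inr (mem_iUnion.2 ⟨i, t, ht, rfl⟩)
  choose ρ hρ A hA using fun i => S.exists_angle_bound_segment (hw i).1 (hw i).2.2
    (fun t ht => (hsub i t ht).2) fun t ht => image_mono hUsub (hsub i t ht).1
  obtain ⟨ρ', ⟨h1, h2, h3⟩, hρ'⟩ := (((eventually_all.2 fun i =>
    eventually_nhdsWithin_of_eventually_nhds (eventually_lt_nhds (hρ i))).and
    ((eventually_nhdsWithin_of_eventually_nhds (eventually_lt_nhds hε)).and
    (eventually_nhdsWithin_of_eventually_nhds (eventually_lt_nhds S.pos)))).and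
    (eventually_mem_nhdsWithin (a := (0 : ℝ)) (s := Ioi 0))).exists
  obtain ⟨A', hA'⟩ := (finite_range A).bddAbove
  have hρ'0 : 0 < ρ' := hρ'
  -- the section lies in the stable manifold exactly where the angle is a multiple of `π`
  have hkey : ∀ x ∈ openStrip ρ', x.2 ∈ Icc (0 : ℝ) 1 → ∀ k : ℤ,
      (S.toFun x).1.im = k * Real.pi → |(S.toFun x).1.im| ≤ A' := by
    intro x hx hx2 k hk
    have hxS : x ∈ openStrip S.r₀ := openStrip_mono h3.le hx
    have hmem : S.point x ∈ B.ι '' U ∩ c.stable := by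
      refine ⟨⟨_, hεU _ hx.1.1.le (hx.1.2.trans h2), rfl⟩, S.point_mem_source hxS, ?_⟩
      rw [S.chart_point hxS]
      simp only [logCover, Complex.exp_im, hk, Real.sin_int_mul_pi, mul_zero]
    rw [hunion] at hmem
    rcases hmem with hmem | hmem
    · exact (B.notMem_of_mem_interior (S.point_mem_interior hxS) hmem).elim
    · obtain ⟨i, hi⟩ := mem_iUnion.1 hmem
      exact (hA i x (openStrip_mono (h1 i).le hx) hxS hx2 hi).trans (hA' ⟨i, rfl⟩)
  set D : Set (ℝ × ℝ) := Ioo 0 ρ' ×ˢ Icc 0 1 with hD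
  have hDc : IsPreconnected ((fun x => |(S.toFun x).1.im|) '' D) :=
    ((convex_Ioo 0 ρ').prod (convex_Icc 0 1)).isPreconnected.image _
      ((Complex.continuous_im.comp_continuousOn
        (S.cont.mono fun x hx => openStrip_mono h3.le ⟨hx.1, mem_univ _⟩).fst).abs)
  have hx₀ : (ρ' / 2, (0 : ℝ)) ∈ D := ⟨⟨half_pos hρ'0, half_lt_self hρ'0⟩, by simp⟩
  set v := max |(S.toFun (ρ' / 2, 0)).1.im| A' with hv
  refine ⟨ρ', hρ', h3.le, v + Real.pi, fun x hx hx2 => not_lt.1 fun hlt => ?_⟩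
  -- a multiple of `π` in the interval `(v, v + π]` would be a value of the angle
  have hvpi : v < (⌊v / Real.pi⌋ + 1 : ℤ) * Real.pi := by
    rw [← div_lt_iff₀ Real.pi_pos]; push_cast; exact Int.lt_floor_add_one _
  have hvpi' : (⌊v / Real.pi⌋ + 1 : ℤ) * Real.pi ≤ v + Real.pi := by
    have := Int.floor_le (v / Real.pi)
    rw [le_div_iff₀ Real.pi_pos] at this
    push_cast; linarith
  obtain ⟨y, hy, hyv⟩ := hDc.Icc_subset (mem_image_of_mem _ hx₀)
    (mem_image_of_mem _ (show x ∈ D from ⟨hx.1, hx2⟩))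
    (show ((⌊v / Real.pi⌋ + 1 : ℤ) : ℝ) * Real.pi ∈ _ from
      ⟨(le_max_left _ _).trans hvpi.le, hvpi'.trans hlt.le⟩)
  simp only at hyv
  have hle : |(S.toFun y).1.im| ≤ A' := by
    rcases abs_choice (S.toFun y).1.im with h | h
    · exact hkey y ⟨hy.1, mem_univ _⟩ hy.2 _ (h.symm.trans hyv)
    · exact hkey y ⟨hy.1, mem_univ _⟩ hy.2 (-(⌊v / Real.pi⌋ + 1)) (by
        rw [h] at hyv; push_cast at hyv ⊢; linarith)
  rw [hyv] at hle
  exact absurd (hle.trans (le_max_right |(S.toFun (ρ' / 2, 0)).1.im| A')) (not_le.2 hvpi)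

/-- The function `n Z - m θ / 2π`, which is invariant under the deck transformation of the section,
is bounded on the section. -/
theorem exists_slope_bound (hB : B.IsTame c) : ∃ ρ > 0, ρ ≤ S.r₀ ∧ ∃ A,
    ∀ x ∈ openStrip ρ, |n * (S.toFun x).2 - m * ((S.toFun x).1.im / (2 * Real.pi))| ≤ A := by
  obtain ⟨ρ, hρ, hρS, A, hA⟩ := S.exists_angle_bound hB
  obtain ⟨r, hr, hrS, K, hK⟩ := S.exists_snd_bound
  refine ⟨min ρ r, lt_min hρ hr, (min_le_left _ _).trans hρS,
    |(n : ℝ)| * (K + |(m : ℝ)|) + |(m : ℝ)| * (A / (2 * Real.pi)), fun x hx => ?_⟩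
  have hper : ∀ y ∈ openStrip S.r₀, ∀ k : ℤ,
      n * (S.toFun (y.1, y.2 + k)).2 - m * ((S.toFun (y.1, y.2 + k)).1.im / (2 * Real.pi)) =
      n * (S.toFun y).2 - m * ((S.toFun y).1.im / (2 * Real.pi)) := fun y hy k => by
    rw [S.equivariant_int k y hy, deck_snd, deck_im]
    have := Real.pi_ne_zero
    push_cast
    field_simp
    ring
  have hy : ((x.1, Int.fract x.2) : ℝ × ℝ) ∈ openStrip (min ρ r) := ⟨hx.1, mem_univ _⟩
  have h1 := hper _ (openStrip_mono ((min_le_left _ _).trans hρS) hy) ⌊x.2⌋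
  simp only [Int.fract_add_floor, Prod.mk.eta] at h1
  rw [h1]
  set y : ℝ × ℝ := (x.1, Int.fract x.2) with hyd
  have hy2 : y.2 ∈ Icc (0 : ℝ) 1 := ⟨Int.fract_nonneg _, (Int.fract_lt_one _).le⟩
  have h2 := hA y (openStrip_mono (min_le_left _ _) hy) hy2
  have h3 : |(S.toFun y).2| ≤ K + |(m : ℝ)| := by
    have h4 := hK y (openStrip_mono (min_le_right _ _) hy)
    have h5 := abs_add_le ((S.toFun y).2 - m * y.2) (m * y.2)
    rw [sub_add_cancel, abs_mul (m : ℝ), abs_of_nonneg hy2.1] at h5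
    nlinarith [abs_nonneg (m : ℝ), hy2.2]
  refine (abs_sub _ _).trans (add_le_add ?_ ?_)
  · rw [abs_mul]
    exact mul_le_mul_of_nonneg_left h3 (abs_nonneg _)
  · rw [abs_mul, abs_div, abs_of_pos Real.two_pi_pos]
    gcongr

end StripLift

/-- The section contains a path in the positive half of the stable manifold that converges to the
periodic orbit. -/
theorem LocalBirkhoffSection.exists_stable_path {M : Type*} [TopologicalSpace M] {φ : Flow ℝ M}
    {γ : Set M} {c : SaddleChart φ γ} {B : LocalBirkhoffSection φ γ}
    (hγ : IsPeriodicOrbit φ γ) (hB : B.IsTame c) :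
    ∃ P : ℝ → ℂ × ℝ, ContinuousOn P (Ioc 0 1) ∧ (∀ t ∈ Ioc (0 : ℝ) 1, (P t).1.im = 0) ∧
      (∃ K, ∀ t ∈ Ioc (0 : ℝ) 1, |(P t).2| ≤ K) ∧
      Tendsto (fun t => (P t).1.re) (𝓝[>] 0) atBot ∧
      ∀ t ∈ Ioc (0 : ℝ) 1, ∃ x ∈ c.chart.source, x ∈ B.interior ∧ c.chart x = logCover (P t) := by
  obtain ⟨U, ⟨hUsub, ⟨ε, hε, hεU⟩, -⟩, ⟨N, w, hw, hunion⟩, -⟩ := hB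
  obtain ⟨T, hT, hhit⟩ := B.exists_hit hγ
  -- a hit of the orbit of a point in the positive half of the stable manifold
  have hev := hhit.and (φ.eventually_nhdsSet_forall (fun x hx t => hγ.flow_mem hx t)
    ((B.collar ε hε).and c.source_mem_nhdsSet) T)
  obtain ⟨δ, hδ, hδq⟩ := c.eventually_nhdsSet_iff.1 hev
  obtain ⟨htar, hx, hflow⟩ := hδq ((δ / 2 : ℝ), 0) (by
    rw [Complex.norm_real, Real.norm_of_nonneg (by positivity)]; linarith)
  set x := c.chart.symm (((δ / 2 : ℝ) : ℂ), 0) with hxd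
  have hxc : c.chart x = (((δ / 2 : ℝ) : ℂ), 0) := c.chart.right_inv htar
  have hxs : x ∈ c.chart.source := c.chart.map_target htar
  obtain ⟨t, ht, hxt⟩ := hx (by
    rw [← c.fst_eq_zero_iff hxs, hxc]
    simpa using hδ.ne')
  have htT : t ∈ Icc (-T) T := ⟨by linarith [ht.1], ht.2⟩
  have hstay : t ∈ stayTimes φ c.chart.source x := Icc_subset_stayTimes ht.1 fun s hs =>
    (hflow s ⟨by linarith [hs.1], hs.2.trans ht.2⟩).2
  have hch := c.chart_flow hxs hstay
  have hre : 0 < (c.chart (φ t x)).1.re := by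
    rw [hch, SaddleChart.model, saddleFlow_re, hxc]
    simp only [Complex.ofReal_re]
    positivity
  have him : (c.chart (φ t x)).1.im = 0 := by
    rw [hch, SaddleChart.model, saddleFlow_im, hxc, Complex.ofReal_im, mul_zero]
  have hmem : φ t x ∈ B.ι '' U ∩ c.stable := by
    obtain ⟨p, hp, hpx⟩ := hxt
    exact ⟨⟨p, hεU p hp.1.le ((hflow t htT).1 p ⟨hp.1.le, hp.2⟩ hpx), hpx⟩,
      (hflow t htT).2, him⟩
  rw [hunion] at hmem
  rcases hmem with hmem | hmem
  · exact (B.notMem_of_mem_interior hxt hmem).elim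
  obtain ⟨i, t₁, ht₁, hwt₁⟩ := mem_iUnion.1 hmem
  have hsub : ∀ t ∈ Icc (0 : ℝ) 1, w i t ∈ B.ι '' U ∩ c.stable := fun t ht => by
    rw [hunion]
    exact Or.inr (mem_iUnion.2 ⟨i, t, ht, rfl⟩)
  have ht₁0 : t₁ ∈ Ioc (0 : ℝ) 1 := ⟨lt_of_le_of_ne ht₁.1 fun h0 =>
    B.notMem_of_mem_interior hxt (hwt₁ ▸ ((hw i).2.2 t₁ ht₁).2 h0.symm), ht₁.2⟩
  obtain ⟨P, hPc, hPl, ⟨k, hk⟩, ⟨K, hK⟩, hlim⟩ := exists_segment_lift (hw i).1 (hw i).2.2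
    fun t ht => (hsub t ht).2
  -- the segment lies in the positive half of the stable manifold, as one of its points does
  have hkeven : Even k := by
    rw [← hwt₁, ← hPl t₁ ht₁0] at hre
    simp only [logCover, Complex.exp_re, hk t₁ ht₁0] at hre
    by_contra hodd
    obtain ⟨l, rfl⟩ := Int.not_even_iff_odd.1 hodd
    rw [show ((2 * l + 1 : ℤ) : ℝ) * Real.pi = Real.pi + l * (2 * Real.pi) by push_cast; ring,
      Real.cos_add_int_mul_two_pi, Real.cos_pi] at hre
    linarith [Real.exp_pos (P t₁).1.re]
  obtain ⟨l, rfl⟩ := hkeven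
  refine ⟨fun t => deck (-l) 0 (P t), (continuous_deck _ _).comp_continuousOn hPc, fun t ht => ?_,
    ⟨K, fun t ht => by simpa using hK t ht⟩, by simpa using hlim, fun t ht => ?_⟩
  · rw [deck_im, hk t ht]; push_cast; ring
  · have h1 := hsub t (Ioc_subset_Icc_self ht)
    obtain ⟨p, hp, hpw⟩ := h1.1
    refine ⟨w i t, h1.2.1, ⟨p, ⟨lt_of_le_of_ne (hUsub hp).1 fun h0 => ?_, (hUsub hp).2⟩, hpw⟩, ?_⟩
    · have h2 := (B.ι_mem_iff (hUsub hp)).2 h0.symm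
      rw [hpw, (hw i).2.2 t (Ioc_subset_Icc_self ht)] at h2
      exact ht.1.ne' h2
    · rw [logCover_deck, hPl t ht]

/-- A path in the lift of the stable manifold, with bounded longitudinal coordinate, that converges
to the periodic orbit: the orbit of its end point meets its translates along the longitude. -/
theorem exists_translate_on_orbit {P : ℝ → ℂ × ℝ} {t₁ : ℝ} (ht₁ : 0 < t₁)
    (hPc : ContinuousOn P (Ioc 0 t₁)) (him : ∀ t ∈ Ioc 0 t₁, (P t).1.im = 0) {A : ℝ}
    (hA : ∀ t ∈ Ioc 0 t₁, |(P t).2| ≤ A) (hlim : Tendsto (fun t => (P t).1.re) (𝓝[>] 0) atBot)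
    {a : ℝ} (ha : a < 0) {N : ℤ} (hN : 2 * A < N) :
    ∃ t₂ ∈ Ioc 0 t₁, ∃ σ > 0, ((P t₁).1 + (a * σ : ℝ), (P t₁).2 + σ) = deck 0 N (P t₂) := by
  have hm₁ : t₁ ∈ Ioc 0 t₁ := ⟨ht₁, le_rfl⟩
  have hN0 : (0 : ℝ) < N := by linarith [(abs_nonneg _).trans (hA t₁ hm₁)]
  -- the coordinate of the orbits tends to `-∞` along the path, and the translation by `N` adds
  -- `-a * N` to it
  obtain ⟨t₂, ht₂, hcoord⟩ : ∃ t₂ ∈ Ioc 0 t₁,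
      TubeLift.orbitCoord a (P t₂) = TubeLift.orbitCoord a (P t₁) + a * N := by
    have hcc : ContinuousOn (fun t => TubeLift.orbitCoord a (P t)) (Ioc 0 t₁) := by
      unfold TubeLift.orbitCoord
      exact (Complex.continuous_re.comp_continuousOn hPc.fst).sub
        (continuousOn_const.mul hPc.snd)
    have hbot : Tendsto (fun t => TubeLift.orbitCoord a (P t)) (𝓝[>] 0) atBot := by
      refine tendsto_atBot_mono' _ ?_ (tendsto_atBot_add_const_right _ (-a * A) hlim)
      filter_upwards [Ioc_mem_nhdsGT ht₁] with t ht
      have := (abs_le.1 (hA t ht)).2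
      unfold TubeLift.orbitCoord
      nlinarith
    obtain ⟨t₀, hlt, ht₀⟩ := ((hbot.eventually_lt_atBot
      (TubeLift.orbitCoord a (P t₁) + a * N)).and (Ioc_mem_nhdsGT ht₁)).exists
    obtain ⟨t₂, ht₂, h⟩ := intermediate_value_Icc ht₀.2
      (hcc.mono fun t ht => ⟨ht₀.1.trans_le ht.1, ht.2⟩)
      (show TubeLift.orbitCoord a (P t₁) + a * N ∈ _ from ⟨hlt.le, by nlinarith⟩)
    exact ⟨t₂, ⟨ht₀.1.trans_le ht₂.1, ht₂.2⟩, h⟩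
  have hA1 := abs_le.1 (hA t₁ hm₁)
  have hA2 := abs_le.1 (hA t₂ ht₂)
  refine ⟨t₂, ht₂, (P t₂).2 + N - (P t₁).2, by linarith, ?_⟩
  unfold TubeLift.orbitCoord at hcoord
  apply logPoint_ext
  · simp only [Complex.add_re, Complex.ofReal_re, deck_re]; linarith
  · simp [him t₁ hm₁, him t₂ ht₂]
  · simp only [deck_snd]; ring

/-! ### The phase with respect to a section -/

namespace LocalBirkhoffSection

variable {M : Type*} [TopologicalSpace M] {φ : Flow ℝ M} {γ : Set M}
  (B : LocalBirkhoffSection φ γ)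

/-- The function `α` gives, for the points near `x`, the unique time near `t₀` at which the orbit
meets the section. -/
def IsHitTime (x : M) (t₀ : ℝ) (α : M → ℝ) : Prop :=
  ContinuousAt α x ∧ α x = t₀ ∧ ∃ ε > 0, ∀ᶠ y in 𝓝 x, ∀ s, |s - t₀| < ε →
    (φ s y ∈ B.interior ↔ s = α y)

/-- A transverse intersection of an orbit with the section persists for the nearby orbits. -/
theorem exists_isHitTime {x : M} {t₀ : ℝ} (h : φ t₀ x ∈ B.interior) :
    ∃ α, B.IsHitTime x t₀ α := by
  obtain ⟨p, hp, hpx⟩ := h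
  obtain ⟨V, hV, hpV, hVA, δ, hδ, he⟩ := B.transverse p hp
  have hne : Nonempty (V × Ioo (-δ) δ) := ⟨⟨p, hpV⟩, ⟨0, by simp [hδ]⟩⟩
  set e := he.toOpenPartialHomeomorph _ with hedef
  have hesrc : ∀ z, z ∈ e.source := fun z => by simp [e]
  have heq : ∀ z : V × Ioo (-δ) δ, e z = φ (z.2 : ℝ) (B.ι z.1) := fun z => by simp [e]
  set z₀ : V × Ioo (-δ) δ := (⟨p, hpV⟩, ⟨0, by simp [hδ]⟩) with hz₀
  have hz₀x : e z₀ = φ t₀ x := by rw [heq]; simp [z₀, hpx]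
  have htar : φ t₀ x ∈ e.target := hz₀x ▸ e.map_source (hesrc _)
  have hφc : Continuous fun y => φ t₀ y := φ.continuous continuous_const continuous_id
  set α : M → ℝ := fun y => t₀ - ((e.symm (φ t₀ y)).2 : ℝ) with hα
  have hαc : ContinuousAt α x := by
    have h1 : ContinuousAt (fun y => e.symm (φ t₀ y)) x :=
      ContinuousAt.comp (f := fun y => φ t₀ y) (e.continuousAt_symm htar) hφc.continuousAt
    exact continuousAt_const.sub (continuous_subtype_val.continuousAt.comp h1.snd)
  have hαx : α x = t₀ := by
    simp only [α]
    rw [← hz₀x, e.left_inv (hesrc _)]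
    simp [z₀]
  -- the image of `V` is open in the section
  obtain ⟨O, hO, hOV⟩ := B.embedding.isInducing.isOpen_iff.1
    (hV.preimage (continuous_subtype_val (p := (· ∈ openAnnulus))))
  have hOV' : ∀ v ∈ openAnnulus, B.ι v ∈ O ↔ v ∈ V := fun v hv =>
    Set.ext_iff.1 hOV ⟨v, hv⟩
  have hev : ∀ᶠ q : M × ℝ in 𝓝 (x, t₀), φ q.2 q.1 ∈ O :=
    (φ.continuous continuous_snd continuous_fst).continuousAt.eventually
      (hO.mem_nhds (show φ t₀ x ∈ O from hpx ▸ (hOV' p hp).2 hpV))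
  rw [nhds_prod_eq] at hev
  obtain ⟨pa, hpa, pb, hpb, hab⟩ := eventually_prod_iff.1 hev
  obtain ⟨ε, hε, hεb⟩ := Metric.eventually_nhds_iff.1 hpb
  refine ⟨α, hαc, hαx, min δ ε, lt_min hδ hε, ?_⟩
  filter_upwards [hpa, hφc.continuousAt.eventually (e.open_target.mem_nhds htar)] with y hy1 hy2
  intro s hs
  constructor
  · rintro ⟨v, hv, hvs⟩
    have hvV : v ∈ V := (hOV' v hv).1
      (hvs ▸ hab hy1 (hεb (by rw [Real.dist_eq]; exact hs.trans_le (min_le_right _ _))))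
    have hs' : t₀ - s ∈ Ioo (-δ) δ := by
      have := hs.trans_le (min_le_left _ _)
      rw [abs_sub_comm, abs_lt] at this
      exact this
    have h1 : φ t₀ y = e (⟨v, hvV⟩, ⟨t₀ - s, hs'⟩) := by
      rw [heq]
      simp only
      rw [hvs, ← φ.map_add]
      congr 1; ring
    simp only [α]
    rw [h1, e.left_inv (hesrc _)]
    simp
  · rintro rfl
    have h1 : φ ((e.symm (φ t₀ y)).2 : ℝ) (B.ι (e.symm (φ t₀ y)).1) = φ t₀ y := by
      rw [← heq, e.right_inv hy2]
    refine ⟨_, hVA (e.symm (φ t₀ y)).1.2, ?_⟩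
    simp only [α]
    generalize e.symm (φ t₀ y) = v at h1
    rw [sub_eq_neg_add, φ.map_add, ← h1, ← φ.map_add, neg_add_cancel, φ.map_zero_apply]

/-- A point near `γ`, off `γ`, such that the orbits of the nearby points meet the section only in its
inner half and at least once in every interval of length `T`, on the time window
`[-(2T + 2), 2T + 2]`. -/
def IsRegular (T : ℝ) (x : M) : Prop :=
  x ∉ γ ∧ ∀ᶠ y in 𝓝 x, ∀ t ∈ Icc (-(2 * T + 2)) (2 * T + 2),
    (∀ p ∈ halfOpenAnnulus, B.ι p = φ t y → p.1 < 1 / 2) ∧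
    (y ∉ γ → ∃ s ∈ Icc 0 T, φ s (φ t y) ∈ B.interior)

variable {B}

theorem exists_isRegular (hγ : IsPeriodicOrbit φ γ) (B : LocalBirkhoffSection φ γ) :
    ∃ T > 0, ∀ᶠ x in 𝓝ˢ γ, x ∉ γ → B.IsRegular T x := by
  obtain ⟨T, hT, hhit⟩ := B.exists_hit hγ
  refine ⟨T, hT, ?_⟩
  have h1 := φ.eventually_nhdsSet_forall (fun x hx t => hγ.flow_mem hx t)
    ((B.collar (1 / 2) (by norm_num)).and hhit) (2 * T + 2)
  obtain ⟨O, hO, hγO, h⟩ := eventually_nhdsSet_iff_exists.1 h1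
  filter_upwards [hO.mem_nhdsSet.2 hγO] with x hx hxγ
  refine ⟨hxγ, ?_⟩
  filter_upwards [hO.mem_nhds hx] with y hy t ht
  have := h y hy t ht
  exact ⟨this.1, fun hyγ => this.2 fun h => hyγ (hγ.flow_mem_iff.1 h)⟩

/-- The absence of an intersection persists: the inner half of the section is compact, up to the
periodic orbit. -/
theorem IsRegular.eventually_notMem [T2Space M] (hγ : IsPeriodicOrbit φ γ) {T : ℝ} {x : M}
    (hx : B.IsRegular T x) {s : ℝ} (hs : |s| < 2 * T + 2) (h : φ s x ∉ B.interior) :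
    ∀ᶠ q : M × ℝ in 𝓝 (x, s), φ q.2 q.1 ∉ B.interior := by
  set C : Set M := B.ι '' (Icc 0 (1 / 2) ×ˢ univ) with hC
  have hCc : IsClosed C := ((isCompact_Icc.prod isCompact_univ).image_of_continuousOn
    (B.continuousOn_ι.mono fun p hp => ⟨hp.1.1, by linarith [hp.1.2]⟩)).isClosed
  have hxC : φ s x ∉ C := by
    rintro ⟨p, hp, hpx⟩
    have hph : p ∈ halfOpenAnnulus := ⟨hp.1.1, by linarith [hp.1.2]⟩
    refine h ⟨p, ⟨lt_of_le_of_ne hp.1.1 fun h0 => hx.1 ?_, hph.2⟩, hpx⟩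
    have := (B.ι_mem_iff hph).2 h0.symm
    rwa [hpx, hγ.flow_mem_iff] at this
  have h1 : ∀ᶠ q : M × ℝ in 𝓝 (x, s), φ q.2 q.1 ∉ C :=
    (φ.continuous continuous_snd continuous_fst).continuousAt.eventually
      (hCc.isOpen_compl.mem_nhds (show φ s x ∈ Cᶜ from hxC))
  have h2 : ∀ᶠ q : M × ℝ in 𝓝 (x, s), ∀ t ∈ Icc (-(2 * T + 2)) (2 * T + 2),
      (∀ p ∈ halfOpenAnnulus, B.ι p = φ t q.1 → p.1 < 1 / 2) :=
    (continuous_fst.tendsto (x, s)).eventually (hx.2.mono fun y hy t ht => (hy t ht).1)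
  have h3 : ∀ᶠ q : M × ℝ in 𝓝 (x, s), q.2 ∈ Ioo (-(2 * T + 2)) (2 * T + 2) :=
    (continuous_snd.tendsto (x, s)).eventually (isOpen_Ioo.mem_nhds (abs_lt.1 hs))
  filter_upwards [h1, h2, h3] with q hq1 hq2 hq3
  rintro ⟨p, hp, hpq⟩
  exact hq1 ⟨p, ⟨⟨hp.1.le, (hq2 _ (Ioo_subset_Icc_self hq3) p ⟨hp.1.le, hp.2⟩ hpq).le⟩,
    mem_univ _⟩, hpq⟩

/-- In a closed set of times that meets every interval of length `T`, there is a first positive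
time, if `0` is not an accumulation point. -/
theorem exists_first_pos {A : Set ℝ} {T : ℝ} (hA : ∀ t, |t| < 2 * T + 2 → t ∉ A → ∀ᶠ s in 𝓝 t, s ∉ A)
    (h0 : ∀ᶠ s in 𝓝[≠] (0 : ℝ), s ∉ A) (hT : 0 < T)
    (hhit : ∀ u ∈ Icc 0 (1 : ℝ), ∃ t ∈ Icc u (u + T), t ∈ A) :
    ∃ b ∈ A, 0 < b ∧ b ≤ T + 1 ∧ ∀ t, 0 < t → t < b → t ∉ A := by
  obtain ⟨ε, hε, hε0⟩ : ∃ ε > 0, ∀ t, 0 < t → t < ε → t ∉ A := by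
    rw [eventually_nhdsWithin_iff, Metric.eventually_nhds_iff] at h0
    obtain ⟨ε, hε, h⟩ := h0
    exact ⟨ε, hε, fun t ht htε => h (by rwa [Real.dist_eq, sub_zero, abs_of_pos ht]) ht.ne'⟩
  set u := min (ε / 2) 1 with hu
  have hu0 : 0 < u := by positivity
  have hu1 : u ≤ 1 := min_le_right _ _
  have hue : u ≤ ε / 2 := min_le_left _ _
  have hcl : IsClosed (Icc u (u + T) ∩ A) := by
    rw [← isOpen_compl_iff, isOpen_iff_mem_nhds]
    intro t ht
    by_cases htI : t ∈ Icc u (u + T)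
    · have htA : t ∉ A := fun h => ht ⟨htI, h⟩
      have := hA t (by rw [abs_of_nonneg (hu0.le.trans htI.1)]; linarith [htI.2]) htA
      filter_upwards [this] with s hs h using hs h.2
    · filter_upwards [isClosed_Icc.isOpen_compl.mem_nhds htI] with s hs h using hs h.1
  obtain ⟨t, ht, htA⟩ := hhit u ⟨hu0.le, hu1⟩
  obtain ⟨b, ⟨hb, hbA⟩, hmin⟩ := (isCompact_Icc.of_isClosed_subset hcl
    inter_subset_left).exists_isLeast ⟨t, ht, htA⟩
  refine ⟨b, hbA, hu0.trans_le hb.1, by linarith [hb.2], fun t ht0 htb htA => ?_⟩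
  by_cases htu : t < ε
  · exact hε0 t ht0 htu htA
  · have := hmin ⟨⟨by linarith, by linarith [hb.2]⟩, htA⟩
    linarith

theorem IsRegular.eventually_notMem_zero [T2Space M] (hγ : IsPeriodicOrbit φ γ) {T : ℝ} (hT : 0 < T)
    {x : M} (hx : B.IsRegular T x) : ∀ᶠ s in 𝓝[≠] (0 : ℝ), φ s x ∉ B.interior := by
  by_cases h0 : φ 0 x ∈ B.interior
  · obtain ⟨α, -, hα, ε, hε, hev⟩ := B.exists_isHitTime h0
    have := hev.self_of_nhds
    rw [hα] at this
    rw [eventually_nhdsWithin_iff]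
    filter_upwards [Metric.ball_mem_nhds (0 : ℝ) hε] with s hs hs0 hsB
    exact hs0 ((this s (by simpa [Real.dist_eq] using hs)).1 hsB)
  · have h1 := hx.eventually_notMem hγ (s := 0) (by simp; positivity) h0
    exact ((continuous_const.prodMk continuous_id).tendsto' (0 : ℝ) (x, 0) rfl).eventually h1
      |>.filter_mono nhdsWithin_le_nhds

theorem IsRegular.exists_next [T2Space M] (hγ : IsPeriodicOrbit φ γ) {T : ℝ} (hT : 0 < T)
    {x : M} (hx : B.IsRegular T x) : ∃ b, φ b x ∈ B.interior ∧ 0 < b ∧ b ≤ T + 1 ∧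
      ∀ t, 0 < t → t < b → φ t x ∉ B.interior := by
  refine exists_first_pos (A := {t | φ t x ∈ B.interior}) (fun t ht htA => ?_)
    (hx.eventually_notMem_zero hγ hT) hT fun u hu => ?_
  · exact ((continuous_const.prodMk continuous_id).tendsto' t (x, t) rfl).eventually
      (hx.eventually_notMem hγ ht htA)
  · obtain ⟨s, hs, hsx⟩ := (hx.2.self_of_nhds u ⟨by linarith [hu.1], by linarith [hu.2]⟩).2 hx.1
    rw [← φ.map_add] at hsx
    exact ⟨s + u, ⟨by linarith [hs.1], by linarith [hs.2]⟩, hsx⟩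

theorem IsRegular.exists_prev [T2Space M] (hγ : IsPeriodicOrbit φ γ) {T : ℝ} (hT : 0 < T)
    {x : M} (hx : B.IsRegular T x) : ∃ a, φ a x ∈ B.interior ∧ a < 0 ∧ -(T + 1) ≤ a ∧
      ∀ t, a < t → t < 0 → φ t x ∉ B.interior := by
  obtain ⟨b, hb, hb0, hbT, hmin⟩ := exists_first_pos (A := {t | φ (-t) x ∈ B.interior}) (T := T)
    (fun t ht htA => ((continuous_const.prodMk continuous_neg).tendsto' t (x, -t) rfl).eventually
      (hx.eventually_notMem hγ (by rwa [abs_neg]) htA))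
    (by
      have h1 := hx.eventually_notMem_zero hγ hT
      rw [eventually_nhdsWithin_iff] at h1 ⊢
      have h2 := (continuous_neg.tendsto' (0 : ℝ) 0 neg_zero).eventually h1
      filter_upwards [h2] with s hs hs0 using hs (neg_ne_zero.2 hs0)) hT fun u hu => by
      obtain ⟨s, hs, hsx⟩ := (hx.2.self_of_nhds (-(u + T))
        ⟨by linarith [hu.1, hu.2], by linarith [hu.1]⟩).2 hx.1
      rw [← φ.map_add] at hsx
      exact ⟨u + T - s, ⟨by linarith [hs.2], by linarith [hs.1]⟩, by
        simpa only [mem_ofPred_eq, neg_sub, sub_eq_add_neg, neg_add, neg_neg, add_comm, add_left_comm]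
          using hsx⟩
  exact ⟨-b, hb, by linarith, by linarith, fun t ht ht0 => by
    simpa using hmin (-t) (by linarith) (by linarith)⟩

variable (B)

/-- The times `a ≤ 0 ≤ b` are consecutive times at which the orbit of `x` meets the section. -/
def IsGap (x : M) (a b : ℝ) : Prop :=
  a ≤ 0 ∧ 0 ≤ b ∧ a < b ∧ φ a x ∈ B.interior ∧ φ b x ∈ B.interior ∧
    ∀ t, a < t → t < b → φ t x ∉ B.interior

open Classical in
/-- The position, modulo `1`, of a point on its orbit between two consecutive intersections with the
section. -/
def phase (x : M) : UnitAddCircle :=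
  if h : ∃ q : ℝ × ℝ, B.IsGap x q.1 q.2 then
    ((-h.choose.1 / (h.choose.2 - h.choose.1) : ℝ) : UnitAddCircle) else 0

variable {B}

theorem IsGap.phase_eq {x : M} {a b : ℝ} (h : B.IsGap x a b) :
    B.phase x = ((-a / (b - a) : ℝ) : UnitAddCircle) := by
  have hex : ∃ q : ℝ × ℝ, B.IsGap x q.1 q.2 := ⟨(a, b), h⟩
  rw [phase, dif_pos hex]
  set a' := hex.choose.1
  set b' := hex.choose.2
  have h' : B.IsGap x a' b' := hex.choose_spec
  clear_value a' b'
  have hzero : ∀ a b : ℝ, B.IsGap x a b → φ 0 x ∈ B.interior →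
      ((-a / (b - a) : ℝ) : UnitAddCircle) = 0 := by
    rintro a b ⟨ha, hb, hab, -, -, hn⟩ h0
    rcases ha.eq_or_lt with rfl | ha'
    · simp
    rcases hb.eq_or_lt with rfl | hb'
    · have : -a / (0 - a) = (1 : ℝ) := by rw [zero_sub]; exact div_self (by linarith)
      rw [this]
      exact AddCircle.coe_period 1
    · exact (hn 0 ha' hb' h0).elim
  by_cases h0 : φ 0 x ∈ B.interior
  · rw [hzero _ _ h h0, hzero _ _ h' h0]
  · obtain ⟨ha, hb, hab, hxa, hxb, hn⟩ := h
    obtain ⟨ha', hb', hab', hxa', hxb', hn'⟩ := h'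
    have hlt : ∀ {s : ℝ}, φ s x ∈ B.interior → s ≠ 0 := by rintro s hs rfl; exact h0 hs
    have h1 := lt_of_le_of_ne ha (hlt hxa)
    have h2 := lt_of_le_of_ne hb (hlt hxb).symm
    have h3 := lt_of_le_of_ne ha' (hlt hxa')
    have h4 := lt_of_le_of_ne hb' (hlt hxb').symm
    have haa : a = a' := by
      rcases lt_trichotomy a a' with h | h | h
      · exact (hn a' h (by linarith) hxa').elim
      · exact h
      · exact (hn' a h (by linarith) hxa).elim
    have hbb : b = b' := by
      rcases lt_trichotomy b b' with h | h | h
      · exact (hn' b (by linarith) h hxb).elim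
      · exact h
      · exact (hn b' (by linarith) h hxb').elim
    rw [haa, hbb]

theorem phase_eq_zero {x : M} (hx : x ∈ B.interior) : B.phase x = 0 := by
  by_cases hex : ∃ q : ℝ × ℝ, B.IsGap x q.1 q.2
  · obtain ⟨⟨a, b⟩, h⟩ := hex
    rw [h.phase_eq]
    obtain ⟨ha, hb, hab, -, -, hn⟩ := h
    rcases ha.eq_or_lt with h0 | ha'
    · simp only at h0
      simp [h0]
    rcases hb.eq_or_lt with h0 | hb'
    · simp only at h0 ha' ⊢
      rw [← h0, zero_sub, div_self (by linarith)]
      exact AddCircle.coe_period 1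
    · exact (hn 0 ha' hb' (by simpa using hx)).elim
  · rw [phase, dif_neg hex]

theorem IsGap.flow {x : M} {a b s : ℝ} (h : B.IsGap x a b) (hs : s ∈ Icc a b) :
    B.IsGap (φ s x) (a - s) (b - s) := by
  obtain ⟨-, -, hab, hxa, hxb, hn⟩ := h
  refine ⟨by linarith [hs.1], by linarith [hs.2], by linarith, ?_, ?_, fun t h1 h2 => ?_⟩
  · rwa [← φ.map_add, sub_add_cancel]
  · rwa [← φ.map_add, sub_add_cancel]
  · rw [← φ.map_add]
    exact hn _ (by linarith) (by linarith)

theorem IsRegular.exists_isGap [T2Space M] (hγ : IsPeriodicOrbit φ γ) {T : ℝ} (hT : 0 < T)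
    {x : M} (hx : B.IsRegular T x) : ∃ a b, B.IsGap x a b ∧ 0 < b := by
  obtain ⟨b, hb, hb0, -, hbn⟩ := hx.exists_next hγ hT
  obtain ⟨a, ha, ha0, -, han⟩ := hx.exists_prev hγ hT
  by_cases h0 : φ 0 x ∈ B.interior
  · exact ⟨0, b, ⟨le_rfl, hb0.le, hb0, h0, hb, fun t h1 h2 => hbn t h1 h2⟩, hb0⟩
  · refine ⟨a, b, ⟨ha0.le, hb0.le, by linarith, ha, hb, fun t h1 h2 => ?_⟩, hb0⟩
    rcases lt_trichotomy t 0 with h | rfl | h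
    · exact han t h1 h
    · exact h0
    · exact hbn t h h2

/-- Consecutive intersection times depend continuously on the point. -/
theorem IsRegular.eventually_gap [T2Space M] (hγ : IsPeriodicOrbit φ γ) {T : ℝ}
    {x : M} (hx : B.IsRegular T x) {a b : ℝ} {α β : M → ℝ} (hα : B.IsHitTime x a α)
    (hβ : B.IsHitTime x b β) (hab : a < b) (ha : -(2 * T + 2) < a) (hb : b < 2 * T + 2)
    (hn : ∀ t, a < t → t < b → φ t x ∉ B.interior) :
    ∀ᶠ y in 𝓝 x, α y < β y ∧ φ (α y) y ∈ B.interior ∧ φ (β y) y ∈ B.interior ∧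
      ∀ t, α y < t → t < β y → φ t y ∉ B.interior := by
  obtain ⟨hαc, hαx, ε, hε, hαε⟩ := hα
  obtain ⟨hβc, hβx, ε', hε', hβε⟩ := hβ
  have h1 : ∀ᶠ y in 𝓝 x, ∀ t ∈ Icc (a + ε / 2) (b - ε' / 2), φ t y ∉ B.interior := by
    refine isCompact_Icc.eventually_forall_of_forall_eventually fun t ht => ?_
    refine hx.eventually_notMem hγ (abs_lt.2 ⟨by linarith [ht.1], by linarith [ht.2]⟩) ?_
    exact hn t (by linarith [ht.1]) (by linarith [ht.2])
  have h2 : ∀ᶠ y in 𝓝 x, |α y - a| < ε := by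
    have := hαc.eventually (Metric.ball_mem_nhds _ hε)
    simpa only [Metric.mem_ball, Real.dist_eq, hαx] using this
  have h3 : ∀ᶠ y in 𝓝 x, |β y - b| < ε' := by
    have := hβc.eventually (Metric.ball_mem_nhds _ hε')
    simpa only [Metric.mem_ball, Real.dist_eq, hβx] using this
  have h4 : ∀ᶠ y in 𝓝 x, α y < β y := hαc.eventually_lt hβc (by rwa [hαx, hβx])
  filter_upwards [h1, h2, h3, h4, hαε, hβε] with y hy1 hy2 hy3 hy4 hy5 hy6
  refine ⟨hy4, (hy5 _ hy2).2 rfl, (hy6 _ hy3).2 rfl, fun t ht1 ht2 htB => ?_⟩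
  rw [abs_lt] at hy2 hy3
  rcases lt_or_ge t (a + ε / 2) with h | h
  · have := (hy5 t (abs_lt.2 ⟨by linarith, by linarith⟩)).1 htB
    linarith
  rcases lt_or_ge (b - ε' / 2) t with h' | h'
  · have := (hy6 t (abs_lt.2 ⟨by linarith, by linarith⟩)).1 htB
    linarith
  · exact hy1 t ⟨h, h'⟩ htB

/-- The phase is continuous, including at the section, where it jumps from `1` to `0`. -/
theorem IsRegular.continuousAt_phase [T2Space M] (hγ : IsPeriodicOrbit φ γ) {T : ℝ} (hT : 0 < T)
    {x : M} (hx : B.IsRegular T x) : ContinuousAt B.phase x := by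
  obtain ⟨b, hb, hb0, hbT, hbn⟩ := hx.exists_next hγ hT
  obtain ⟨a, ha, ha0, haT, han⟩ := hx.exists_prev hγ hT
  obtain ⟨α, hα⟩ := B.exists_isHitTime ha
  obtain ⟨β, hβ⟩ := B.exists_isHitTime hb
  have hcoe : Continuous ((↑) : ℝ → UnitAddCircle) := AddCircle.continuous_mk' 1
  have hαneg : ∀ᶠ y in 𝓝 x, α y < 0 := hα.1.eventually_lt continuousAt_const (by rwa [hα.2.1])
  have hβpos : ∀ᶠ y in 𝓝 x, 0 < β y := continuousAt_const.eventually_lt hβ.1 (by rwa [hβ.2.1])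
  by_cases h0 : φ 0 x ∈ B.interior
  · obtain ⟨ζ, hζ⟩ := B.exists_isHitTime h0
    have h1 := hx.eventually_gap hγ hα hζ ha0 (by linarith) (by linarith) han
    have h2 := hx.eventually_gap hγ hζ hβ hb0 (by linarith) (by linarith) hbn
    classical
    have hlim : Tendsto (fun y => if ζ y ≤ 0 then -ζ y / (β y - ζ y) else -ζ y / (ζ y - α y))
        (𝓝 x) (𝓝 0) := by
      have e1 : ContinuousAt (fun y => -ζ y / (β y - ζ y)) x :=
        hζ.1.neg.div (hβ.1.sub hζ.1) (by rw [hβ.2.1, hζ.2.1]; linarith)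
      have e2 : ContinuousAt (fun y => -ζ y / (ζ y - α y)) x :=
        hζ.1.neg.div (hζ.1.sub hα.1) (by rw [hα.2.1, hζ.2.1]; linarith)
      refine Tendsto.if' ?_ ?_
      · simpa [ContinuousAt, hζ.2.1] using e1
      · simpa [ContinuousAt, hζ.2.1] using e2
    have hx0 : B.phase x = ((0 : ℝ) : UnitAddCircle) := phase_eq_zero (by simpa using h0)
    rw [ContinuousAt, hx0]
    refine (hcoe.continuousAt.tendsto.comp hlim).congr' ?_
    filter_upwards [h1, h2, hαneg, hβpos] with y hy1 hy2 hy3 hy4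
    simp only [Function.comp_apply]
    split_ifs with hle
    · exact (IsGap.phase_eq ⟨hle, hy4.le, hy2⟩).symm
    · have hgap : B.IsGap y (α y) (ζ y) := ⟨hy3.le, (not_le.1 hle).le, hy1⟩
      rw [hgap.phase_eq, circle_coe_eq_iff]
      refine ⟨-1, ?_⟩
      have : ζ y - α y ≠ 0 := by linarith [hy1.1]
      push_cast
      field_simp
      ring
  · have hn : ∀ t, a < t → t < b → φ t x ∉ B.interior := fun t h1 h2 => by
      rcases lt_trichotomy t 0 with h | rfl | h
      · exact han t h1 h
      · exact h0
      · exact hbn t h h2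
    have h1 := hx.eventually_gap hγ hα hβ (by linarith) (by linarith) (by linarith) hn
    have e1 : ContinuousAt (fun y => ((-α y / (β y - α y) : ℝ) : UnitAddCircle)) x :=
      hcoe.continuousAt.comp (hα.1.neg.div (hβ.1.sub hα.1)
        (by rw [hα.2.1, hβ.2.1]; linarith))
    refine e1.congr ?_
    filter_upwards [h1, hαneg, hβpos] with y hy1 hy2 hy3
    exact (IsGap.phase_eq ⟨hy2.le, hy3.le, hy1⟩).symm

end LocalBirkhoffSection

/-! ### The linking number does not vanish -/

/-- A continuous function that increases immediately to the right of every point is increasing. -/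
theorem lt_of_eventually_gt_right {f : ℝ → ℝ} {a b : ℝ} (hab : a < b)
    (hf : ContinuousOn f (Icc a b)) (h : ∀ x ∈ Ico a b, ∀ᶠ y in 𝓝[>] x, f x < f y) :
    f a < f b := by
  have key : ∀ c ∈ Ico a b, f c ≤ f b := fun c hc => by
    have hsub : Icc c b ⊆ Icc a b := Icc_subset_Icc_left hc.1
    have hcl : IsClosed ({x | f c ≤ f x} ∩ Icc c b) := by
      rw [inter_comm]
      exact (hf.mono hsub).preimage_isClosed_of_isClosed isClosed_Icc isClosed_Ici
    refine hcl.Icc_subset_of_forall_mem_nhdsWithin (show f c ≤ f c from le_rfl) (fun x hx => ?_)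
      ⟨hc.2.le, le_rfl⟩
    exact (h x ⟨hc.1.trans hx.2.1, hx.2.2⟩).mono fun y hy => hx.1.trans hy.le
  obtain ⟨x, hx, hxab⟩ := ((h a ⟨le_rfl, hab⟩).and (Ioo_mem_nhdsGT hab)).exists
  exact hx.trans_le (key x ⟨hxab.1.le, hxab.2⟩)

namespace StripLift

variable {M : Type*} [TopologicalSpace M] {φ : Flow ℝ M} {γ : Set M}
  {c : SaddleChart φ γ} {B : LocalBirkhoffSection φ γ} {n m : ℤ}

/-- The linking number does not vanish. Otherwise, the lift of the section to the universal cover is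
invariant under a translation along the longitude, hence some orbit of the stable manifold meets it
twice; but the phase, which is constant on the section, has a lift to the universal cover, and it
increases along the orbits. -/
theorem link_ne_zero [T2Space M] (S : StripLift c B n m) (hγ : IsPeriodicOrbit φ γ)
    (hB : B.IsTame c) : n ≠ 0 := by
  rintro rfl
  obtain ⟨T, hT, hreg⟩ := B.exists_isRegular hγ
  obtain ⟨δ, hδ, hδq⟩ := c.eventually_nhdsSet_iff.1 hreg
  set r := Real.log δ with hr
  have htube : ∀ x ∈ logTube r, ‖(logCover x).1‖ < δ := fun x hx => by
    rw [← Real.exp_log hδ]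
    exact (logCover_mem.2 hx).2
  have htar : ∀ x ∈ logTube r, logCover x ∈ c.chart.target := fun x hx => (hδq _ (htube x hx)).1
  have hoff : ∀ x ∈ logTube r, c.chart.symm (logCover x) ∉ γ := fun x hx => by
    rw [c.symm_mem_iff (htar x hx)]
    exact Complex.exp_ne_zero _
  have hregx : ∀ x ∈ logTube r, B.IsRegular T (c.chart.symm (logCover x)) := fun x hx =>
    (hδq _ (htube x hx)).2 (hoff x hx)
  -- a lift of the phase
  obtain ⟨K, hK, hKl⟩ := exists_circle_lift (convex_logTube r)
    (f := fun x => B.phase (c.chart.symm (logCover x))) fun x hx => by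
      refine ContinuousAt.continuousWithinAt ?_
      exact ContinuousAt.comp (f := fun x => c.chart.symm (logCover x))
        ((hregx x hx).continuousAt_phase hγ hT)
        (ContinuousAt.comp (c.chart.continuousAt_symm (htar x hx))
          continuous_logCover.continuousAt)
  have hK0 : ∀ x ∈ logTube r, c.chart.symm (logCover x) ∈ B.interior → ∃ k : ℤ, K x = k := by
    intro x hx hxB
    have h1 := (hKl x hx).trans (LocalBirkhoffSection.phase_eq_zero hxB)
    rw [← AddCircle.coe_zero, circle_coe_eq_iff] at h1
    simpa using h1
  -- it is invariant under the translation by `m` along the longitude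
  have hinv : ∀ x ∈ logTube r, K (deck 0 m x) = K x := by
    obtain ⟨k, hk⟩ := (convex_logTube r).isPreconnected.exists_int_of_circle_lifts
      (f := fun x => K (deck 0 m x)) (g := K)
      (hK.comp (continuous_deck _ _).continuousOn fun x hx => deck_mem.2 hx) hK fun x hx => by
        rw [hKl _ (deck_mem.2 hx), hKl x hx, logCover_deck]
    obtain ⟨ρ, hρ, hρ1, hcol⟩ := B.exists_collar_subset (c.eventually_norm_lt hδ)
    have hmem : ∀ x ∈ openStrip (min ρ S.r₀), S.toFun x ∈ logTube r := fun x hx => by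
      have h1 := (hcol (x.1, ((S.sign * x.2 : ℝ) : UnitAddCircle)) hx.1.1.le
        (hx.1.2.trans_le (min_le_left _ _))).2
      rw [← S.lifts x (openStrip_mono (min_le_right _ _) hx)] at h1
      rw [← logCover_mem]
      exact ⟨Complex.exp_ne_zero _, by rwa [hr, Real.exp_log hδ]⟩
    have hx₀ : ∀ s : ℝ, (min ρ S.r₀ / 2, s) ∈ openStrip (min ρ S.r₀) := fun s =>
      ⟨⟨half_pos (lt_min hρ S.pos), half_lt_self (lt_min hρ S.pos)⟩, mem_univ _⟩
    have h1 := (convex_openStrip (min ρ S.r₀)).isPreconnected.eq_of_int_valued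
      (f := fun x => K (S.toFun x))
      (hK.comp (S.cont.mono (openStrip_mono (min_le_right _ _))) hmem) (fun x hx => by
        have hx' := openStrip_mono (min_le_right _ _) hx
        refine hK0 _ (hmem x hx) ?_
        rw [← S.chart_point hx', c.chart.left_inv (S.point_mem_source hx')]
        exact S.point_mem_interior hx') (hx₀ (0 + 1)) (hx₀ 0)
    have h2 := S.equivariant _ (openStrip_mono (min_le_right _ _) (hx₀ 0))
    simp only at h1 h2
    rw [h2, hk _ (hmem _ (hx₀ 0))] at h1
    intro x hx
    rw [hk x hx]
    linarith
  have hinv' : ∀ (l : ℕ), ∀ x ∈ logTube r, K (deck 0 (m * l) x) = K x ∧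
      K (deck 0 (-(m * l)) x) = K x := by
    intro l
    induction l with
    | zero => intro x _; simp [deck_zero]
    | succ l ih =>
      intro x hx
      constructor
      · have h1 := hinv (deck 0 (m * l) x) (deck_mem.2 hx)
        rw [deck_deck, (ih x hx).1] at h1
        rw [← h1]
        congr 2; push_cast; ring
      · rw [← (ih x hx).2, ← hinv (deck 0 (-(m * (l + 1 : ℕ))) x) (deck_mem.2 hx), deck_deck]
        congr 2; push_cast; ring
  -- the path of the section in the stable manifold
  obtain ⟨P, hPc, hPim, ⟨A, hA⟩, hlim, hPB⟩ := LocalBirkhoffSection.exists_stable_path hγ hB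
  obtain ⟨t₁, ht₁, hPr⟩ : ∃ t₁ ∈ Ioc (0 : ℝ) 1, ∀ t ∈ Ioc 0 t₁, P t ∈ logTube r := by
    obtain ⟨u, hu, hsub⟩ := mem_nhdsGT_iff_exists_Ioo_subset.1 (hlim.eventually_lt_atBot r)
    have hu0 : (0 : ℝ) < u := hu
    refine ⟨min (u / 2) 1, ⟨by positivity, min_le_right _ _⟩, fun t ht => ?_⟩
    exact hsub ⟨ht.1, by linarith [ht.2, min_le_left (u / 2) 1]⟩
  have hsub : Ioc 0 t₁ ⊆ Ioc (0 : ℝ) 1 := Ioc_subset_Ioc_right ht₁.2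
  have hKP : ∀ t ∈ Ioc 0 t₁, K (P t) = K (P t₁) := fun t ht =>
    isPreconnected_Ioc.eq_of_int_valued (f := fun t => K (P t))
      (hK.comp (hPc.mono hsub) hPr) (fun t ht => by
        obtain ⟨x, hxs, hxB, hxP⟩ := hPB t (hsub ht)
        refine hK0 _ (hPr t ht) ?_
        rwa [← hxP, c.chart.left_inv hxs]) ht ⟨ht₁.1, le_rfl⟩
  have ha := c.a_neg
  -- a translate of the path that is met by the orbit of its end point
  obtain ⟨N, hN, hN'⟩ : ∃ N : ℤ, (∀ x ∈ logTube r, K (deck 0 N x) = K x) ∧ 2 * A < N := by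
    have hm : (1 : ℝ) ≤ |(m : ℝ)| := by
      rw [← Int.cast_abs]
      exact_mod_cast Int.one_le_abs S.mult_ne_zero
    obtain ⟨l, hl⟩ := exists_nat_gt (2 * A)
    have h1 : (l : ℝ) ≤ |(m : ℝ)| * l := le_mul_of_one_le_left (Nat.cast_nonneg _) hm
    rcases abs_choice (m : ℝ) with h | h
    · refine ⟨m * l, fun x hx => (hinv' l x hx).1, ?_⟩
      rw [h] at h1
      push_cast
      linarith
    · refine ⟨-(m * l), fun x hx => (hinv' l x hx).2, ?_⟩
      rw [h] at h1
      push_cast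
      linarith
  obtain ⟨t₂, ht₂, σ₁, hσ₁0, hXend⟩ := exists_translate_on_orbit ht₁.1 (hPc.mono hsub)
    (fun t ht => hPim t (hsub ht)) (fun t ht => hA t (hsub ht)) hlim ha hN'
  set X : ℝ → ℂ × ℝ := fun σ => ((P t₁).1 + (c.a * σ : ℝ), (P t₁).2 + σ) with hX
  have hX0 : X 0 = P t₁ := by simp [X]
  have hXr : ∀ σ ∈ Icc 0 σ₁, X σ ∈ logTube r := fun σ hσ => by
    have h1 : (P t₁).1.re < r := hPr t₁ ⟨ht₁.1, le_rfl⟩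
    have h2 := mul_nonpos_of_nonpos_of_nonneg ha.le hσ.1
    simp only [X, logTube, mem_ofPred_eq, Complex.add_re, Complex.ofReal_re]
    linarith
  have hXc : Continuous X := by simp only [X]; fun_prop
  have hXflow : ∀ σ, logCover (X σ) = c.model σ (logCover (P t₁)) := fun σ => by
    have him := hPim t₁ ht₁
    refine Prod.ext (Complex.ext ?_ ?_) ?_
    · simp only [X, logCover, SaddleChart.model, saddleFlow_re, Complex.exp_re, Complex.add_re,
        Complex.add_im, Complex.ofReal_re, Complex.ofReal_im, add_zero, Real.exp_add]
      ring
    · simp [X, logCover, SaddleChart.model, saddleFlow_im, Complex.exp_im, him]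
    · simp [X, logCover, SaddleChart.model, saddleFlow_snd]
  obtain ⟨ς, hς0, hςc, hςm, hς⟩ := c.orbital.symm.carriesOrbits (logCover (P t₁)) σ₁ hσ₁0.le
    fun σ hσ => by
      have := htar _ (hXr σ hσ)
      rw [hXflow] at this
      exact this
  -- the lift of the phase increases along the orbit, but it is constant on the path and its translates
  have hlt : K (X 0) < K (X σ₁) := by
    refine lt_of_eventually_gt_right (f := fun σ => K (X σ)) hσ₁0
      (hK.comp hXc.continuousOn hXr) fun σ hσ => ?_
    have hσI : σ ∈ Icc 0 σ₁ := Ico_subset_Icc_self hσ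
    set x := c.chart.symm (logCover (P t₁)) with hx
    have hxσ : ∀ s ∈ Icc 0 σ₁, c.chart.symm (logCover (X s)) = φ (ς s) x := fun s hs => by
      rw [hXflow]
      exact hς s hs
    obtain ⟨a, b, hgap, hb⟩ := (hregx _ (hXr σ hσI)).exists_isGap hγ hT
    rw [hxσ σ hσI] at hgap
    -- the points of the orbit just after this one lie in the same gap
    obtain ⟨u, hu, huσ, hub⟩ : ∃ u, σ < u ∧ u ≤ σ₁ ∧ ∀ s ∈ Icc σ u, ς s - ς σ ∈ Icc 0 b := by
      have h1 : ∀ᶠ s in 𝓝[Icc 0 σ₁] σ, ς s < ς σ + b :=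
        (hςc σ hσI).eventually_lt continuousWithinAt_const (by linarith)
      have h2 : ∀ᶠ s in 𝓝[≥] σ, ς s < ς σ + b := by
        rw [← nhdsWithin_Icc_eq_nhdsGE hσ.2]
        exact h1.filter_mono (nhdsWithin_mono _ (Icc_subset_Icc_left hσ.1))
      obtain ⟨u, hu, hsubu⟩ := mem_nhdsGE_iff_exists_Icc_subset.1 h2
      have hu' : σ < u := hu
      refine ⟨min u σ₁, lt_min hu' hσ.2, min_le_right _ _, fun s hs => ⟨?_, ?_⟩⟩
      · have := hςm.monotoneOn hσI ⟨hσ.1.trans hs.1, hs.2.trans (min_le_right _ _)⟩ hs.1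
        linarith
      · have : ς s < ς σ + b := hsubu ⟨hs.1, hs.2.trans (min_le_left _ _)⟩
        linarith
    have hsubI : Icc σ u ⊆ Icc 0 σ₁ := Icc_subset_Icc hσ.1 huσ
    have hab := hgap.2.2.1
    obtain ⟨k, hk⟩ := isPreconnected_Icc.exists_int_of_circle_lifts (f := fun s => K (X s))
      (g := fun s => (ς s - ς σ - a) / (b - a))
      (hK.comp hXc.continuousOn fun s hs => hXr s (hsubI hs))
      ((((hςc.mono hsubI).sub continuousOn_const).sub continuousOn_const).div_const _)
      fun s (hs : s ∈ Icc σ u) => by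
        have h1 := hgap.flow (s := ς s - ς σ)
          ⟨hgap.1.trans (hub s hs).1, (hub s hs).2⟩
        rw [← φ.map_add, sub_add_cancel, ← hxσ s (hsubI hs)] at h1
        rw [hKl _ (hXr s (hsubI hs)), h1.phase_eq]
        congr 1
        rw [neg_sub, sub_sub_sub_cancel_right]
    filter_upwards [Ioc_mem_nhdsGT hu] with s hs
    have h1 : K (X σ) = (ς σ - ς σ - a) / (b - a) + k := hk σ ⟨le_rfl, hu.le⟩
    have h2 : K (X s) = (ς s - ς σ - a) / (b - a) + k := hk s (Ioc_subset_Icc_self hs)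
    have h3 := hςm hσI (hsubI (Ioc_subset_Icc_self hs)) hs.1
    have h4 : (ς σ - ς σ - a) / (b - a) < (ς s - ς σ - a) / (b - a) :=
      div_lt_div_of_pos_right (by linarith) (by linarith)
    linarith
  rw [hX0, show X σ₁ = _ from hXend, hN _ (hPr t₂ ht₂), hKP t₂ ht₂] at hlt
  exact lt_irrefl _ hlt

end StripLift

/-! ### Orbital equivalences that exchange two sections -/

section SectionEquiv

variable {M₁ M₂ : Type*} [TopologicalSpace M₁] [TopologicalSpace M₂]
  {φ₁ : Flow ℝ M₁} {φ₂ : Flow ℝ M₂} {γ₁ : Set M₁} {γ₂ : Set M₂}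

/-- The homeomorphism `H`, between punctured neighbourhoods of two periodic orbits, is an orbital
equivalence that exchanges the germs of two Birkhoff sections. -/
structure IsSectionEquiv (B₁ : LocalBirkhoffSection φ₁ γ₁) (B₂ : LocalBirkhoffSection φ₂ γ₂)
    (H : OpenPartialHomeomorph M₁ M₂) : Prop where
  orbital : IsLocalOrbitalEquivalence φ₁ φ₂ H
  source_mem : ∀ᶠ x in 𝓝ˢ γ₁, x ∉ γ₁ → x ∈ H.source
  target_mem : ∀ᶠ x in 𝓝ˢ γ₂, x ∉ γ₂ → x ∈ H.target
  source_notMem : ∀ x ∈ H.source, x ∉ γ₁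
  target_notMem : ∀ x ∈ H.target, x ∉ γ₂
  map_section : ∀ O ∈ 𝓝ˢ γ₂, ∀ᶠ x in 𝓝ˢ γ₁, x ∈ B₁.interior → H x ∈ O ∧ H x ∈ B₂.interior
  symm_map_section : ∀ O ∈ 𝓝ˢ γ₁, ∀ᶠ x in 𝓝ˢ γ₂, x ∈ B₂.interior →
    H.symm x ∈ O ∧ H.symm x ∈ B₁.interior

namespace IsSectionEquiv

variable {B₁ : LocalBirkhoffSection φ₁ γ₁} {B₂ : LocalBirkhoffSection φ₂ γ₂}
  {H : OpenPartialHomeomorph M₁ M₂}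

theorem symm (h : IsSectionEquiv B₁ B₂ H) : IsSectionEquiv B₂ B₁ H.symm where
  orbital := h.orbital.symm
  source_mem := h.target_mem
  target_mem := h.source_mem
  source_notMem := h.target_notMem
  target_notMem := h.source_notMem
  map_section := h.symm_map_section
  symm_map_section := h.map_section

/-- The equivalence sends points near the first periodic orbit to points near the second one: a
point is followed to its first intersection with the section, and the time between consecutive
intersections is bounded on both sides. -/
theorem eventually_mem [T2Space M₁] [T2Space M₂] (h : IsSectionEquiv B₁ B₂ H)
    (hγ₁ : IsPeriodicOrbit φ₁ γ₁) (hγ₂ : IsPeriodicOrbit φ₂ γ₂) {O : Set M₂} (hO : O ∈ 𝓝ˢ γ₂) :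
    ∀ᶠ x in 𝓝ˢ γ₁, x ∉ γ₁ → H x ∈ O := by
  obtain ⟨T₁, hT₁, hreg₁⟩ := B₁.exists_isRegular hγ₁
  obtain ⟨T₂, hT₂, hreg₂⟩ := B₂.exists_isRegular hγ₂
  have hO' := (φ₂.eventually_nhdsSet_forall (fun x hx t => hγ₂.flow_mem hx t)
    (inter_mem hO (h.symm_map_section univ univ_mem)) (T₂ + 1)).and hreg₂
  have hx := hreg₁.and (φ₁.eventually_nhdsSet_forall (fun x hx t => hγ₁.flow_mem hx t)
    (inter_mem h.source_mem (h.map_section _ hO')) (T₁ + 1))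
  filter_upwards [hx] with x hx hxγ
  obtain ⟨b, hb, hb0, hbT, hbn⟩ := (hx.1 hxγ).exists_next hγ₁ hT₁
  have hflow : ∀ s ∈ Icc 0 b, φ₁ s x ∈ H.source := fun s hs =>
    (hx.2 s ⟨by linarith [hs.1], hs.2.trans hbT⟩).1 (hγ₁.flow_mem_iff.not.2 hxγ)
  have hxs : x ∈ H.source := by simpa using hflow 0 ⟨le_rfl, hb0.le⟩
  obtain ⟨σ, hσ0, hσc, hσm, hσ⟩ := h.orbital.carriesOrbits x b hb0.le hflow
  obtain ⟨⟨hy1, hy2⟩, hy3⟩ := (hx.2 b ⟨by linarith, hbT⟩).2 hb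
  set y := H (φ₁ b x) with hy
  have hyγ : y ∉ γ₂ := B₂.notMem_of_mem_interior hy3
  have hyx : y = φ₂ (σ b) (H x) := hσ b ⟨hb0.le, le_rfl⟩
  have hσb : 0 < σ b := hσ0 ▸ hσm ⟨le_rfl, hb0.le⟩ ⟨hb0.le, le_rfl⟩ hb0
  -- otherwise the image of the orbit segment would meet the second section before its end point
  have hle : σ b ≤ T₂ + 1 := by
    by_contra! hlt
    obtain ⟨a, ha, ha0, haT, -⟩ := (hy2 hyγ).exists_prev hγ₂ hT₂
    obtain ⟨s, hs, hsa⟩ := intermediate_value_Icc hb0.le hσc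
      (show σ b + a ∈ _ from ⟨by rw [hσ0]; linarith, by linarith⟩)
    have hz : φ₂ a y = H (φ₁ s x) := by
      rw [hσ s hs, hsa, hyx, ← φ₂.map_add, add_comm]
    have h1 := ((hy1 a ⟨haT, by linarith⟩).2 ha).2
    rw [hz, H.left_inv (hflow s hs)] at h1
    have hs0 : 0 < s := lt_of_le_of_ne hs.1 fun h0 => by
      rw [← h0, hσ0] at hsa; linarith
    have hsb : s < b := lt_of_le_of_ne hs.2 fun h0 => by
      rw [h0] at hsa; linarith
    exact hbn s hs0 hsb h1
  have := (hy1 (-σ b) ⟨by linarith, by linarith⟩).1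
  rwa [hyx, ← φ₂.map_add, neg_add_cancel, φ₂.map_zero_apply] at this

end IsSectionEquiv

end SectionEquiv

namespace LocalBirkhoffSection

variable {M : Type*} [TopologicalSpace M] {φ : Flow ℝ M} {γ : Set M}

theorem exists_coordinates (B : LocalBirkhoffSection φ γ) :
    ∃ q : B.interior → ℝ × UnitAddCircle, Continuous q ∧ ∀ x, q x ∈ openAnnulus ∧ B.ι (q x) = x := by
  have hex : ∀ x : B.interior, ∃ p ∈ openAnnulus, B.ι p = x := fun x => x.2
  choose q hq hqx using hex
  refine ⟨q, ?_, fun x => ⟨hq x, hqx x⟩⟩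
  have h1 : Continuous fun x => (⟨q x, hq x⟩ : openAnnulus) := by
    rw [B.embedding.continuous_iff]
    exact continuous_subtype_val.congr fun x => (hqx x).symm
  exact continuous_subtype_val.comp h1

variable {M' : Type*} [TopologicalSpace M'] {φ' : Flow ℝ M'} {γ' : Set M'}

/-- A homeomorphism between the interiors of two sections that sends the end at the periodic orbit
to the end at the periodic orbit has an inverse with the same property. -/
theorem eventually_symm_mem {B : LocalBirkhoffSection φ γ} {B' : LocalBirkhoffSection φ' γ'}
    (h : B.interior ≃ₜ B'.interior)
    (hh : ∀ O ∈ 𝓝ˢ γ', ∀ᶠ x in 𝓝ˢ γ, ∀ hx : x ∈ B.interior, (h ⟨x, hx⟩ : M') ∈ O)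
    {O : Set M} (hO : O ∈ 𝓝ˢ γ) :
    ∀ᶠ y in 𝓝ˢ γ', ∀ hy : y ∈ B'.interior, (h.symm ⟨y, hy⟩ : M) ∈ O := by
  obtain ⟨q, hqc, hq⟩ := B.exists_coordinates
  obtain ⟨q', hqc', hq'⟩ := B'.exists_coordinates
  obtain ⟨r, hr, hr1, hrO⟩ := B.exists_collar_subset hO
  -- the image of the circle of radius `r / 2` stays away from the periodic orbit
  have hcirc : ∀ z : UnitAddCircle, (r / 2, z) ∈ openAnnulus := fun z =>
    ⟨by simpa using hr, by simp only; linarith⟩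
  have hcont : Continuous fun z : UnitAddCircle =>
      (q' (h ⟨B.ι (r / 2, z), mem_image_of_mem _ (hcirc z)⟩)).1 := by
    refine continuous_fst.comp (hqc'.comp (h.continuous.comp (Continuous.subtype_mk ?_ _)))
    exact B.continuousOn_ι.comp_continuous (by fun_prop) fun z =>
      ⟨(hcirc z).1.le, (hcirc z).2⟩
  obtain ⟨z₀, -, hz₀⟩ := isCompact_univ.exists_isMinOn univ_nonempty hcont.continuousOn
  set r' := (q' (h ⟨B.ι (r / 2, z₀), mem_image_of_mem _ (hcirc z₀)⟩)).1 with hr'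
  have hr'0 : 0 < r' := (hq' _).1.1
  have hr'1 : r' < 1 := (hq' _).1.2
  -- the radial coordinate of the inverse, on a thin annulus
  set D : Set (ℝ × UnitAddCircle) := Ioo 0 r' ×ˢ univ with hD
  have hDA : ∀ p : D, (p : ℝ × UnitAddCircle) ∈ openAnnulus := fun p =>
    ⟨p.2.1.1, p.2.1.2.trans hr'1⟩
  set g : D → ℝ := fun p => (q (h.symm ⟨B'.ι p, mem_image_of_mem _ (hDA p)⟩)).1 with hg
  have hgc : Continuous g := by
    refine continuous_fst.comp (hqc.comp (h.symm.continuous.comp (Continuous.subtype_mk ?_ _)))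
    exact B'.continuousOn_ι.comp_continuous continuous_subtype_val fun p =>
      ⟨(hDA p).1.le, (hDA p).2⟩
  have hconn : PreconnectedSpace D := isPreconnected_iff_preconnectedSpace.1
    (isPreconnected_Ioo.prod isPreconnected_univ)
  have hne : ∀ p : D, g p ≠ r / 2 := by
    intro p hp
    set x := h.symm ⟨B'.ι p, mem_image_of_mem _ (hDA p)⟩ with hx
    have h1 : (x : M) = B.ι (r / 2, (q x).2) := by
      rw [← (hq x).2]
      congr 1
      exact Prod.ext hp rfl
    have h2 : x = ⟨B.ι (r / 2, (q x).2), mem_image_of_mem _ (hcirc _)⟩ := Subtype.ext h1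
    have h3 : r' ≤ (q' (h x)).1 := by
      rw [h2]
      exact hz₀ (mem_univ (q x).2)
    have h4 : q' (h x) = p := B'.injOn_ι (hq' _).1 (hDA p) (by
      rw [(hq' _).2, hx, h.apply_symm_apply])
    rw [h4] at h3
    exact absurd p.2.1.2 (not_lt.2 h3)
  obtain ⟨p₀, hp₀⟩ : ∃ p : D, g p < r / 2 := by
    obtain ⟨ε, hε, hε1, hεx⟩ := B.exists_collar_subset
      (hh {y | ∀ p ∈ halfOpenAnnulus, B'.ι p = y → p.1 < r'} (B'.collar r' hr'0))
    set e := min ε r / 3 with he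
    have he0 : 0 < e := by positivity
    have h1 := min_le_left ε r
    have h2 := min_le_right ε r
    have hp : (e, (0 : UnitAddCircle)) ∈ openAnnulus := ⟨he0, by simp only; linarith⟩
    set x : B.interior := ⟨B.ι (e, 0), mem_image_of_mem _ hp⟩ with hx
    have h3 : (q' (h x)).1 < r' := hεx (e, 0) he0.le (by simp only; linarith) x.2 (q' (h x))
      ⟨(hq' _).1.1.le, (hq' _).1.2⟩ (hq' _).2
    refine ⟨⟨q' (h x), ⟨(hq' _).1.1, h3⟩, mem_univ _⟩, ?_⟩
    have h4 : (⟨B'.ι (q' (h x)), mem_image_of_mem _ (hq' (h x)).1⟩ : B'.interior) = h x :=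
      Subtype.ext (hq' _).2
    have h5 : q x = (e, 0) := B.injOn_ι (hq x).1 hp (hq x).2
    simp only [g]
    rw [h4, h.symm_apply_apply, h5]
    simp only
    linarith
  have hlt : ∀ p, g p < r / 2 := by
    intro p
    by_contra hge
    obtain ⟨p₁, hp₁⟩ := intermediate_value_univ p₀ p hgc ⟨hp₀.le, not_lt.1 hge⟩
    exact hne p₁ hp₁
  filter_upwards [B'.collar r' hr'0] with y hy hyB
  have h1 : (q' ⟨y, hyB⟩).1 < r' := hy _ ⟨(hq' _).1.1.le, (hq' _).1.2⟩ (hq' _).2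
  have h2 := hlt ⟨q' ⟨y, hyB⟩, ⟨(hq' _).1.1, h1⟩, mem_univ _⟩
  have h3 : (⟨B'.ι (q' ⟨y, hyB⟩), mem_image_of_mem _ (hq' _).1⟩ : B'.interior) = ⟨y, hyB⟩ :=
    Subtype.ext (hq' _).2
  simp only [g] at h2
  rw [h3] at h2
  have h4 := hrO _ (hq (h.symm ⟨y, hyB⟩)).1.1.le (by linarith)
  rwa [(hq _).2] at h4

end LocalBirkhoffSection

section Represents

variable {M₁ M₂ : Type*} [TopologicalSpace M₁] [TopologicalSpace M₂]
  {φ₁ : Flow ℝ M₁} {φ₂ : Flow ℝ M₂} {γ₁ : Set M₁} {γ₂ : Set M₂}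

/-- The germ `E` is the homeomorphism `H` read in the saddle charts. -/
structure PuncturedEquiv.Represents {c₁ : SaddleChart φ₁ γ₁} {c₂ : SaddleChart φ₂ γ₂}
    (E : PuncturedEquiv c₁.a c₁.b c₂.a c₂.b) (H : OpenPartialHomeomorph M₁ M₂) : Prop where
  toFun_eq : E.toFun = fun q => c₂.chart (H (c₁.chart.symm q))
  invFun_eq : E.invFun = fun q => c₁.chart (H.symm (c₂.chart.symm q))
  mem : ∀ q ∈ puncturedTube E.ℓ₁, q ∈ c₁.chart.target ∧ c₁.chart.symm q ∈ H.source ∧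
    H (c₁.chart.symm q) ∈ c₂.chart.source
  mem_symm : ∀ q ∈ puncturedTube E.ℓ₂, q ∈ c₂.chart.target ∧ c₂.chart.symm q ∈ H.target ∧
    H.symm (c₂.chart.symm q) ∈ c₁.chart.source

variable {c₁ : SaddleChart φ₁ γ₁} {c₂ : SaddleChart φ₂ γ₂} {H : OpenPartialHomeomorph M₁ M₂}

theorem PuncturedEquiv.Represents.symm {E : PuncturedEquiv c₁.a c₁.b c₂.a c₂.b}
    (h : E.Represents H) : E.symm.Represents (c₁ := c₂) (c₂ := c₁) H.symm where
  toFun_eq := h.invFun_eq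
  invFun_eq := h.toFun_eq
  mem := h.mem_symm
  mem_symm := h.mem

/-- Sufficiently thin punctured tubes lie in a given punctured neighbourhood. -/
theorem SaddleChart.exists_puncturedTube {M : Type*} [TopologicalSpace M] {φ : Flow ℝ M}
    {γ : Set M} (c : SaddleChart φ γ) {P : M → Prop} (h : ∀ᶠ x in 𝓝ˢ γ, x ∉ γ → P x) :
    ∃ ℓ, ∀ q ∈ puncturedTube ℓ, q ∈ c.chart.target ∧ c.chart.symm q ∉ γ ∧ P (c.chart.symm q) := by
  obtain ⟨ε, hε, hq⟩ := c.eventually_nhdsSet_iff.1 h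
  refine ⟨Real.log ε, fun q hqℓ => ?_⟩
  have h1 := hq q (by simpa [Real.exp_log hε] using hqℓ.2)
  have h2 : c.chart.symm q ∉ γ := by
    rw [c.symm_mem_iff h1.1]
    exact hqℓ.1
  exact ⟨h1.1, h2, h1.2 h2⟩

theorem exists_puncturedTube_image [T2Space M₁] [T2Space M₂] {B₁ : LocalBirkhoffSection φ₁ γ₁}
    {B₂ : LocalBirkhoffSection φ₂ γ₂} (c₁ : SaddleChart φ₁ γ₁) (c₂ : SaddleChart φ₂ γ₂)
    (h : IsSectionEquiv B₁ B₂ H)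
    (hγ₁ : IsPeriodicOrbit φ₁ γ₁) (hγ₂ : IsPeriodicOrbit φ₂ γ₂) (r : ℝ) :
    ∃ ℓ, ∀ q ∈ puncturedTube ℓ, q ∈ c₁.chart.target ∧ c₁.chart.symm q ∈ H.source ∧
      H (c₁.chart.symm q) ∈ c₂.chart.source ∧ c₂.chart (H (c₁.chart.symm q)) ∈ puncturedTube r := by
  obtain ⟨ℓ, hℓ⟩ := c₁.exists_puncturedTube ((h.source_mem.and (h.eventually_mem hγ₁ hγ₂
    (c₂.eventually_norm_lt (Real.exp_pos r)))).mono fun x hx hxγ => And.intro (hx.1 hxγ) (hx.2 hxγ))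
  refine ⟨ℓ, fun q hq => ?_⟩
  obtain ⟨h1, h2, h3, h4, h5⟩ := hℓ q hq
  refine ⟨h1, h3, h4, ?_, h5⟩
  rw [Ne, c₂.fst_eq_zero_iff h4]
  exact h.target_notMem _ (H.map_source h3)

/-- Read in the saddle charts, the equivalence is a germ of equivalences of punctured tubes. -/
theorem IsSectionEquiv.exists_puncturedEquiv [T2Space M₁] [T2Space M₂]
    {B₁ : LocalBirkhoffSection φ₁ γ₁} {B₂ : LocalBirkhoffSection φ₂ γ₂}
    (c₁ : SaddleChart φ₁ γ₁) (c₂ : SaddleChart φ₂ γ₂) (h : IsSectionEquiv B₁ B₂ H)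
    (hγ₁ : IsPeriodicOrbit φ₁ γ₁) (hγ₂ : IsPeriodicOrbit φ₂ γ₂) :
    ∃ E : PuncturedEquiv c₁.a c₁.b c₂.a c₂.b, E.Represents H := by
  have key := exists_puncturedTube_image c₁ c₂ h hγ₁ hγ₂
  have key' := exists_puncturedTube_image c₂ c₁ h.symm hγ₂ hγ₁
  obtain ⟨ℓ₁, h₁⟩ := key 0
  obtain ⟨ℓ₂, h₂⟩ := key' 0
  have hcont : ContinuousOn (fun q => c₂.chart (H (c₁.chart.symm q))) (puncturedTube ℓ₁) :=
    c₂.chart.continuousOn.comp (H.continuousOn.comp (c₁.chart.symm.continuousOn.mono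
      fun q hq => (h₁ q hq).1) fun q hq => (h₁ q hq).2.1) fun q hq => (h₁ q hq).2.2.1
  have hcont' : ContinuousOn (fun q => c₁.chart (H.symm (c₂.chart.symm q))) (puncturedTube ℓ₂) :=
    c₁.chart.continuousOn.comp (H.symm.continuousOn.comp (c₂.chart.symm.continuousOn.mono
      fun q hq => (h₂ q hq).1) fun q hq => (h₂ q hq).2.1) fun q hq => (h₂ q hq).2.2.1
  refine ⟨⟨fun q => c₂.chart (H (c₁.chart.symm q)), fun q => c₁.chart (H.symm (c₂.chart.symm q)),
    ℓ₁, ℓ₂, hcont, hcont', fun q hq => (h₁ q hq).2.2.2.1, fun q hq => (h₂ q hq).2.2.2.1,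
    fun q hq => ?_, fun q hq => ?_, fun r => ?_, fun r => ?_, ?_, ?_⟩, ⟨rfl, rfl,
    fun q hq => ⟨(h₁ q hq).1, (h₁ q hq).2.1, (h₁ q hq).2.2.1⟩,
    fun q hq => ⟨(h₂ q hq).1, (h₂ q hq).2.1, (h₂ q hq).2.2.1⟩⟩⟩
  · rw [c₂.chart.left_inv (h₁ q hq).2.2.1, H.left_inv (h₁ q hq).2.1,
      c₁.chart.right_inv (h₁ q hq).1]
  · rw [c₁.chart.left_inv (h₂ q hq).2.2.1, H.right_inv (h₂ q hq).2.1,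
      c₂.chart.right_inv (h₂ q hq).1]
  · obtain ⟨r', hr'⟩ := key r
    exact ⟨min r' ℓ₁, min_le_right _ _, fun q hq =>
      (hr' q (puncturedTube_mono (min_le_left _ _) hq)).2.2.2⟩
  · obtain ⟨r', hr'⟩ := key' r
    exact ⟨min r' ℓ₂, min_le_right _ _, fun q hq =>
      (hr' q (puncturedTube_mono (min_le_left _ _) hq)).2.2.2⟩
  · exact c₂.orbital.carriesOrbits.comp (h.orbital.carriesOrbits.comp
      (c₁.orbital.symm.carriesOrbits.mono (S' := puncturedTube ℓ₁) fun q hq => (h₁ q hq).1)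
      fun q hq => (h₁ q hq).2.1) fun q hq => (h₁ q hq).2.2.1
  · exact c₁.orbital.carriesOrbits.comp (h.orbital.symm.carriesOrbits.comp
      (c₂.orbital.symm.carriesOrbits.mono (S' := puncturedTube ℓ₂) fun q hq => (h₂ q hq).1)
      fun q hq => (h₂ q hq).2.1) fun q hq => (h₂ q hq).2.2.1

theorem PuncturedEquiv.Represents.isPositive {E : PuncturedEquiv c₁.a c₁.b c₂.a c₂.b}
    (h : E.Represents H) (hor : PreservesOrientation c₁ c₂ H) : E.IsPositive := by
  intro r
  obtain ⟨ℓ, hℓ⟩ := c₁.exists_puncturedTube hor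
  set s := min r ℓ - 1 with hs
  have h1 := min_le_left r ℓ
  have h2 := min_le_right r ℓ
  have hmem : (((Real.exp s : ℝ) : ℂ), (0 : UnitAddCircle)) ∈ puncturedTube ℓ := by
    refine ⟨by simp, ?_⟩
    rw [Complex.norm_real, Real.norm_of_nonneg (Real.exp_pos _).le, Real.exp_lt_exp]
    linarith
  obtain ⟨htar, -, -, Z, hZ, hind⟩ := hℓ _ hmem
  simp only [c₁.chart.right_inv htar] at hZ hind
  refine ⟨s, by linarith, 0, Z, ?_, ?_⟩
  · rw [h.toFun_eq]
    exact hZ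
  · rw [h.toFun_eq]
    exact hind

end Represents

/-! ### The action on homology, and the shift along the orbits -/

section Shift

variable {M₁ M₂ : Type*} [TopologicalSpace M₁] [TopologicalSpace M₂]
  {φ₁ : Flow ℝ M₁} {φ₂ : Flow ℝ M₂} {γ₁ : Set M₁} {γ₂ : Set M₂}
  {c₁ : SaddleChart φ₁ γ₁} {c₂ : SaddleChart φ₂ γ₂}
  {B₁ : LocalBirkhoffSection φ₁ γ₁} {B₂ : LocalBirkhoffSection φ₂ γ₂}
  {H : OpenPartialHomeomorph M₁ M₂} {E : PuncturedEquiv c₁.a c₁.b c₂.a c₂.b} {n m : ℤ}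

theorem IsSectionEquiv.eventually_mem_collar (h : IsSectionEquiv B₁ B₂ H)
    {ρ : ℝ} (hρ : 0 < ρ) :
    ∀ᶠ x in 𝓝ˢ γ₁, x ∈ B₁.interior → ∃ p ∈ openAnnulus, p.1 < ρ ∧ B₂.ι p = H x := by
  filter_upwards [h.map_section _ (B₂.collar ρ hρ)] with x hx hxB
  obtain ⟨h1, p, hp, hpx⟩ := hx hxB
  exact ⟨p, hp, h1 p ⟨hp.1.le, hp.2⟩ hpx, hpx⟩

/-- The orientation of the longitude is preserved: the image of a path of the section that converges
to the periodic orbit in the stable manifold is such a path, and the orbits meet its translates in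
the same order. -/
theorem TubeLift.long_eq_one [T2Space M₂] (T : TubeLift E) (T' : TubeLift E.symm)
    (hE : E.Represents H) (h : IsSectionEquiv B₁ B₂ H) (hγ₁ : IsPeriodicOrbit φ₁ γ₁)
    (hγ₂ : IsPeriodicOrbit φ₂ γ₂) (hB₁ : B₁.IsTame c₁) (hB₂ : B₂.IsTame c₂)
    (S₂ : StripLift c₂ B₂ n m) : T.long = 1 := by
  obtain ⟨P, hPc, hPim, ⟨A, hA⟩, hlim, hPB⟩ := LocalBirkhoffSection.exists_stable_path hγ₁ hB₁
  obtain ⟨ρ, hρ, hρS, K, hK⟩ := S₂.exists_slope_bound hB₂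
  obtain ⟨ℓ, hℓ⟩ := c₁.exists_puncturedTube ((h.eventually_mem_collar hρ).mono
    fun x hx (_ : x ∉ γ₁) => hx)
  obtain ⟨t₁, ht₁, hPr⟩ : ∃ t₁ ∈ Ioc (0 : ℝ) 1, ∀ t ∈ Ioc 0 t₁, P t ∈ logTube (min ℓ E.ℓ₁) := by
    obtain ⟨u, hu, hsub⟩ := mem_nhdsGT_iff_exists_Ioo_subset.1
      (hlim.eventually_lt_atBot (min ℓ E.ℓ₁))
    have hu0 : (0 : ℝ) < u := hu
    refine ⟨min (u / 2) 1, ⟨by positivity, min_le_right _ _⟩, fun t ht => ?_⟩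
    exact hsub ⟨ht.1, by linarith [ht.2, min_le_left (u / 2) 1]⟩
  have hsub : Ioc 0 t₁ ⊆ Ioc (0 : ℝ) 1 := Ioc_subset_Ioc_right ht₁.2
  have hPE : ∀ t ∈ Ioc 0 t₁, P t ∈ logTube E.ℓ₁ := fun t ht =>
    logTube_mono (min_le_right _ _) (hPr t ht)
  have hmem : ∀ t ∈ Ioc 0 t₁, logCover (P t) ∈ puncturedTube E.ℓ₁ := fun t ht =>
    logCover_mem.2 (hPE t ht)
  -- the longitudinal coordinate is bounded on the image of the path
  obtain ⟨A₂, hA₂⟩ : ∃ A₂, ∀ t ∈ Ioc 0 t₁, |(T.toFun (P t)).2| ≤ A₂ := by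
    obtain ⟨f, hfc, hf⟩ := S₂.exists_lift (convex_Ioc 0 t₁)
      (w := fun t => H (c₁.chart.symm (logCover (P t))))
      (H.continuousOn.comp (c₁.chart.symm.continuousOn.comp
        (continuous_logCover.comp_continuousOn (hPc.mono hsub))
        fun t ht => (hE.mem _ (hmem t ht)).1) fun t ht => (hE.mem _ (hmem t ht)).2.1)
      fun t ht => by
        obtain ⟨x, hxs, hxB, hxP⟩ := hPB t (hsub ht)
        refine (hℓ _ (logCover_mem.2 (logTube_mono (min_le_left _ _) (hPr t ht)))).2.2 ?_
        rwa [← hxP, c₁.chart.left_inv hxs]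
    have hfS : ∀ t ∈ Ioc 0 t₁, f t ∈ openStrip S₂.r₀ := fun t ht => openStrip_mono hρS (hf t ht).1
    obtain ⟨i, j, hij⟩ := isPreconnected_Ioc.exists_deck (f := fun t => S₂.toFun (f t))
      (g := fun t => T.toFun (P t)) (S₂.cont.comp hfc hfS) (T.cont.comp (hPc.mono hsub) hPE)
      fun t ht => by
        rw [← S₂.chart_point (hfS t ht), (hf t ht).2, T.lifts _ (hPE t ht), hE.toFun_eq]
    obtain ⟨k, hk⟩ := E.exists_im_lift_eq c₁.a_neg c₂.b_pos T.cont T.lifts 0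
    have hn : (1 : ℝ) ≤ |(n : ℝ)| := by
      rw [← Int.cast_abs]
      exact_mod_cast Int.one_le_abs (S₂.link_ne_zero hγ₂ hB₂)
    set D := (n : ℝ) * j - m * ((k * Real.pi + 2 * Real.pi * i) / (2 * Real.pi)) with hD
    refine ⟨K + |D|, fun t ht => ?_⟩
    have h1 := hK _ (hf t ht).1
    rw [hij t ht, deck_snd, deck_im, hk _ (hPE t ht) (by rw [hPim t (hsub ht)]; simp)] at h1
    have h2 : |(n : ℝ) * (T.toFun (P t)).2| ≤ K + |D| := by
      rw [show (n : ℝ) * (T.toFun (P t)).2 = (n * ((T.toFun (P t)).2 + j) -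
        m * ((k * Real.pi + 2 * Real.pi * i) / (2 * Real.pi))) - D by rw [hD]; ring]
      exact (abs_sub _ _).trans (by linarith)
    rw [abs_mul] at h2
    nlinarith [abs_nonneg (T.toFun (P t)).2]
  -- the orbit of the end point meets a translate by some large `N` at a positive time; if `long = -1`,
  -- the image orbit would meet a translate by `-N` at a positive time
  refine (T.long_eq_one_or T').resolve_right fun hneg => ?_
  obtain ⟨N, hN⟩ := exists_nat_gt (max (2 * A) (2 * A₂))
  have hN₁ := (le_max_left _ _).trans_lt hN
  have hN₂ := (le_max_right _ _).trans_lt hN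
  obtain ⟨t₂, ht₂, σ, hσ, htr⟩ := exists_translate_on_orbit (N := N) ht₁.1 (hPc.mono hsub)
    (fun t ht => hPim t (hsub ht)) (fun t ht => hA t (hsub ht)) hlim c₁.a_neg (by exact_mod_cast hN₁)
  have hm₁ : t₁ ∈ Ioc 0 t₁ := ⟨ht₁.1, le_rfl⟩
  obtain ⟨σ', hσ', -, hT⟩ := T.slice_flow c₁.a_neg c₂.b_pos (hPE t₁ hm₁) (j := 0)
    (by rw [hPim t₁ ht₁]; simp) hσ.le
  rw [htr, T.equivariant _ (hPE t₂ ht₂)] at hT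
  have h1 := congr_arg Prod.snd hT
  simp only [deck_snd, hneg] at h1
  push_cast at h1
  have h2 := abs_le.1 (hA₂ t₁ hm₁)
  have h3 := abs_le.1 (hA₂ t₂ ht₂)
  linarith

/-- If the linking numbers and the multiplicities of the two sections coincide, the equivalence acts
trivially on the homology of the punctured tube, and the shift along the orbits is bounded on the
section: the slopes of both sections and the change of the angular coordinate are bounded. -/
theorem TubeLift.twist_eq_zero [T2Space M₂] (T : TubeLift E) (T' : TubeLift E.symm)
    (hE : E.Represents H) (h : IsSectionEquiv B₁ B₂ H) (hγ₂ : IsPeriodicOrbit φ₂ γ₂)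
    (hB₁ : B₁.IsTame c₁) (hB₂ : B₂.IsTame c₂)
    (S₁ : StripLift c₁ B₁ n m) (S₂ : StripLift c₂ B₂ n m) (hlong : T.long = 1)
    (hor : E.IsPositive) : T.twist = 0 ∧ ∃ K, ∀ᶠ x in 𝓝ˢ γ₁, x ∈ B₁.interior →
      ∀ y, logCover y = c₁.chart x → |(T.toFun y).2 - y.2| ≤ K := by
  obtain ⟨hmerid, r, hr, A, hA⟩ :=
    T.merid_eq_one T' c₁.a_neg c₁.b_pos c₂.a_neg c₂.b_pos hlong hor
  obtain ⟨ρ₁, hρ₁, hρ₁S, K₁, hK₁⟩ := S₁.exists_slope_bound hB₁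
  obtain ⟨ρ₂, hρ₂, hρ₂S, K₂, hK₂⟩ := S₂.exists_slope_bound hB₂
  have hn := S₂.link_ne_zero hγ₂ hB₂
  obtain ⟨ρ₃, hρ₃, -, hcol⟩ := B₁.exists_collar_subset
    ((h.eventually_mem_collar hρ₂).and (c₁.eventually_norm_lt (Real.exp_pos r)))
  set ρ := min ρ₁ ρ₃ with hρ
  have hρ0 : 0 < ρ := lt_min hρ₁ hρ₃
  have hS : ∀ x ∈ openStrip ρ, x ∈ openStrip S₁.r₀ := fun x hx =>
    openStrip_mono ((min_le_left _ _).trans hρ₁S) hx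
  have hcol' : ∀ x ∈ openStrip ρ, _ := fun x hx =>
    hcol (x.1, ((S₁.sign * x.2 : ℝ) : UnitAddCircle)) hx.1.1.le (hx.1.2.trans_le (min_le_right _ _))
  have hyr : ∀ x ∈ openStrip ρ, S₁.toFun x ∈ logTube r := fun x hx => by
    have h1 := (hcol' x hx).2.2
    rw [← S₁.lifts x (hS x hx)] at h1
    rw [← logCover_mem]
    exact ⟨Complex.exp_ne_zero _, h1⟩
  have hyE : ∀ x ∈ openStrip ρ, S₁.toFun x ∈ logTube E.ℓ₁ := fun x hx => logTube_mono hr (hyr x hx)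
  have hsymm : ∀ x ∈ openStrip ρ, c₁.chart.symm (logCover (S₁.toFun x)) = S₁.point x :=
    fun x hx => by
      rw [← S₁.chart_point (hS x hx), c₁.chart.left_inv (S₁.point_mem_source (hS x hx))]
  have hsrc : ∀ x ∈ openStrip ρ, S₁.point x ∈ H.source := fun x hx => by
    rw [← hsymm x hx]
    exact (hE.mem _ (logCover_mem.2 (hyE x hx))).2.1
  obtain ⟨f, hfc, hf⟩ := S₂.exists_lift (convex_openStrip ρ) (w := fun x => H (S₁.point x))
    (H.continuousOn.comp (S₁.continuousOn_point.mono fun x hx => hS x hx) hsrc)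
    fun x hx => (hcol' x hx).1 (S₁.point_mem_interior (hS x hx))
  have hfS : ∀ x ∈ openStrip ρ, f x ∈ openStrip S₂.r₀ := fun x hx =>
    openStrip_mono hρ₂S (hf x hx).1
  obtain ⟨i, j, hij⟩ := (convex_openStrip ρ).isPreconnected.exists_deck
    (f := fun x => S₂.toFun (f x)) (g := fun x => T.toFun (S₁.toFun x)) (S₂.cont.comp hfc hfS)
    (T.cont.comp (S₁.cont.mono fun x hx => hS x hx) hyE) fun x hx => by
      rw [← S₂.chart_point (hfS x hx), (hf x hx).2, T.lifts _ (hyE x hx), hE.toFun_eq]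
      simp only
      rw [hsymm x hx]
  -- the action on the class of the boundary curve
  have hx₀ : ∀ s, (ρ / 2, s) ∈ openStrip ρ := fun s => ⟨⟨half_pos hρ0, half_lt_self hρ0⟩, mem_univ _⟩
  have htwist : T.twist = 0 := by
    have hpt : S₂.point (f (ρ / 2, 0 + 1)) = S₂.point (f (ρ / 2, 0)) := by
      rw [(hf _ (hx₀ _)).2, (hf _ (hx₀ _)).2]
      congr 1
      rw [S₁.point_eq_iff (hS _ (hx₀ _)) (hS _ (hx₀ _))]
      exact ⟨1, by simp⟩
    obtain ⟨d, hd⟩ := (S₂.point_eq_iff (hfS _ (hx₀ _)) (hfS _ (hx₀ _))).1 hpt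
    have h1 := hij _ (hx₀ (0 + 1))
    have h2 := S₁.equivariant _ (hS _ (hx₀ 0))
    simp only at h2
    rw [h2, T.equivariant _ (hyE _ (hx₀ 0)), hd, S₂.equivariant_int _ _ (hfS _ (hx₀ 0)),
      hij _ (hx₀ 0), deck_deck, deck_deck] at h1
    obtain ⟨h3, h4⟩ := deck_injective h1
    rw [hmerid, one_mul] at h3
    rw [hlong, one_mul] at h4
    -- the curve is sent to `d` times the curve; the meridian component shows that `d = 1`
    have hd1 : d = 1 := by
      have : n * (d - 1) = 0 := by linarith
      rcases mul_eq_zero.1 this with h | h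
      · exact (hn h).elim
      · linarith
    have : T.twist * n = 0 := by rw [hd1] at h4; linarith
    exact (mul_eq_zero.1 this).resolve_right hn
  have hn1 : (1 : ℝ) ≤ |(n : ℝ)| := by
    rw [← Int.cast_abs]
    exact_mod_cast Int.one_le_abs hn
  set D := (n : ℝ) * j - m * i with hD
  have hbound : ∀ x ∈ openStrip ρ, |(T.toFun (S₁.toFun x)).2 - (S₁.toFun x).2| ≤
      K₁ + K₂ + |D| + |(m : ℝ)| * (A / (2 * Real.pi)) := by
    intro x hx
    have h1 := hK₁ x (openStrip_mono (min_le_left _ _) hx)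
    have h2 := hK₂ _ (hf x hx).1
    rw [hij x hx, deck_snd, deck_im] at h2
    have h3 := hA _ (hyr x hx)
    set y := S₁.toFun x
    set z := T.toFun y
    have hpi := Real.two_pi_pos
    have h4 : |(m : ℝ) * ((z.1.im - y.1.im) / (2 * Real.pi))| ≤ |(m : ℝ)| * (A / (2 * Real.pi)) := by
      rw [abs_mul, abs_div, abs_of_pos hpi]
      gcongr
    have h5 : (n : ℝ) * (z.2 - y.2) =
        (n * (z.2 + j) - m * ((z.1.im + 2 * Real.pi * i) / (2 * Real.pi))) -
        (n * y.2 - m * (y.1.im / (2 * Real.pi))) - D +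
        m * ((z.1.im - y.1.im) / (2 * Real.pi)) := by
      rw [hD]
      field_simp
      ring
    have h6 : |(n : ℝ) * (z.2 - y.2)| ≤ K₁ + K₂ + |D| + |(m : ℝ)| * (A / (2 * Real.pi)) := by
      rw [h5]
      refine (abs_add_le _ _).trans (add_le_add ?_ h4)
      refine (abs_sub _ _).trans (add_le_add ?_ le_rfl)
      exact (abs_sub _ _).trans (by linarith)
    rw [abs_mul] at h6
    nlinarith [abs_nonneg (z.2 - y.2)]
  refine ⟨htwist, K₁ + K₂ + |D| + |(m : ℝ)| * (A / (2 * Real.pi)), ?_⟩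
  filter_upwards [B₁.collar ρ hρ0] with x hx hxB y hy
  obtain ⟨⟨p, z⟩, hp, rfl⟩ := hxB
  obtain ⟨s, rfl⟩ := QuotientAddGroup.mk_surjective z
  have hpρ := hx _ ⟨hp.1.le, hp.2⟩ rfl
  have hps : (p, S₁.sign * s) ∈ openStrip ρ := ⟨⟨hp.1, hpρ⟩, mem_univ _⟩
  have hpt : S₁.point (p, S₁.sign * s) = B₁.ι (p, (s : UnitAddCircle)) := by
    simp only [StripLift.point]
    rw [← mul_assoc, S₁.sign_mul_self, one_mul]
  have h1 : logCover y = logCover (S₁.toFun (p, S₁.sign * s)) := by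
    rw [hy, ← S₁.chart_point (hS _ hps), hpt]
  obtain ⟨k, l, rfl⟩ := logCover_eq_iff.1 h1
  rw [T.equivariant _ (hyE _ hps), deck_snd, deck_snd, htwist, hlong, zero_mul, zero_add, one_mul,
    add_sub_add_right_eq_sub]
  exact hbound _ hps

/-- The model time that corresponds to a given time is bounded near the periodic orbit. -/
theorem SaddleChart.exists_clock_le {M : Type*} [TopologicalSpace M] {φ : Flow ℝ M} {γ : Set M}
    (c : SaddleChart φ γ) (hγ : IsPeriodicOrbit φ γ) (t : ℝ) :
    ∃ K, ∀ᶠ x in 𝓝ˢ γ, c.clock x t ≤ K := by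
  have hstay : ∀ x ∈ γ, t ∈ stayTimes φ c.chart.source x := fun x hx => by
    rw [stayTimes_univ_of_invariant fun s => c.subset_source (hγ.flow_mem hx s)]
    exact mem_univ _
  have hc : ContinuousOn (fun x => c.clock x t) γ := fun x hx =>
    (SaddleChart.continuousAt_clock (hstay x hx)).continuousWithinAt
  obtain ⟨K, hK⟩ := c.isCompact_orbit.bddAbove_image hc
  refine ⟨K + 1, eventually_nhdsSet_iff_forall.2 fun x hx => ?_⟩
  have h1 : c.clock x t < K + 1 := lt_of_le_of_lt (hK ⟨x, hx, rfl⟩) (lt_add_one K)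
  exact ((SaddleChart.continuousAt_clock (hstay x hx)).eventually_lt continuousAt_const h1).mono
    fun _ h => h.le

/-- Along an orbit, the longitudinal coordinates of a point of the universal cover and of its image
increase by the model times. -/
theorem TubeLift.exists_flow_lift {a₁ b₁ a₂ b₂ : ℝ} {E : PuncturedEquiv a₁ b₁ a₂ b₂}
    (T : TubeLift E) {y : ℂ × ℝ} {t : ℝ} (ht : 0 ≤ t)
    (hmem : ∀ s ∈ Icc 0 t, saddleFlow a₁ b₁ s (logCover y) ∈ puncturedTube E.ℓ₁) :
    ∃ σ : ℝ, 0 ≤ σ ∧ (0 < t → 0 < σ) ∧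
      E.toFun (saddleFlow a₁ b₁ t (logCover y)) = saddleFlow a₂ b₂ σ (E.toFun (logCover y)) ∧
      ∃ y', logCover y' = saddleFlow a₁ b₁ t (logCover y) ∧ y'.2 = y.2 + t ∧
        (T.toFun y').2 = (T.toFun y).2 + σ := by
  obtain ⟨σ, hσ0, hσc, hσm, hσ⟩ := E.orbits _ t ht hmem
  obtain ⟨Y, hYc, hY⟩ := exists_logCover_lift (convex_Icc 0 t)
    (f := fun s => saddleFlow a₁ b₁ s (logCover y))
    ((saddleFlow a₁ b₁).continuous continuous_id continuous_const).continuousOn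
    fun s hs => (hmem s hs).1
  have h0 : (0 : ℝ) ∈ Icc 0 t := ⟨le_rfl, ht⟩
  have ht' : t ∈ Icc 0 t := ⟨ht, le_rfl⟩
  -- normalise the lift of the orbit to start at `y`
  obtain ⟨i, j, hij⟩ := logCover_eq_iff.1 ((hY 0 h0).trans ((saddleFlow a₁ b₁).map_zero_apply _))
  have hYi : deck (-i) (-j) (Y 0) = y := by
    rw [hij, deck_deck, neg_add_cancel, neg_add_cancel, deck_zero]
  set Y' : ℝ → ℂ × ℝ := fun s => deck (-i) (-j) (Y s) with hY'
  have hY'c : ContinuousOn Y' (Icc 0 t) := (continuous_deck _ _).comp_continuousOn hYc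
  have hY'l : ∀ s ∈ Icc 0 t, logCover (Y' s) = saddleFlow a₁ b₁ s (logCover y) := fun s hs => by
    rw [← hY s hs]
    exact logCover_deck _ _ _
  have hY'0 : Y' 0 = y := hYi
  have hY'm : ∀ s ∈ Icc 0 t, Y' s ∈ logTube E.ℓ₁ := fun s hs => by
    rw [← logCover_mem, hY'l s hs]
    exact hmem s hs
  obtain ⟨k, hk⟩ := isPreconnected_Icc.exists_int_of_circle_lifts (f := fun s => (Y' s).2)
    (g := fun s => y.2 + s) hY'c.snd (by fun_prop) fun s (hs : s ∈ Icc 0 t) => by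
      have := congr_arg Prod.snd (hY'l s hs)
      rw [saddleFlow_snd] at this
      rw [AddCircle.coe_add]
      exact this
  obtain ⟨l, hl⟩ := isPreconnected_Icc.exists_int_of_circle_lifts
    (f := fun s => (T.toFun (Y' s)).2) (g := fun s => (T.toFun y).2 + σ s)
    (T.cont.comp hY'c hY'm).snd (continuousOn_const.add hσc) fun s (hs : s ∈ Icc 0 t) => by
      have h1 := congr_arg Prod.snd (T.lifts _ (hY'm s hs))
      have h2 := congr_arg Prod.snd (T.lifts _ (hY'm 0 h0))
      rw [hY'l s hs, hσ s hs, saddleFlow_snd] at h1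
      rw [hY'0] at h2
      rw [AddCircle.coe_add, show ((T.toFun y).2 : UnitAddCircle) = _ from h2]
      exact h1
  have hk0 := hk 0 h0
  have hl0 := hl 0 h0
  simp only [hY'0, hσ0] at hk0 hl0
  have hkt : (Y' t).2 = y.2 + t + k := hk t ht'
  have hlt : (T.toFun (Y' t)).2 = (T.toFun y).2 + σ t + l := hl t ht'
  refine ⟨σ t, hσ0 ▸ hσm.monotoneOn h0 ht' ht, fun h => hσ0 ▸ hσm h0 ht' h, hσ t ht', Y' t,
    hY'l t ht', by linarith, by linarith⟩

/-- An upper bound of the shift on the section gives an upper bound on a punctured tube, since the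
orbits meet the section in bounded time, and the sum of the time and the shift increases along the
orbits. -/
theorem TubeLift.exists_shift_le (T : TubeLift E)
    (hγ₁ : IsPeriodicOrbit φ₁ γ₁) {K : ℝ} (hK : ∀ᶠ x in 𝓝ˢ γ₁, x ∈ B₁.interior →
      ∀ y, logCover y = c₁.chart x → (T.toFun y).2 - y.2 ≤ K) :
    ∃ ℓ ≤ E.ℓ₁, ∃ K', ∀ y ∈ logTube ℓ, (T.toFun y).2 - y.2 ≤ K' := by
  obtain ⟨t₀, ht₀, hhit⟩ := B₁.exists_hit hγ₁
  obtain ⟨τ, hτ⟩ := c₁.exists_clock_le hγ₁ t₀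
  obtain ⟨ℓ, hℓ⟩ := c₁.exists_puncturedTube (((hhit.and hτ).and (φ₁.eventually_nhdsSet_forall
    (fun x hx t => hγ₁.flow_mem hx t) (hK.and c₁.source_mem_nhdsSet) t₀)).mono
    fun x hx (_ : x ∉ γ₁) => hx)
  set β := max |c₁.a| |c₁.b| with hβ
  refine ⟨min ℓ (E.ℓ₁ - β * |τ|), ?_, K + τ, fun y hy => ?_⟩
  · have : 0 ≤ β * |τ| := mul_nonneg (le_max_of_le_left (abs_nonneg _)) (abs_nonneg _)
    exact (min_le_right _ _).trans (by linarith)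
  obtain ⟨htar, hxγ, ⟨hx, hxτ⟩, hxf⟩ := hℓ _ (logCover_mem.2 (logTube_mono (min_le_left _ _) hy))
  set x := c₁.chart.symm (logCover y) with hxd
  have hxs : x ∈ c₁.chart.source := c₁.chart.map_target htar
  have hxc : c₁.chart x = logCover y := c₁.chart.right_inv htar
  obtain ⟨t, ht, hxt⟩ := hx hxγ
  have hstay : ∀ s ∈ Icc 0 t₀, s ∈ stayTimes φ₁ c₁.chart.source x := fun s hs =>
    Icc_subset_stayTimes hs.1 fun s' hs' => (hxf s' ⟨by linarith [hs'.1], hs'.2.trans hs.2⟩).2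
  set θ := c₁.clock x t with hθ
  have hmono := (SaddleChart.strictMonoOn_clock hxs).monotoneOn
  have hθ0 : 0 ≤ θ := by
    rw [← SaddleChart.clock_zero hxs]
    exact hmono (hstay 0 ⟨le_rfl, ht₀.le⟩) (hstay t ht) ht.1
  have hθτ : θ ≤ τ := (hmono (hstay t ht) (hstay t₀ ⟨ht₀.le, le_rfl⟩) ht.2).trans hxτ
  obtain ⟨σ, hσ, -, -, y', hy', hy'2, hTy'⟩ := T.exists_flow_lift (y := y) hθ0 fun s hs => by
    refine ⟨(saddleFlow_fst_eq_zero _ _).not.2 (Complex.exp_ne_zero _), ?_⟩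
    refine (norm_saddleFlow_le _ _ (le_max_left _ _) (le_max_right _ _) _ _).trans_lt ?_
    have h1 := (logCover_mem.2 hy).2
    have h2 : |s| ≤ |τ| := abs_le_abs_of_nonneg hs.1 (hs.2.trans hθτ)
    calc Real.exp (β * |s|) * ‖(logCover y).1‖ ≤ Real.exp (β * |τ|) * ‖(logCover y).1‖ := by
          gcongr
      _ < Real.exp (β * |τ|) * Real.exp (min ℓ (E.ℓ₁ - β * |τ|)) := by gcongr
      _ ≤ Real.exp (β * |τ|) * Real.exp (E.ℓ₁ - β * |τ|) := by gcongr; exact min_le_right _ _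
      _ = Real.exp E.ℓ₁ := by rw [← Real.exp_add]; congr 1; ring
  have h1 := (hxf t ⟨by linarith [ht.1], ht.2⟩).1 hxt y' (by
    rw [hy', SaddleChart.chart_flow hxs (hstay t ht), hxc])
  linarith

/-- The shift along the orbits is bounded on a punctured tube. The lower bound is the upper bound for
the inverse equivalence. -/
theorem TubeLift.exists_shift_bound (T : TubeLift E) (T' : TubeLift E.symm)
    (hE : E.Represents H) (h : IsSectionEquiv B₁ B₂ H) (hγ₁ : IsPeriodicOrbit φ₁ γ₁)
    (hγ₂ : IsPeriodicOrbit φ₂ γ₂) (hlong : T.long = 1) (hmerid : T.merid = 1) (htwist : T.twist = 0)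
    {K : ℝ} (hK : ∀ᶠ x in 𝓝ˢ γ₁, x ∈ B₁.interior →
      ∀ y, logCover y = c₁.chart x → |(T.toFun y).2 - y.2| ≤ K) :
    ∃ ℓ ≤ E.ℓ₁, ∃ K', ∀ y ∈ logTube ℓ, |(T.toFun y).2 - y.2| ≤ K' := by
  obtain ⟨ℓ, hℓ, K₁, hK₁⟩ := T.exists_shift_le hγ₁
    (hK.mono fun x hx hxB y hy => (le_abs_self _).trans (hx hxB y hy))
  obtain ⟨r, hr, i, j, hij⟩ := T.exists_symm_comp T'
  have hK' : ∀ᶠ x in 𝓝ˢ γ₂, x ∈ B₂.interior →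
      ∀ y, logCover y = c₂.chart x → (T'.toFun y).2 - y.2 ≤ K + j := by
    have h1 := h.symm_map_section _ ((hK.and (c₁.eventually_norm_lt (Real.exp_pos r))))
    filter_upwards [h1, c₂.source_mem_nhdsSet, h.target_mem] with x hx hxs hxt hxB y hy
    obtain ⟨⟨hx1, hx2, hx3⟩, hx4⟩ := hx hxB
    have hxH : x ∈ H.target := hxt (B₂.notMem_of_mem_interior hxB)
    set x' := H.symm x with hx'
    have hx'γ : x' ∉ γ₁ := B₁.notMem_of_mem_interior hx4
    have hq0 : (c₁.chart x').1 ≠ 0 := by rwa [Ne, c₁.fst_eq_zero_iff hx2]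
    obtain ⟨z, hz⟩ := exists_logCover_eq hq0
    have hzr : z ∈ logTube r := by
      rw [← logCover_mem, hz]
      exact ⟨hq0, hx3⟩
    have hTz : logCover (T.toFun z) = c₂.chart x := by
      rw [T.lifts z (logTube_mono hr hzr), hE.toFun_eq, hz]
      simp only
      rw [c₁.chart.left_inv hx2, H.right_inv hxH]
    obtain ⟨k, l, rfl⟩ := logCover_eq_iff.1 (hy.trans hTz.symm)
    -- the point `y` is the image of a translate of `z`
    have hw := T.equivariant z (logTube_mono hr hzr) k l
    rw [hlong, hmerid, htwist, one_mul, one_mul, zero_mul, zero_add] at hw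
    have hzm : deck k l z ∈ logTube r := deck_mem.2 hzr
    have h2 := hx1 hx4 (deck k l z) ((logCover_deck _ _ _).trans hz)
    have h3 := (hij _ hzm).2
    rw [hw] at h2 h3
    rw [h3, deck_snd]
    linarith [(abs_le.1 h2).1]
  obtain ⟨ℓ', hℓ', K₂, hK₂⟩ := T'.exists_shift_le hγ₂ hK'
  obtain ⟨r', hr', htends⟩ := E.tends ℓ'
  refine ⟨min (min ℓ r) r', (min_le_left _ _).trans ((min_le_left _ _).trans hℓ),
    max K₁ (K₂ - j), fun y hy => ?_⟩
  have hyℓ := logTube_mono ((min_le_left _ _).trans (min_le_left _ _)) hy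
  have hyr := logTube_mono ((min_le_left _ _).trans (min_le_right _ _)) hy
  have hyr' := logTube_mono (min_le_right _ _) hy
  have h1 : T.toFun y ∈ logTube ℓ' := by
    rw [← logCover_mem, T.lifts y (logTube_mono hr hyr)]
    exact htends _ (logCover_mem.2 hyr')
  have h2 := hK₂ _ h1
  rw [(hij y hyr).2, deck_snd] at h2
  rw [abs_le]
  constructor
  · linarith [le_max_right K₁ (K₂ - j)]
  · exact (hK₁ y hyℓ).trans (le_max_left _ _)

end Shift

/-! ### The correction of the shift -/

theorem abs_log_norm_saddleFlow_sub_le {a b β : ℝ} (ha : |a| ≤ β) (hb : |b| ≤ β) (t : ℝ)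
    {q : ℂ × UnitAddCircle} (hq : q.1 ≠ 0) :
    |Real.log ‖(saddleFlow a b t q).1‖ - Real.log ‖q.1‖| ≤ β * |t| := by
  have key : ∀ (t : ℝ) (q : ℂ × UnitAddCircle), q.1 ≠ 0 →
      Real.log ‖(saddleFlow a b t q).1‖ ≤ β * |t| + Real.log ‖q.1‖ := fun t q hq => by
    have h1 : 0 < ‖(saddleFlow a b t q).1‖ := norm_pos_iff.2 ((saddleFlow_fst_eq_zero _ _).not.2 hq)
    have h2 := Real.log_le_log h1 (norm_saddleFlow_le a b ha hb t q)
    rwa [Real.log_mul (Real.exp_pos _).ne' (norm_pos_iff.2 hq).ne', Real.log_exp] at h2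
  have h1 := key t q hq
  have h2 := key (-t) _ ((saddleFlow_fst_eq_zero a b (t := t)).not.2 hq)
  rw [← (saddleFlow a b).map_add, neg_add_cancel, (saddleFlow a b).map_zero_apply, abs_neg] at h2
  exact abs_le.2 ⟨by linarith, by linarith⟩

theorem abs_div_one_add_sub_le {K ε g g' : ℝ} (hK : 0 ≤ K) (hε : 0 ≤ ε) (hg : 0 ≤ g) (hg' : 0 ≤ g') :
    |K / (1 + ε * g') - K / (1 + ε * g)| ≤ K * ε * |g - g'| := by
  have h1 : 1 ≤ 1 + ε * g := le_add_of_nonneg_right (mul_nonneg hε hg)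
  have h2 : 1 ≤ 1 + ε * g' := le_add_of_nonneg_right (mul_nonneg hε hg')
  have h3 : K / (1 + ε * g') - K / (1 + ε * g) =
      K * ε * (g - g') / ((1 + ε * g') * (1 + ε * g)) := by
    have : 1 + ε * g ≠ 0 := by positivity
    have : 1 + ε * g' ≠ 0 := by positivity
    field_simp
    ring
  rw [h3, abs_div, abs_mul, abs_of_nonneg (mul_nonneg hK hε),
    abs_of_nonneg (by positivity : (0 : ℝ) ≤ (1 + ε * g') * (1 + ε * g))]
  exact div_le_self (by positivity) (one_le_mul_of_one_le_of_one_le h2 h1)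

namespace TubeLift

variable {a₁ b₁ a₂ b₂ : ℝ} {E : PuncturedEquiv a₁ b₁ a₂ b₂}

/-- When the lift acts trivially on the homology, its shift along the longitude is a function on the
punctured tube. -/
theorem exists_shift (T : TubeLift E) (hlong : T.long = 1) (htwist : T.twist = 0) :
    ∃ w : ℂ × UnitAddCircle → ℝ, ContinuousOn w (puncturedTube E.ℓ₁) ∧
      ∀ y ∈ logTube E.ℓ₁, w (logCover y) = (T.toFun y).2 - y.2 := by
  have hex : ∀ q : ℂ × UnitAddCircle, ∃ y, q.1 ≠ 0 → logCover y = q := fun q => by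
    by_cases hq : q.1 = 0
    · exact ⟨0, fun h => (h hq).elim⟩
    · obtain ⟨y, hy⟩ := exists_logCover_eq hq
      exact ⟨y, fun _ => hy⟩
  choose Y hY using hex
  have hw : ∀ y ∈ logTube E.ℓ₁,
      (T.toFun (Y (logCover y))).2 - (Y (logCover y)).2 = (T.toFun y).2 - y.2 := by
    intro y hy
    obtain ⟨i, j, hij⟩ := logCover_eq_iff.1 (hY (logCover y) (Complex.exp_ne_zero _))
    rw [hij, T.equivariant y hy, deck_snd, deck_snd, hlong, htwist, zero_mul, zero_add, one_mul,
      add_sub_add_right_eq_sub]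
  refine ⟨fun q => (T.toFun (Y q)).2 - (Y q).2, fun q hq => ?_, hw⟩
  refine ContinuousAt.continuousWithinAt ?_
  obtain ⟨y, rfl⟩ := exists_logCover_eq hq.1
  have hy := logCover_mem.1 hq
  have hlog := (isOpen_logTube E.ℓ₁).mem_nhds hy
  have h1 : ContinuousAt (fun y => (T.toFun y).2 - y.2) y :=
    ((T.cont.continuousAt hlog).snd).sub continuousAt_snd
  rw [ContinuousAt, hw y hy]
  refine Tendsto.mono_left ?_ (isOpenMap_logCover.nhds_le y)
  rw [tendsto_map'_iff]
  refine h1.tendsto.congr' ?_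
  filter_upwards [hlog] with z hz using (hw z hz).symm

/-- A bounded shift can be modified near the periodic orbit to a shift that tends to `0`, in such a
way that the modified map still preserves the order on the orbits. -/
theorem exists_correction (T : TubeLift E) (hlong : T.long = 1) (htwist : T.twist = 0)
    (ha₂ : a₂ ≠ 0) (hb₂ : b₂ ≠ 0) {ℓ : ℝ} (hℓ : ℓ ≤ E.ℓ₁) {K : ℝ}
    (hK : ∀ y ∈ logTube ℓ, |(T.toFun y).2 - y.2| ≤ K) (ℓ' : ℝ) :
    ∃ D : ℂ × UnitAddCircle → ℝ, ContinuousOn D (puncturedTube ℓ) ∧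
      (∀ q ∈ puncturedTube ℓ, Real.exp ℓ' ≤ ‖q.1‖ → D q = 0) ∧
      (∀ q ∈ puncturedTube ℓ, |D q| ≤ 2 * K) ∧
      (∀ q, ∀ t > 0, (∀ s ∈ Icc 0 t, saddleFlow a₁ b₁ s q ∈ puncturedTube ℓ) →
        ∀ σ, E.toFun (saddleFlow a₁ b₁ t q) = saddleFlow a₂ b₂ σ (E.toFun q) →
          D q < σ + D (saddleFlow a₁ b₁ t q)) ∧
      ∃ ω : ℂ × UnitAddCircle → ℝ,
        (∀ q ∈ puncturedTube ℓ, (E.toFun q).2 + ((D q : ℝ) : UnitAddCircle) =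
          q.2 + ((ω q : ℝ) : UnitAddCircle)) ∧
        ∀ δ > 0, ∃ r ≤ ℓ, ∀ q ∈ puncturedTube r, |ω q| < δ := by
  obtain ⟨w, hwc, hw⟩ := T.exists_shift hlong htwist
  have hwK : ∀ q ∈ puncturedTube ℓ, |w q| ≤ K := fun q hq => by
    obtain ⟨y, rfl⟩ := exists_logCover_eq hq.1
    have hy := logCover_mem.1 hq
    rw [hw y (logTube_mono hℓ hy)]
    exact hK y hy
  have hK0 : 0 ≤ K := (abs_nonneg _).trans (hK ((⟨ℓ - 1, 0⟩ : ℂ), (0 : ℝ)) (by simp [logTube]))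
  set β := max |a₁| |b₁| with hβ
  have hβ0 : 0 ≤ β := le_max_of_le_left (abs_nonneg _)
  -- with this `ε`, the level `C` below changes by less than `t` on an orbit segment of model length `t`
  set ε := 1 / (2 * (K + 1) * (β + 1)) with hε
  have hε0 : 0 < ε := by positivity
  -- the modified shift is the truncation of `w` at level `C`
  set g : ℂ × UnitAddCircle → ℝ := fun q => max 0 (ℓ' - Real.log ‖q.1‖) with hg
  have hg0 : ∀ q, 0 ≤ g q := fun q => le_max_left _ _
  set C : ℂ × UnitAddCircle → ℝ := fun q => K / (1 + ε * g q) with hC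
  have hden : ∀ q, 1 ≤ 1 + ε * g q := fun q => le_add_of_nonneg_right (mul_nonneg hε0.le (hg0 q))
  have hC0 : ∀ q, 0 ≤ C q := fun q => div_nonneg hK0 (zero_le_one.trans (hden q))
  have hCK : ∀ q, C q ≤ K := fun q => div_le_self hK0 (hden q)
  set ω : ℂ × UnitAddCircle → ℝ := fun q => max (min (w q) (C q)) (-C q) with hω
  have hωC : ∀ q, |ω q| ≤ C q := fun q => abs_le.2 ⟨le_max_right _ _,
    max_le (min_le_right _ _) (by linarith [hC0 q])⟩
  have hgc : ContinuousOn g (puncturedTube ℓ) := continuousOn_const.sup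
    (continuousOn_const.sub ((continuous_fst.norm.continuousOn).log fun q hq =>
      (norm_pos_iff.2 hq.1).ne'))
  have hCc : ContinuousOn C (puncturedTube ℓ) := continuousOn_const.div
    (continuousOn_const.add (continuousOn_const.mul hgc)) fun q _ => by linarith [hden q]
  have hwc' := hwc.mono (puncturedTube_mono hℓ)
  refine ⟨fun q => ω q - w q, ((hwc'.inf hCc).sup hCc.neg).sub hwc', fun q hq hqℓ => ?_,
    fun q hq => ?_, fun q t ht hflow σ hσ => ?_, ω, fun q hq => ?_, fun δ hδ => ?_⟩
  · have h1 : g q = 0 := max_eq_left (by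
      have := (Real.le_log_iff_exp_le (norm_pos_iff.2 hq.1)).2 hqℓ
      linarith)
    have h2 : C q = K := by simp [C, h1]
    have h3 := abs_le.1 (hwK q hq)
    simp only [ω]
    rw [h2, min_eq_left h3.2, max_eq_left h3.1, sub_self]
  · have h1 := hωC q
    have h2 := hwK q hq
    refine (abs_sub _ _).trans ?_
    linarith [hCK q]
  · have hq : q ∈ puncturedTube ℓ := by
      simpa only [(saddleFlow a₁ b₁).map_zero_apply] using hflow 0 ⟨le_rfl, ht.le⟩
    set q' := saddleFlow a₁ b₁ t q with hq'
    obtain ⟨y, rfl⟩ := exists_logCover_eq hq.1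
    have hy := logTube_mono hℓ (logCover_mem.1 hq)
    obtain ⟨σ', -, hσ'0, hσ', y', hy', hy'2, hTy'⟩ := T.exists_flow_lift (y := y) ht.le
      fun s hs => puncturedTube_mono hℓ (hflow s hs)
    have hσσ : σ' = σ := saddleFlow_injective a₂ b₂ ha₂ hb₂ (E.ne_zero _ (puncturedTube_mono hℓ hq))
      (hσ'.symm.trans hσ)
    have hy'm : y' ∈ logTube E.ℓ₁ := by
      rw [← logCover_mem, hy']
      exact puncturedTube_mono hℓ (hflow t ⟨ht.le, le_rfl⟩)
    have hww : w q' = w (logCover y) + σ - t := by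
      rw [hq', ← hy', hw y hy, hw y' hy'm, hTy', hy'2, hσσ]
      ring
    have hσ0 : 0 < σ := hσσ ▸ hσ'0 ht
    have hCC : |C q' - C (logCover y)| < t := by
      have h1 := abs_log_norm_saddleFlow_sub_le (β := β) (le_max_left |a₁| |b₁|)
        (le_max_right |a₁| |b₁|) t hq.1
      have h2 : |g (logCover y) - g q'| ≤ β * t := by
        simp only [g]
        rw [max_comm 0, max_comm 0]
        refine (abs_max_sub_max_le_abs _ _ _).trans ?_
        rw [abs_of_pos ht] at h1
        rwa [sub_sub_sub_cancel_left]
      refine (abs_div_one_add_sub_le hK0 hε0.le (hg0 _) (hg0 _)).trans_lt ?_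
      have h3 : K * ε * β ≤ 1 / 2 := by
        have : K * ε * β = (K / (K + 1)) * (β / (β + 1)) * (1 / 2) := by
          rw [hε]; field_simp
        rw [this]
        have h4 : K / (K + 1) ≤ 1 := (div_le_one (by linarith)).2 (by linarith)
        have h5 : β / (β + 1) ≤ 1 := (div_le_one (by linarith)).2 (by linarith)
        have h6 : 0 ≤ β / (β + 1) := by positivity
        nlinarith [mul_le_one₀ h4 h6 h5]
      have h7 : K * ε * |g (logCover y) - g q'| ≤ K * ε * (β * t) :=
        mul_le_mul_of_nonneg_left h2 (by positivity)
      nlinarith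
    rw [abs_lt] at hCC
    have hωω : ω (logCover y) - t < ω q' := by
      simp only [ω]
      rw [← max_sub_sub_right, ← min_sub_sub_right]
      refine max_lt_max (min_lt_min ?_ ?_) ?_ <;> linarith
    simp only
    linarith
  · obtain ⟨y, rfl⟩ := exists_logCover_eq hq.1
    have hy := logTube_mono hℓ (logCover_mem.1 hq)
    rw [← T.lifts y hy]
    simp only [logCover]
    rw [← AddCircle.coe_add, ← AddCircle.coe_add]
    congr 1
    have := hw y hy
    simp only [logCover] at this
    rw [this]
    ring
  · refine ⟨min ℓ (ℓ' - K / (ε * δ)), min_le_left _ _, fun q hq => (hωC q).trans_lt ?_⟩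
    have h1 : Real.log ‖q.1‖ < ℓ' - K / (ε * δ) := by
      rw [Real.log_lt_iff_lt_exp (norm_pos_iff.2 hq.1)]
      exact hq.2.trans_le (Real.exp_le_exp.2 (min_le_right _ _))
    have h2 : K / (ε * δ) < g q := lt_max_of_lt_right (by linarith)
    rw [div_lt_iff₀ (by positivity)] at h2
    rw [div_lt_iff₀ (by linarith [hden q])]
    nlinarith

end TubeLift

namespace SaddleChart

variable {M : Type*} [TopologicalSpace M] {φ : Flow ℝ M} {γ : Set M}

/-- Near the periodic orbit, the model times in a given interval are reached in bounded time. -/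
theorem exists_clock_bound (c : SaddleChart φ γ) (hγ : IsPeriodicOrbit φ γ) (κ : ℝ) :
    ∃ T > 0, ∀ᶠ x in 𝓝ˢ γ, κ < c.clock x T ∧ c.clock x (-T) < -κ := by
  have hstay : ∀ x ∈ γ, stayTimes φ c.chart.source x = univ := fun x hx =>
    stayTimes_univ_of_invariant fun s => c.subset_source (hγ.flow_mem hx s)
  have hmono : ∀ x ∈ γ, StrictMono (c.clock x) := fun x hx => by
    have := strictMonoOn_clock (c.subset_source hx)
    rwa [hstay x hx, strictMonoOn_univ] at this
  have hsurj : ∀ x ∈ γ, Function.Surjective (c.clock x) := fun x hx => by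
    have := image_clock (c.subset_source hx)
    rw [hstay x hx, stayTimes_univ_of_invariant fun t => c.mem_target_of_fst_eq_zero
      ((saddleFlow_fst_eq_zero _ _).2 ((c.fst_eq_zero_iff (c.subset_source hx)).2 hx)),
      image_univ] at this
    exact range_eq_univ.1 this
  have key : ∃ T₀, ∀ T ≥ T₀, ∀ x ∈ γ, κ < c.clock x T ∧ c.clock x (-T) < -κ := by
    refine c.isCompact_orbit.induction_on (p := fun s => ∃ T₀, ∀ T ≥ T₀, ∀ x ∈ γ, x ∈ s →
      κ < c.clock x T ∧ c.clock x (-T) < -κ) ?_ ?_ ?_ ?_ |>.imp fun T₀ h T hT x hx => h T hT x hx hx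
    · exact ⟨0, fun T _ x _ hx => hx.elim⟩
    · rintro s t hst ⟨T₀, h⟩
      exact ⟨T₀, fun T hT x hx hxs => h T hT x hx (hst hxs)⟩
    · rintro s t ⟨T₀, h⟩ ⟨T₁, h'⟩
      refine ⟨max T₀ T₁, fun T hT x hx hxs => ?_⟩
      rcases hxs with hxs | hxs
      · exact h T ((le_max_left _ _).trans hT) x hx hxs
      · exact h' T ((le_max_right _ _).trans hT) x hx hxs
    · intro x hx
      obtain ⟨t, ht⟩ := hsurj x hx (κ + 1)
      obtain ⟨t', ht'⟩ := hsurj x hx (-κ - 1)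
      have hc : ∀ t, ContinuousAt (fun y => c.clock y t) x := fun t =>
        continuousAt_clock (by rw [hstay x hx]; exact mem_univ _)
      have h1 : ∀ᶠ y in 𝓝 x, κ < c.clock y t :=
        continuousAt_const.eventually_lt (hc t) (by rw [ht]; linarith)
      have h2 : ∀ᶠ y in 𝓝 x, c.clock y t' < -κ :=
        (hc t').eventually_lt continuousAt_const (by rw [ht']; linarith)
      refine ⟨{y | κ < c.clock y t ∧ c.clock y t' < -κ}, mem_nhdsWithin_of_mem_nhds (h1.and h2),
        max t (-t'), fun T hT y hy hyt => ⟨hyt.1.trans_le ?_, lt_of_le_of_lt ?_ hyt.2⟩⟩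
      · exact (hmono y hy).monotone ((le_max_left _ _).trans hT)
      · exact (hmono y hy).monotone (by linarith [(le_max_right t (-t')).trans hT])
  obtain ⟨T₀, hT₀⟩ := key
  refine ⟨max T₀ 1, by positivity, eventually_nhdsSet_iff_forall.2 fun x hx => ?_⟩
  have hc : ∀ t, ContinuousAt (fun y => c.clock y t) x := fun t =>
    continuousAt_clock (by rw [hstay x hx]; exact mem_univ _)
  obtain ⟨h1, h2⟩ := hT₀ _ (le_max_left T₀ 1) x hx
  exact (continuousAt_const.eventually_lt (hc _) h1).and ((hc _).eventually_lt continuousAt_const h2)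

/-- The point `x` stays in the chart during the time interval `[-T, T]`, which is long enough for the
model times in `[-κ, κ]`. -/
def HasWindow (c : SaddleChart φ γ) (κ T : ℝ) (x : M) : Prop :=
  (∀ t ∈ Icc (-T) T, φ t x ∈ c.chart.source) ∧ κ < c.clock x T ∧ c.clock x (-T) < -κ

variable {c : SaddleChart φ γ} {κ T : ℝ} {x : M}

theorem HasWindow.mem_stayTimes (h : c.HasWindow κ T x) {t : ℝ} (ht : t ∈ Icc (-T) T) :
    t ∈ stayTimes φ c.chart.source x := fun s hs => by
  refine h.1 s ?_
  have h0 : (0 : ℝ) ∈ Icc (-T) T := by constructor <;> linarith [ht.1, ht.2]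
  exact (ordConnected_Icc.uIcc_subset h0 ht) hs

theorem HasWindow.exists_clock_eq (h : c.HasWindow κ T x) (hT : 0 < T) {τ : ℝ} (hτ : |τ| ≤ κ) :
    ∃ u ∈ Ioo (-T) T, c.clock x u = τ := by
  have hs : x ∈ c.chart.source := by simpa using h.1 0 ⟨by linarith, hT.le⟩
  have hτ' := abs_le.1 hτ
  have hc : ContinuousOn (c.clock x) (Icc (-T) T) :=
    (continuousOn_clock hs).mono fun t ht => h.mem_stayTimes ht
  obtain ⟨u, hu, huτ⟩ := intermediate_value_Ioo (by linarith : -T ≤ T) hc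
    (show τ ∈ _ from ⟨by linarith [h.2.2], by linarith [h.2.1]⟩)
  exact ⟨u, hu, huτ⟩

/-- The time that corresponds to a given model time depends continuously on the point. -/
theorem continuousAt_of_clock_eq {u v : M → ℝ} (hT : 0 < T) (hx : ∀ᶠ y in 𝓝 x, c.HasWindow κ T y ∧
    u y ∈ Ioo (-T) T ∧ c.clock y (u y) = v y) (hv : ContinuousAt v x) : ContinuousAt u x := by
  obtain ⟨hxw, hxu, hxv⟩ := hx.self_of_nhds
  have hmono : ∀ y, c.HasWindow κ T y → StrictMonoOn (c.clock y) (Icc (-T) T) := fun y hy =>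
    (strictMonoOn_clock (by simpa using hy.1 0 ⟨by linarith, hT.le⟩)).mono
      fun t ht => hy.mem_stayTimes ht
  have hxu' := Ioo_subset_Icc_self hxu
  refine tendsto_order.2 ⟨fun l hl => ?_, fun l hl => ?_⟩
  · obtain ⟨a, ha, ha'⟩ := exists_between (max_lt hl hxu.1)
    have haI : a ∈ Icc (-T) T := ⟨((le_max_right _ _).trans_lt ha).le, ha'.le.trans hxu.2.le⟩
    have h1 := (continuousAt_clock (hxw.mem_stayTimes haI)).eventually_lt hv
      (by rw [← hxv]; exact hmono x hxw haI hxu' ha')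
    filter_upwards [h1, hx] with y hy1 hy2
    rw [← hy2.2.2] at hy1
    exact ((le_max_left _ _).trans_lt ha).trans
      (((hmono y hy2.1).lt_iff_lt haI (Ioo_subset_Icc_self hy2.2.1)).1 hy1)
  · obtain ⟨a, ha, ha'⟩ := exists_between (lt_min hl hxu.2)
    have haI : a ∈ Icc (-T) T := ⟨hxu.1.le.trans ha.le, (ha'.trans_le (min_le_right _ _)).le⟩
    have h1 := hv.eventually_lt (continuousAt_clock (hxw.mem_stayTimes haI))
      (by rw [← hxv]; exact hmono x hxw hxu' haI ha)
    filter_upwards [h1, hx] with y hy1 hy2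
    rw [← hy2.2.2] at hy1
    exact (((hmono y hy2.1).lt_iff_lt (Ioo_subset_Icc_self hy2.2.1) haI).1 hy1).trans
      (ha'.trans_le (min_le_left _ _))

end SaddleChart

/-! ### The time change -/

section TubeImage

variable {M₁ M₂ : Type*} [TopologicalSpace M₁] [TopologicalSpace M₂]
  {φ₁ : Flow ℝ M₁} {φ₂ : Flow ℝ M₂} {γ₁ : Set M₁} {γ₂ : Set M₂}
  {c₁ : SaddleChart φ₁ γ₁} {c₂ : SaddleChart φ₂ γ₂}
  {H : OpenPartialHomeomorph M₁ M₂} {E : PuncturedEquiv c₁.a c₁.b c₂.a c₂.b}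

/-- The image under `H` of the punctured tube of radius `exp ℓ`. -/
def tubeImage (c₁ : SaddleChart φ₁ γ₁) (H : OpenPartialHomeomorph M₁ M₂) (ℓ : ℝ) : Set M₂ :=
  {y | y ∈ H.target ∧ H.symm y ∈ c₁.chart.source ∧ c₁.chart (H.symm y) ∈ puncturedTube ℓ}

theorem isOpen_tubeImage (c₁ : SaddleChart φ₁ γ₁) (H : OpenPartialHomeomorph M₁ M₂) (ℓ : ℝ) :
    IsOpen (tubeImage c₁ H ℓ) :=
  H.symm.isOpen_inter_preimage (c₁.chart.isOpen_inter_preimage (isOpen_puncturedTube ℓ))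

theorem continuousOn_tubeImage (c₁ : SaddleChart φ₁ γ₁) (H : OpenPartialHomeomorph M₁ M₂) (ℓ : ℝ) :
    ContinuousOn (fun y => c₁.chart (H.symm y)) (tubeImage c₁ H ℓ) :=
  c₁.chart.continuousOn.comp (H.symm.continuousOn.mono fun _ hy => hy.1) fun _ hy => hy.2.1

namespace PuncturedEquiv.Represents

theorem image_mem (hE : E.Represents H) {ℓ : ℝ} (hℓ : ℓ ≤ E.ℓ₁) {q : ℂ × UnitAddCircle}
    (hq : q ∈ puncturedTube ℓ) : H (c₁.chart.symm q) ∈ tubeImage c₁ H ℓ ∧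
      c₁.chart (H.symm (H (c₁.chart.symm q))) = q := by
  obtain ⟨h1, h2, h3⟩ := hE.mem q (puncturedTube_mono hℓ hq)
  have h4 : c₁.chart (H.symm (H (c₁.chart.symm q))) = q := by
    rw [H.left_inv h2, c₁.chart.right_inv h1]
  refine ⟨⟨H.map_source h2, ?_, ?_⟩, h4⟩
  · rw [H.left_inv h2]
    exact c₁.chart.map_target h1
  · rwa [h4]

theorem chart_eq (hE : E.Represents H) {ℓ : ℝ} (hℓ : ℓ ≤ E.ℓ₁) {y : M₂}
    (hy : y ∈ tubeImage c₁ H ℓ) :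
    y ∈ c₂.chart.source ∧ c₂.chart y = E.toFun (c₁.chart (H.symm y)) := by
  have h1 : H (c₁.chart.symm (c₁.chart (H.symm y))) = y := by
    rw [c₁.chart.left_inv hy.2.1, H.right_inv hy.1]
  refine ⟨?_, ?_⟩
  · rw [← h1]
    exact (hE.mem _ (puncturedTube_mono hℓ hy.2.2)).2.2
  · rw [hE.toFun_eq]
    simp only [h1]

theorem eventually_mem (hE : E.Represents H) {O : Set M₂} (hO : O ∈ 𝓝ˢ γ₂) :
    ∃ r ≤ E.ℓ₁, tubeImage c₁ H r ⊆ O := by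
  obtain ⟨ε, hε, hεO⟩ := c₂.exists_tube_subset hO
  obtain ⟨r, hr, hrE⟩ := E.tends (Real.log ε)
  refine ⟨r, hr, fun y hy => ?_⟩
  obtain ⟨h1, h2⟩ := hE.chart_eq hr hy
  have h3 := (hrE _ hy.2.2).2
  rw [← h2, Real.exp_log hε] at h3
  rw [← c₂.chart.left_inv h1]
  exact (hεO _ h3).2

theorem eventually_tubeImage (hE : E.Represents H) {ℓ : ℝ} (hℓ : ℓ ≤ E.ℓ₁) :
    ∀ᶠ x in 𝓝ˢ γ₁, x ∉ γ₁ → x ∈ H.source ∧ x ∈ c₁.chart.source ∧ c₁.chart x ∈ puncturedTube ℓ ∧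
      H x ∈ tubeImage c₁ H ℓ := by
  filter_upwards [c₁.eventually_norm_lt (Real.exp_pos ℓ)] with x hx hxγ
  have hq : c₁.chart x ∈ puncturedTube ℓ := ⟨(c₁.fst_eq_zero_iff hx.1).not.2 hxγ, hx.2⟩
  have h1 := hE.mem _ (puncturedTube_mono hℓ hq)
  have h2 := (hE.image_mem hℓ hq).1
  rw [c₁.chart.left_inv hx.1] at h1 h2
  exact ⟨h1.2.1, hx.1, hq, h2⟩

/-- The image of a closed punctured tube is closed, once the periodic orbit is added. -/
theorem isClosed_union_image [T2Space M₂] (hE : E.Represents H) {ℓ : ℝ} (hℓ : ℓ ≤ E.ℓ₁) {ℓ' : ℝ}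
    (hℓ' : ℓ' < ℓ) :
    IsClosed (γ₂ ∪ {y | y ∈ tubeImage c₁ H ℓ ∧ ‖(c₁.chart (H.symm y)).1‖ ≤ Real.exp ℓ'}) := by
  rw [← isOpen_compl_iff, isOpen_iff_mem_nhds]
  intro y hy
  simp only [mem_compl_iff, mem_union, not_or] at hy
  -- separate `y` from the periodic orbit, and use compactness away from it
  obtain ⟨O, O', hO, hO', hγO, hyO', hdisj⟩ := SeparatedNhds.of_isCompact_isCompact
    c₂.isCompact_orbit (isCompact_singleton (x := y)) (disjoint_singleton_right.2 hy.1)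
  obtain ⟨r, hr, hrO⟩ := hE.eventually_mem (hO.mem_nhdsSet.2 hγO)
  set C : Set (ℂ × UnitAddCircle) := {q | Real.exp r ≤ ‖q.1‖ ∧ ‖q.1‖ ≤ Real.exp ℓ'} with hC
  have hCt : C ⊆ puncturedTube ℓ := fun q hq =>
    ⟨norm_pos_iff.1 ((Real.exp_pos r).trans_le hq.1), hq.2.trans_lt (Real.exp_lt_exp.2 hℓ')⟩
  have hCc : IsCompact C := by
    refine ((isCompact_closedBall (0 : ℂ) (Real.exp ℓ')).prod isCompact_univ).of_isClosed_subset
      ((isClosed_le continuous_const continuous_fst.norm).inter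
        (isClosed_le continuous_fst.norm continuous_const)) fun q hq => ⟨?_, mem_univ _⟩
    simpa using hq.2
  have hcont : ContinuousOn (fun q => H (c₁.chart.symm q)) C :=
    H.continuousOn.comp (c₁.chart.symm.continuousOn.mono fun q hq =>
      (hE.mem q (puncturedTube_mono hℓ (hCt hq))).1) fun q hq =>
      (hE.mem q (puncturedTube_mono hℓ (hCt hq))).2.1
  have hcl := (hCc.image_of_continuousOn hcont).isClosed
  have hyC : y ∉ (fun q => H (c₁.chart.symm q)) '' C := by
    rintro ⟨q, hq, rfl⟩
    obtain ⟨h1, h2⟩ := hE.image_mem hℓ (hCt hq)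
    refine hy.2 ⟨h1, ?_⟩
    rw [h2]
    exact hq.2
  filter_upwards [hO'.mem_nhds (hyO' rfl), hcl.isOpen_compl.mem_nhds hyC] with z hz1 hz2
  have hzO : z ∉ O := fun h => hdisj.notMem_of_mem_left h hz1
  rintro (hz | ⟨hz, hzn⟩)
  · exact hzO (hγO hz)
  · rcases lt_or_ge ‖(c₁.chart (H.symm z)).1‖ (Real.exp r) with h | h
    · exact hzO (hrO ⟨hz.1, hz.2.1, hz.2.2.1, h⟩)
    · refine hz2 ⟨_, ⟨h, hzn⟩, ?_⟩
      simp only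
      rw [c₁.chart.left_inv hz.2.1, H.right_inv hz.1]

/-- A correction of the shift, given in the models, is realised by a time change on the complement of
the periodic orbit. -/
theorem exists_timeShift [T2Space M₂] (hE : E.Represents H) (hγ₂ : IsPeriodicOrbit φ₂ γ₂)
    (htgt : ∀ y ∈ H.target, y ∉ γ₂) (hH : IsLocalOrbitalEquivalence φ₁ φ₂ H)
    {ℓ : ℝ} (hℓ : ℓ ≤ E.ℓ₁) {ℓ' : ℝ} (hℓ' : ℓ' < ℓ)
    {κ T : ℝ} (hT : 0 < T) (hwin : ∀ y ∈ tubeImage c₁ H ℓ, c₂.HasWindow κ T y)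
    {D : ℂ × UnitAddCircle → ℝ} (hDc : ContinuousOn D (puncturedTube ℓ))
    (hD0 : ∀ q ∈ puncturedTube ℓ, Real.exp ℓ' ≤ ‖q.1‖ → D q = 0)
    (hDκ : ∀ q ∈ puncturedTube ℓ, |D q| ≤ κ)
    (hDmono : ∀ q, ∀ t > 0, (∀ s ∈ Icc 0 t, saddleFlow c₁.a c₁.b s q ∈ puncturedTube ℓ) →
      ∀ σ, E.toFun (saddleFlow c₁.a c₁.b t q) = saddleFlow c₂.a c₂.b σ (E.toFun q) →
        D q < σ + D (saddleFlow c₁.a c₁.b t q)) :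
    ∃ u : M₂ → ℝ, ContinuousOn u γ₂ᶜ ∧ (∀ y, |u y| ≤ T) ∧
      (∀ y ∈ γ₂ᶜ, StrictMono fun s => s + u (φ₂ s y)) ∧
      (∀ y ∈ tubeImage c₁ H ℓ, c₂.clock y (u y) = D (c₁.chart (H.symm y))) ∧
      ∀ y ∉ tubeImage c₁ H ℓ, u y = 0 := by
  set Ω := tubeImage c₁ H ℓ with hΩ
  set Q : M₂ → ℂ × UnitAddCircle := fun y => c₁.chart (H.symm y) with hQ
  have hΩo : IsOpen Ω := isOpen_tubeImage c₁ H ℓ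
  have hΩγ : ∀ y ∈ Ω, y ∉ γ₂ := fun y hy => htgt y hy.1
  have hex : ∀ y, ∃ u ∈ Ioo (-T) T, (y ∈ Ω → c₂.clock y u = D (Q y)) ∧ (y ∉ Ω → u = 0) := by
    intro y
    by_cases hy : y ∈ Ω
    · obtain ⟨u, hu, huτ⟩ := (hwin y hy).exists_clock_eq hT (hDκ _ hy.2.2)
      exact ⟨u, hu, fun _ => huτ, fun h => (h hy).elim⟩
    · exact ⟨0, ⟨by linarith, hT⟩, fun h => (hy h).elim, fun _ => rfl⟩
  choose u huT huΩ hu0 using hex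
  set F : Set M₂ := γ₂ ∪ {y | y ∈ Ω ∧ ‖(Q y).1‖ ≤ Real.exp ℓ'} with hF
  have hFc : IsClosed F := hE.isClosed_union_image hℓ hℓ'
  have hmonoclock : ∀ y ∈ Ω, StrictMonoOn (c₂.clock y) (stayTimes φ₂ c₂.chart.source y) :=
    fun y hy => SaddleChart.strictMonoOn_clock (hE.chart_eq hℓ hy).1
  have huF : ∀ y ∉ F, u y = 0 := by
    intro y hy
    by_cases hyΩ : y ∈ Ω
    · have h1 : Real.exp ℓ' ≤ ‖(Q y).1‖ := (not_le.1 fun h => hy (Or.inr ⟨hyΩ, h⟩)).le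
      have h2 := huΩ y hyΩ
      rw [hD0 _ hyΩ.2.2 h1, ← SaddleChart.clock_zero (hE.chart_eq hℓ hyΩ).1] at h2
      exact (hmonoclock y hyΩ).injOn ((hwin y hyΩ).mem_stayTimes (Ioo_subset_Icc_self (huT y)))
        (zero_mem_stayTimes (hE.chart_eq hℓ hyΩ).1) h2
    · exact hu0 y hyΩ
  refine ⟨u, fun y hy => ContinuousAt.continuousWithinAt ?_, fun y => (abs_lt.2 (huT y)).le,
    fun y hy => ?_, huΩ, hu0⟩
  · by_cases hyF : y ∈ F
    · have hyΩ : y ∈ Ω := (hyF.resolve_left hy).1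
      refine SaddleChart.continuousAt_of_clock_eq (c := c₂) (κ := κ) (v := fun y => D (Q y)) hT ?_ ?_
      · filter_upwards [hΩo.mem_nhds hyΩ] with z hz using ⟨hwin z hz, huT z, huΩ z hz⟩
      · exact (hDc.comp (continuousOn_tubeImage c₁ H ℓ) fun z hz => hz.2.2).continuousAt
          (hΩo.mem_nhds hyΩ)
    · refine (continuousAt_const (y := (0 : ℝ))).congr ?_
      filter_upwards [hFc.isOpen_compl.mem_nhds hyF] with z hz using (huF z hz).symm
  · refine strictMono_of_local fun s₀ => ?_
    have hφc : Continuous fun s => φ₂ s y := φ₂.continuous continuous_id continuous_const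
    by_cases hyF : φ₂ s₀ y ∈ F
    · have hyΩ : φ₂ s₀ y ∈ Ω := (hyF.resolve_left (hγ₂.flow_mem_iff.not.2 hy)).1
      obtain ⟨ε, hε, hεΩ⟩ := Metric.eventually_nhds_iff.1
        (hφc.continuousAt.eventually (hΩo.mem_nhds hyΩ))
      refine ⟨ε, hε, fun s hs s' hs' hss => ?_⟩
      have hmem : ∀ r ∈ Icc s s', φ₂ r y ∈ Ω := fun r hr => hεΩ (by
        rw [Real.dist_eq, abs_lt]
        constructor <;> linarith [hr.1, hr.2, hs.1, hs'.2])
      -- follow the orbit of `φ₂ s y` for the time `s' - s`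
      set x := φ₂ s y with hx
      have hadd : ∀ r, φ₂ r x = φ₂ (s + r) y := fun r => by rw [hx, ← φ₂.map_add, add_comm]
      have hx' : φ₂ (s' - s) x = φ₂ s' y := by rw [hadd]; congr 1; ring
      have hxΩ : ∀ r ∈ Icc 0 (s' - s), φ₂ r x ∈ Ω := fun r hr => by
        rw [hadd]
        exact hmem _ ⟨by linarith [hr.1], by linarith [hr.2]⟩
      have hd : 0 < s' - s := sub_pos.2 hss
      have hx0 : x ∈ Ω := hmem s ⟨le_rfl, hss.le⟩
      have hx'Ω : φ₂ (s' - s) x ∈ Ω := hxΩ _ ⟨hd.le, le_rfl⟩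
      obtain ⟨hxs, hxc⟩ := hE.chart_eq hℓ hx0
      have hcar : CarriesOrbits φ₂ (saddleFlow c₁.a c₁.b) Q Ω :=
        c₁.orbital.carriesOrbits.comp (hH.symm.carriesOrbits.mono (S' := Ω) fun z hz => hz.1)
          fun z hz => hz.2.1
      obtain ⟨σ, hσ0, hσc, hσm, hσ⟩ := hcar x (s' - s) hd.le hxΩ
      have hσpos : 0 < σ (s' - s) := hσ0 ▸ hσm ⟨le_rfl, hd.le⟩ ⟨hd.le, le_rfl⟩ hd
      have hstay : s' - s ∈ stayTimes φ₂ c₂.chart.source x :=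
        Icc_subset_stayTimes hd.le fun r hr => (hE.chart_eq hℓ (hxΩ r hr)).1
      have hkey : D (Q x) < c₂.clock x (s' - s) + D (Q (φ₂ (s' - s) x)) := by
        have h1 := hσ (s' - s) ⟨hd.le, le_rfl⟩
        rw [h1]
        refine hDmono (Q x) (σ (s' - s)) hσpos (fun r hr => ?_) _ ?_
        · obtain ⟨r', hr', rfl⟩ := intermediate_value_Icc hd.le hσc
            (show r ∈ _ by rw [hσ0]; exact hr)
          rw [← hσ r' hr']
          exact (hxΩ r' hr').2.2
        · rw [← h1, ← (hE.chart_eq hℓ hx'Ω).2, SaddleChart.chart_flow hxs hstay, hxc]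
      have hus := (hwin x hx0).mem_stayTimes (Ioo_subset_Icc_self (huT x))
      have hus' := (hwin _ hx'Ω).mem_stayTimes (Ioo_subset_Icc_self (huT (φ₂ (s' - s) x)))
      rw [← huΩ x hx0, ← huΩ _ hx'Ω, ← SaddleChart.clock_add hxs (hΩγ x hx0) hstay hus'] at hkey
      have hlt := ((hmonoclock x hx0).lt_iff_lt hus (add_mem_stayTimes hstay hus')).1 hkey
      simp only
      rw [← hx']
      linarith
    · obtain ⟨ε, hε, hεF⟩ := Metric.eventually_nhds_iff.1
        (hφc.continuousAt.eventually (hFc.isOpen_compl.mem_nhds hyF))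
      refine ⟨ε, hε, fun s hs s' hs' hss => ?_⟩
      have h0 : ∀ r ∈ Ioo (s₀ - ε) (s₀ + ε), u (φ₂ r y) = 0 := fun r hr =>
        huF _ (hεF (by rw [Real.dist_eq, abs_lt]; constructor <;> linarith [hr.1, hr.2]))
      simp only [h0 s hs, h0 s' hs', add_zero]
      exact hss

end PuncturedEquiv.Represents

/-- A map between neighbourhoods of two periodic orbits is continuous at the points of the first one
if, in the charts, it sends small tubes to small tubes and nearly preserves the longitudinal
coordinate. -/
theorem SaddleChart.continuousAt_of_near {f : M₁ → M₂} (hf : ∀ δ > 0, ∀ᶠ x in 𝓝ˢ γ₁,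
      f x ∈ c₂.chart.source ∧ ‖(c₂.chart (f x)).1‖ < δ ∧ ∃ w : ℝ, |w| < δ ∧
        (c₂.chart (f x)).2 = (c₁.chart x).2 + (w : UnitAddCircle)) {x : M₁} (hx : x ∈ γ₁)
    (hfx : f x = c₂.chart.symm (0, (c₁.chart x).2)) : ContinuousAt f x := by
  have hf' := fun δ hδ => eventually_nhdsSet_iff_forall.1 (hf δ hδ) x hx
  have h1 : Tendsto (fun y => (c₂.chart (f y)).1) (𝓝 x) (𝓝 0) := by
    rw [Metric.tendsto_nhds]
    intro δ hδ
    filter_upwards [hf' δ hδ] with y hy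
    rw [dist_zero_right]
    exact hy.2.1
  have h2 : Tendsto (fun y => (c₂.chart (f y)).2) (𝓝 x) (𝓝 (c₁.chart x).2) := by
    rw [Metric.tendsto_nhds]
    intro δ hδ
    have h3 : ContinuousAt (fun y => (c₁.chart y).2) x :=
      (c₁.chart.continuousAt (c₁.subset_source hx)).snd
    filter_upwards [hf' (δ / 2) (half_pos hδ),
      h3.eventually (Metric.ball_mem_nhds _ (half_pos hδ))] with y hy hy2
    obtain ⟨-, -, w, hw, hyw⟩ := hy
    rw [hyw]
    refine (dist_triangle _ (c₁.chart y).2 _).trans_lt ?_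
    have h4 : dist ((c₁.chart y).2 + (w : UnitAddCircle)) (c₁.chart y).2 ≤ |w| := by
      rw [dist_eq_norm, add_sub_cancel_left]
      exact QuotientAddGroup.norm_mk_le_norm
    have h5 : dist (c₁.chart y).2 (c₁.chart x).2 < δ / 2 := hy2
    linarith
  have h3 : ContinuousAt c₂.chart.symm ((0 : ℂ), (c₁.chart x).2) :=
    c₂.chart.continuousAt_symm (c₂.mem_target_of_fst_eq_zero rfl)
  rw [ContinuousAt, hfx]
  refine (h3.tendsto.comp (h1.prodMk_nhds h2)).congr' ?_
  filter_upwards [hf' 1 one_pos] with y hy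
  exact c₂.chart.left_inv hy.1

end TubeImage

/-! ### The extension to the periodic orbit -/

section Extension

theorem IsLocalOrbitalEquivalence.trans {X Y V : Type*} [TopologicalSpace X] [TopologicalSpace Y]
    [TopologicalSpace V] {φ : Flow ℝ X} {ψ : Flow ℝ Y} {χ : Flow ℝ V}
    {e : OpenPartialHomeomorph X Y} {e' : OpenPartialHomeomorph Y V}
    (h : IsLocalOrbitalEquivalence φ ψ e) (h' : IsLocalOrbitalEquivalence ψ χ e')
    (hee : e.target = e'.source) : IsLocalOrbitalEquivalence φ χ (e.trans' e' hee) := by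
  intro x hx
  have hx' : x ∈ e.source := hx
  obtain ⟨θ, h0, hmono, himg, hθ⟩ := h x hx'
  obtain ⟨θ', h0', hmono', himg', hθ'⟩ := h' (e x) (hee ▸ e.map_source hx')
  rw [hee] at himg
  have hmaps : MapsTo θ (stayTimes φ e.source x) (stayTimes ψ e'.source (e x)) :=
    himg ▸ mapsTo_image _ _
  refine ⟨θ' ∘ θ, by simp [h0, h0'], hmono'.comp hmono hmaps, ?_, fun t ht => ?_⟩
  · change (θ' ∘ θ) '' stayTimes φ e.source x = stayTimes χ e'.target (e' (e x))
    rw [image_comp, himg, himg']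
  · change e' (e (φ t x)) = χ (θ' (θ t)) (e' (e x))
    rw [hθ t ht, hθ' _ (hmaps ht)]

/-- A bounded continuous time shift which preserves the order on the orbits is a local orbital
equivalence of every open set that it preserves with its complement. -/
theorem exists_timeShift_equivalence {M : Type*} [TopologicalSpace M] (φ : Flow ℝ M) {X O : Set M}
    {u : M → ℝ} {T : ℝ} (hX : IsOpen X) (hinv : ∀ x ∈ X, ∀ t, φ t x ∈ X) (hu : ContinuousOn u X)
    (hT : ∀ x ∈ X, |u x| ≤ T) (hmono : ∀ x ∈ X, StrictMono fun s => s + u (φ s x))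
    (hO : IsOpen O) (hOX : O ⊆ X) (hmem : ∀ x ∈ X, φ (u x) x ∈ O ↔ x ∈ O) :
    ∃ Ψ : OpenPartialHomeomorph M M, Ψ.source = O ∧ Ψ.target = O ∧
      IsLocalOrbitalEquivalence φ φ Ψ ∧ (∀ x ∈ O, Ψ x = φ (u x) x) ∧
      ∀ x ∈ O, ∃ t, |t| ≤ T ∧ Ψ.symm x = φ t x := by
  obtain ⟨Ψ, hs, ht, hΨ, hΨ'⟩ := exists_timeShift_homeo φ hX hinv hu hT hmono
  have himg : Ψ.IsImage O O := fun x hx => by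
    rw [hs] at hx
    rw [hΨ x hx, hmem x hx]
  have hO' : IsOpen (Ψ.source ∩ O) := Ψ.open_source.inter hO
  have hs' : (himg.restr hO').source = O := by
    change Ψ.source ∩ O = O
    rw [hs, inter_eq_right.2 hOX]
  have ht' : (himg.restr hO').target = O := by
    change Ψ.target ∩ O = O
    rw [ht, inter_eq_right.2 hOX]
  refine ⟨himg.restr hO', hs', ht', ?_, fun x hx => hΨ x (hOX hx), fun x hx => hΨ' x (hOX hx)⟩
  intro x hx
  rw [hs'] at hx
  rw [hs', ht']
  change ∃ θ : ℝ → ℝ, θ 0 = 0 ∧ StrictMonoOn θ (stayTimes φ O x) ∧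
    θ '' stayTimes φ O x = stayTimes φ O (Ψ x) ∧ ∀ t ∈ stayTimes φ O x, Ψ (φ t x) = φ (θ t) (Ψ x)
  have hxX := hOX hx
  have hsurj := timeShift_surjective φ hinv hu hT hxX
  have hm := hmono x hxX
  set f : ℝ → ℝ := fun s => s + u (φ s x) with hf
  have hf0 : f 0 = u x := by simp [hf]
  have hΨf : ∀ s, Ψ (φ s x) = φ (f s) x := fun s => by
    rw [hΨ _ (hinv x hxX s), ← φ.map_add, add_comm]
  have hΨx : Ψ x = φ (f 0) x := by rw [← hΨf, φ.map_zero_apply]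
  have hfmem : ∀ s, φ (f s) x ∈ O ↔ φ s x ∈ O := fun s => by
    rw [← hΨf, hΨ _ (hinv x hxX s), hmem _ (hinv x hxX s)]
  have huIcc : ∀ s r, f r ∈ uIcc (f 0) (f s) ↔ r ∈ uIcc 0 s := fun s r => by
    rw [mem_uIcc, mem_uIcc, hm.le_iff_le, hm.le_iff_le, hm.le_iff_le, hm.le_iff_le]
  refine ⟨fun s => f s - f 0, sub_self _, fun s _ t _ hst => sub_lt_sub_right (hm hst) _,
    ?_, fun t _ => ?_⟩
  · ext t
    constructor
    · rintro ⟨s, hs, rfl⟩ r hr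
      obtain ⟨r', hr'⟩ := hsurj (r + f 0)
      rw [hΨx, ← φ.map_add, ← hr', hfmem]
      refine hs r' ((huIcc s r').1 ?_)
      rw [show f r' = r + f 0 from hr']
      rw [mem_uIcc] at hr ⊢
      rcases hr with hr | hr
      · exact Or.inl ⟨by linarith, by linarith⟩
      · exact Or.inr ⟨by linarith, by linarith⟩
    · intro ht
      obtain ⟨s, hs⟩ := hsurj (t + f 0)
      replace hs : f s = t + f 0 := hs
      refine ⟨s, fun r hr => ?_, by simp [hs]⟩
      have h1 := (huIcc s r).2 hr
      have h2 := ht (f r - f 0) (by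
        rw [hs, mem_uIcc] at h1
        rw [mem_uIcc]
        rcases h1 with h1 | h1
        · exact Or.inl ⟨by linarith, by linarith⟩
        · exact Or.inr ⟨by linarith, by linarith⟩)
      rwa [hΨx, ← φ.map_add, sub_add_cancel, hfmem] at h2
  · simp only
    rw [hΨf, hΨx, ← φ.map_add, sub_add_cancel]

variable {M₁ M₂ : Type*} [TopologicalSpace M₁] [TopologicalSpace M₂]
  {φ₁ : Flow ℝ M₁} {φ₂ : Flow ℝ M₂} {γ₁ : Set M₁} {γ₂ : Set M₂}
  {c₁ : SaddleChart φ₁ γ₁} {c₂ : SaddleChart φ₂ γ₂}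

/-- The map from the first periodic orbit to the second one that respects the longitudinal
coordinates of the charts. -/
def SaddleChart.orbitMap (c₁ : SaddleChart φ₁ γ₁) (c₂ : SaddleChart φ₂ γ₂) (x : M₁) : M₂ :=
  c₂.chart.symm (0, (c₁.chart x).2)

theorem SaddleChart.orbitMap_mem (x : M₁) : c₁.orbitMap c₂ x ∈ γ₂ :=
  (c₂.symm_mem_iff (c₂.mem_target_of_fst_eq_zero rfl)).2 rfl

theorem SaddleChart.orbitMap_orbitMap {x : M₁} (hx : x ∈ γ₁) :
    c₂.orbitMap c₁ (c₁.orbitMap c₂ x) = x := by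
  have hxs := c₁.subset_source hx
  have h0 := (c₁.fst_eq_zero_iff hxs).2 hx
  rw [orbitMap, orbitMap, c₂.chart.right_inv (c₂.mem_target_of_fst_eq_zero rfl)]
  simp only
  rw [← h0, Prod.mk.eta, c₁.chart.left_inv hxs]

/-- On the periodic orbits, the longitudinal coordinate of both models increases with unit speed. -/
theorem SaddleChart.exists_orbitMap_flow (hγ₁ : IsPeriodicOrbit φ₁ γ₁)
    (hγ₂ : IsPeriodicOrbit φ₂ γ₂) {x : M₁} (hx : x ∈ γ₁) :
    ∃ θ : ℝ → ℝ, θ 0 = 0 ∧ StrictMono θ ∧ Function.Surjective θ ∧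
      ∀ t, c₁.orbitMap c₂ (φ₁ t x) = φ₂ (θ t) (c₁.orbitMap c₂ x) := by
  have hxs := c₁.subset_source hx
  have h0 := (c₁.fst_eq_zero_iff hxs).2 hx
  have hz : ((0 : ℂ), (c₁.chart x).2) ∈ c₂.chart.target := c₂.mem_target_of_fst_eq_zero rfl
  obtain ⟨θ, hθ0, hmono, himg, hθ⟩ := c₁.orbital x hxs
  obtain ⟨θ', hθ0', hmono', himg', hθ'⟩ := c₂.orbital.symm _ hz
  have hst : stayTimes φ₁ c₁.chart.source x = univ :=
    stayTimes_univ_of_invariant fun t => c₁.subset_source (hγ₁.flow_mem hx t)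
  have hst₁ : stayTimes (saddleFlow c₁.a c₁.b) c₁.chart.target (c₁.chart x) = univ :=
    stayTimes_univ_of_invariant fun t => c₁.mem_target_of_fst_eq_zero
      ((saddleFlow_fst_eq_zero _ _).2 h0)
  have hst₂ : stayTimes (saddleFlow c₂.a c₂.b) c₂.chart.symm.source
      ((0 : ℂ), (c₁.chart x).2) = univ :=
    stayTimes_univ_of_invariant fun t => c₂.mem_target_of_fst_eq_zero
      ((saddleFlow_fst_eq_zero _ _).2 rfl)
  have hst' : stayTimes φ₂ c₂.chart.symm.target (c₂.chart.symm (0, (c₁.chart x).2)) = univ :=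
    stayTimes_univ_of_invariant fun t => c₂.subset_source (hγ₂.flow_mem (orbitMap_mem (c₁ := c₁) x) t)
  rw [hst, hst₁, image_univ, range_eq_univ] at himg
  rw [hst, strictMonoOn_univ] at hmono
  rw [hst₂, hst', image_univ, range_eq_univ] at himg'
  rw [hst₂, strictMonoOn_univ] at hmono'
  refine ⟨θ' ∘ θ, by simp [hθ0, hθ0'], hmono'.comp hmono, himg'.comp himg, fun t => ?_⟩
  simp only [Function.comp_apply, orbitMap]
  rw [← hθ' (θ t) (hst₂ ▸ mem_univ _), hθ t (hst ▸ mem_univ _)]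
  congr 1
  refine Prod.ext ((saddleFlow_fst_eq_zero _ _).2 rfl).symm ?_
  simp only [saddleFlow_snd]

/-- A local orbital equivalence between punctured neighbourhoods extends to the periodic orbits when
the change of the longitudinal coordinate tends to `0`. -/
theorem IsLocalOrbitalEquivalence.exists_extension (c₁ : SaddleChart φ₁ γ₁)
    (c₂ : SaddleChart φ₂ γ₂) (hγ₁ : IsPeriodicOrbit φ₁ γ₁) (hγ₂ : IsPeriodicOrbit φ₂ γ₂)
    (hcl₁ : IsClosed γ₁) (hcl₂ : IsClosed γ₂) {W₁ : Set M₁} {W₂ : Set M₂}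
    (hW₁ : IsOpen W₁) (hW₂ : IsOpen W₂) (hγW₁ : γ₁ ⊆ W₁) (hγW₂ : γ₂ ⊆ W₂)
    {K : OpenPartialHomeomorph M₁ M₂} (hKs : K.source = W₁ \ γ₁) (hKt : K.target = W₂ \ γ₂)
    (hK : IsLocalOrbitalEquivalence φ₁ φ₂ K)
    (hnear : ∀ δ > 0, ∀ᶠ x in 𝓝ˢ γ₁, x ∉ γ₁ →
      K x ∈ c₂.chart.source ∧ ‖(c₂.chart (K x)).1‖ < δ ∧ ∃ w : ℝ, |w| < δ ∧
        (c₂.chart (K x)).2 = (c₁.chart x).2 + (w : UnitAddCircle))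
    (hsymm : ∀ O ∈ 𝓝ˢ γ₁, ∀ᶠ y in 𝓝ˢ γ₂, y ∉ γ₂ → K.symm y ∈ O) :
    ∃ HN : OpenPartialHomeomorph M₁ M₂, HN.source = W₁ ∧ HN.target = W₂ ∧
      IsLocalOrbitalEquivalence φ₁ φ₂ HN ∧ HN '' γ₁ = γ₂ ∧ ∀ x, x ∉ γ₁ → HN x = K x := by
  classical
  set f : M₁ → M₂ := fun x => if x ∈ γ₁ then c₁.orbitMap c₂ x else K x with hf
  set g : M₂ → M₁ := fun y => if y ∈ γ₂ then c₂.orbitMap c₁ y else K.symm y with hg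
  have hf1 : ∀ x ∈ γ₁, f x = c₁.orbitMap c₂ x := fun x hx => if_pos hx
  have hf2 : ∀ x, x ∉ γ₁ → f x = K x := fun x hx => if_neg hx
  have hg1 : ∀ y ∈ γ₂, g y = c₂.orbitMap c₁ y := fun x hx => if_pos hx
  have hg2 : ∀ y, y ∉ γ₂ → g y = K.symm y := fun x hx => if_neg hx
  have hKm : ∀ x ∈ W₁, x ∉ γ₁ → K x ∈ W₂ \ γ₂ := fun x hx hxγ =>
    hKt ▸ K.map_source (hKs ▸ ⟨hx, hxγ⟩)
  have hKm' : ∀ y ∈ W₂, y ∉ γ₂ → K.symm y ∈ W₁ \ γ₁ := fun y hy hyγ =>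
    hKs ▸ K.map_target (hKt ▸ ⟨hy, hyγ⟩)
  have hnear_f : ∀ δ > 0, ∀ᶠ x in 𝓝ˢ γ₁, f x ∈ c₂.chart.source ∧ ‖(c₂.chart (f x)).1‖ < δ ∧
      ∃ w : ℝ, |w| < δ ∧ (c₂.chart (f x)).2 = (c₁.chart x).2 + (w : UnitAddCircle) := by
    intro δ hδ
    filter_upwards [hnear δ hδ] with x hx
    by_cases hxγ : x ∈ γ₁
    · have h0 : ((0 : ℂ), (c₁.chart x).2) ∈ c₂.chart.target := c₂.mem_target_of_fst_eq_zero rfl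
      rw [hf1 x hxγ, SaddleChart.orbitMap, c₂.chart.right_inv h0]
      exact ⟨c₂.chart.map_target h0, by simpa using hδ, 0, by simpa using hδ, by simp⟩
    · rw [hf2 x hxγ]
      exact hx hxγ
  have hnear_g : ∀ δ > 0, ∀ᶠ y in 𝓝ˢ γ₂, g y ∈ c₁.chart.source ∧ ‖(c₁.chart (g y)).1‖ < δ ∧
      ∃ w : ℝ, |w| < δ ∧ (c₁.chart (g y)).2 = (c₂.chart y).2 + (w : UnitAddCircle) := by
    intro δ hδ
    filter_upwards [hsymm _ ((hnear δ hδ).and (c₁.eventually_norm_lt hδ)),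
      hW₂.mem_nhdsSet.2 hγW₂] with y hy hyW
    by_cases hyγ : y ∈ γ₂
    · have h0 : ((0 : ℂ), (c₂.chart y).2) ∈ c₁.chart.target := c₁.mem_target_of_fst_eq_zero rfl
      rw [hg1 y hyγ, SaddleChart.orbitMap, c₁.chart.right_inv h0]
      exact ⟨c₁.chart.map_target h0, by simpa using hδ, 0, by simpa using hδ, by simp⟩
    · rw [hg2 y hyγ]
      obtain ⟨h1, h2, h3⟩ := hy hyγ
      obtain ⟨-, -, w, hw, hw'⟩ := h1 (hKm' y hyW hyγ).2
      rw [K.right_inv (hKt ▸ ⟨hyW, hyγ⟩)] at hw'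
      refine ⟨h2, h3, -w, by rwa [abs_neg], ?_⟩
      rw [hw', AddCircle.coe_neg, add_neg_cancel_right]
  have hfc : ContinuousOn f W₁ := fun x hx => by
    refine ContinuousAt.continuousWithinAt ?_
    by_cases hxγ : x ∈ γ₁
    · exact SaddleChart.continuousAt_of_near hnear_f hxγ (hf1 x hxγ)
    · refine (K.continuousAt (hKs ▸ ⟨hx, hxγ⟩)).congr ?_
      filter_upwards [hcl₁.isOpen_compl.mem_nhds hxγ] with z hz using (hf2 z hz).symm
  have hgc : ContinuousOn g W₂ := fun y hy => by
    refine ContinuousAt.continuousWithinAt ?_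
    by_cases hyγ : y ∈ γ₂
    · exact SaddleChart.continuousAt_of_near hnear_g hyγ (hg1 y hyγ)
    · refine (K.continuousAt_symm (hKt ▸ ⟨hy, hyγ⟩)).congr ?_
      filter_upwards [hcl₂.isOpen_compl.mem_nhds hyγ] with z hz using (hg2 z hz).symm
  refine ⟨{ toFun := f
            invFun := g
            source := W₁
            target := W₂
            map_source' := fun x hx => ?_
            map_target' := fun y hy => ?_
            left_inv' := fun x hx => ?_
            right_inv' := fun y hy => ?_
            open_source := hW₁
            open_target := hW₂
            continuousOn_toFun := hfc
            continuousOn_invFun := hgc }, rfl, rfl, ?_, ?_, hf2⟩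
  · by_cases hxγ : x ∈ γ₁
    · rw [hf1 x hxγ]
      exact hγW₂ (SaddleChart.orbitMap_mem x)
    · rw [hf2 x hxγ]
      exact (hKm x hx hxγ).1
  · by_cases hyγ : y ∈ γ₂
    · rw [hg1 y hyγ]
      exact hγW₁ (SaddleChart.orbitMap_mem y)
    · rw [hg2 y hyγ]
      exact (hKm' y hy hyγ).1
  · by_cases hxγ : x ∈ γ₁
    · rw [hf1 x hxγ, hg1 _ (SaddleChart.orbitMap_mem x), SaddleChart.orbitMap_orbitMap hxγ]
    · rw [hf2 x hxγ, hg2 _ (hKm x hx hxγ).2, K.left_inv (hKs ▸ ⟨hx, hxγ⟩)]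
  · by_cases hyγ : y ∈ γ₂
    · rw [hg1 y hyγ, hf1 _ (SaddleChart.orbitMap_mem y), SaddleChart.orbitMap_orbitMap hyγ]
    · rw [hg2 y hyγ, hf2 _ (hKm' y hy hyγ).2, K.right_inv (hKt ▸ ⟨hy, hyγ⟩)]
  · intro x hx
    change x ∈ W₁ at hx
    change ∃ θ : ℝ → ℝ, θ 0 = 0 ∧ StrictMonoOn θ (stayTimes φ₁ W₁ x) ∧
      θ '' stayTimes φ₁ W₁ x = stayTimes φ₂ W₂ (f x) ∧
        ∀ t ∈ stayTimes φ₁ W₁ x, f (φ₁ t x) = φ₂ (θ t) (f x)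
    by_cases hxγ : x ∈ γ₁
    · obtain ⟨θ, hθ0, hmono, hsurj, hθ⟩ :=
        SaddleChart.exists_orbitMap_flow (c₁ := c₁) (c₂ := c₂) hγ₁ hγ₂ hxγ
      refine ⟨θ, hθ0, hmono.strictMonoOn _, ?_, fun t _ => ?_⟩
      · rw [stayTimes_univ_of_invariant fun t => hγW₁ (hγ₁.flow_mem hxγ t), hf1 x hxγ,
          stayTimes_univ_of_invariant fun t =>
            hγW₂ (hγ₂.flow_mem (SaddleChart.orbitMap_mem (c₁ := c₁) x) t), image_univ,
          hsurj.range_eq]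
      · rw [hf1 x hxγ, hf1 _ (hγ₁.flow_mem hxγ t), hθ t]
    · obtain ⟨θ, hθ0, hmono, himg, hθ⟩ := hK x (hKs ▸ ⟨hx, hxγ⟩)
      rw [hKs, stayTimes_diff fun t => hγ₁.flow_mem_iff.not.2 hxγ] at hmono himg hθ
      rw [hKt, stayTimes_diff fun t => hγ₂.flow_mem_iff.not.2 (hKm x hx hxγ).2] at himg
      refine ⟨θ, hθ0, hmono, ?_, fun t ht => ?_⟩
      · rw [himg, hf2 x hxγ]
      · rw [hf2 x hxγ, hf2 _ (hγ₁.flow_mem_iff.not.2 hxγ), hθ t ht]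
  · change f '' γ₁ = γ₂
    ext y
    constructor
    · rintro ⟨x, hx, rfl⟩
      rw [hf1 x hx]
      exact SaddleChart.orbitMap_mem x
    · intro hy
      refine ⟨c₂.orbitMap c₁ y, SaddleChart.orbitMap_mem y, ?_⟩
      rw [hf1 _ (SaddleChart.orbitMap_mem y), SaddleChart.orbitMap_orbitMap hy]

end Extension

section Final

variable {M₁ M₂ : Type*} [TopologicalSpace M₁] [TopologicalSpace M₂]
  {φ₁ : Flow ℝ M₁} {φ₂ : Flow ℝ M₂} {γ₁ : Set M₁} {γ₂ : Set M₂}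
  {c₁ : SaddleChart φ₁ γ₁} {c₂ : SaddleChart φ₂ γ₂}
  {H : OpenPartialHomeomorph M₁ M₂} {E : PuncturedEquiv c₁.a c₁.b c₂.a c₂.b}

/-- If the homology of the punctured tubes is respected and the shift is bounded, the equivalence
can be modified along the orbits, near the periodic orbit, so that it extends to it. -/
theorem TubeLift.exists_modification [T2Space M₁] [T2Space M₂] (T : TubeLift E)
    (hE : E.Represents H)
    (hγ₁ : IsPeriodicOrbit φ₁ γ₁) (hγ₂ : IsPeriodicOrbit φ₂ γ₂) {W₁ : Set M₁} {W₂ : Set M₂}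
    (hW₁ : IsOpen W₁) (hW₂ : IsOpen W₂) (hγW₁ : γ₁ ⊆ W₁) (hγW₂ : γ₂ ⊆ W₂)
    (hHs : H.source = W₁ \ γ₁) (hHt : H.target = W₂ \ γ₂)
    (hH : IsLocalOrbitalEquivalence φ₁ φ₂ H) (hlong : T.long = 1) (htwist : T.twist = 0)
    {ℓ₀ K : ℝ} (hℓ₀ : ℓ₀ ≤ E.ℓ₁) (hK : ∀ y ∈ logTube ℓ₀, |(T.toFun y).2 - y.2| ≤ K)
    {N : Set M₁} (hN : N ∈ 𝓝ˢ γ₁) :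
    ∃ HN : OpenPartialHomeomorph M₁ M₂, HN.source = W₁ ∧ HN.target = W₂ ∧
      IsLocalOrbitalEquivalence φ₁ φ₂ HN ∧ HN '' γ₁ = γ₂ ∧ ∀ x ∈ W₁ \ N, HN x = H x := by
  have hcl₁ : IsClosed γ₁ := c₁.isCompact_orbit.isClosed
  have hcl₂ : IsClosed γ₂ := c₂.isCompact_orbit.isClosed
  have htγ : ∀ y ∈ H.target, y ∉ γ₂ := fun y hy => (hHt ▸ hy : y ∈ W₂ \ γ₂).2
  obtain ⟨T₀, hT₀, hclock⟩ := c₂.exists_clock_bound hγ₂ (2 * K)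
  have hflow : ∀ {O : Set M₂}, O ∈ 𝓝ˢ γ₂ → ∀ᶠ y in 𝓝ˢ γ₂, ∀ t ∈ Icc (-T₀) T₀, φ₂ t y ∈ O :=
    fun hO => φ₂.eventually_nhdsSet_forall (fun x hx t => hγ₂.flow_mem hx t) hO T₀
  have hwin : ∀ᶠ y in 𝓝ˢ γ₂, c₂.HasWindow (2 * K) T₀ y ∧ ∀ t ∈ Icc (-T₀) T₀, φ₂ t y ∈ W₂ := by
    filter_upwards [hclock, hflow c₂.source_mem_nhdsSet, hflow (hW₂.mem_nhdsSet.2 hγW₂)]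
      with y h1 h2 h3 using ⟨⟨h2, h1⟩, h3⟩
  obtain ⟨r, hr, hrwin⟩ := hE.eventually_mem hwin
  obtain ⟨ε, hε, hεN⟩ := c₁.exists_tube_subset hN
  set ℓ := min ℓ₀ (min r (Real.log ε)) with hℓdef
  have hℓ₀' : ℓ ≤ ℓ₀ := min_le_left _ _
  have hℓr : ℓ ≤ r := (min_le_right _ _).trans (min_le_left _ _)
  have hℓε : ℓ ≤ Real.log ε := (min_le_right _ _).trans (min_le_right _ _)
  have hℓ : ℓ ≤ E.ℓ₁ := hℓ₀'.trans hℓ₀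
  have htube : ∀ y ∈ tubeImage c₁ H ℓ,
      c₂.HasWindow (2 * K) T₀ y ∧ ∀ t ∈ Icc (-T₀) T₀, φ₂ t y ∈ W₂ := fun y hy =>
    hrwin ⟨hy.1, hy.2.1, puncturedTube_mono hℓr hy.2.2⟩
  obtain ⟨D, hDc, hD0, hDK, hDmono, ω, hω, hω0⟩ := T.exists_correction hlong htwist c₂.a_neg.ne
    c₂.b_pos.ne' hℓ (fun y hy => hK y (logTube_mono hℓ₀' hy)) (ℓ - 1)
  obtain ⟨u, huc, huT, hum, huD, hu0⟩ := hE.exists_timeShift hγ₂ htγ hH hℓ (sub_one_lt ℓ) hT₀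
    (fun y hy => (htube y hy).1) hDc hD0 hDK hDmono
  have hinv : ∀ y ∈ γ₂ᶜ, ∀ t, φ₂ t y ∈ γ₂ᶜ := fun y hy t => hγ₂.flow_mem_iff.not.2 hy
  have hmem : ∀ y ∈ γ₂ᶜ, φ₂ (u y) y ∈ W₂ \ γ₂ ↔ y ∈ W₂ \ γ₂ := by
    intro y hy
    by_cases hyt : y ∈ tubeImage c₁ H ℓ
    · have h1 : y ∈ W₂ \ γ₂ := hHt ▸ hyt.1
      exact iff_of_true ⟨(htube y hyt).2 _ (abs_le.1 (huT y)), hinv y hy _⟩ h1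
    · rw [hu0 y hyt, φ₂.map_zero_apply]
  obtain ⟨Ψ, hΨs, hΨt, hΨ, hΨu, hΨsymm⟩ := exists_timeShift_equivalence φ₂ hcl₂.isOpen_compl hinv huc
    (fun y _ => huT y) hum (hW₂.sdiff hcl₂) (fun y hy => hy.2) hmem
  have hHΨ : H.target = Ψ.source := hHt.trans hΨs.symm
  have happ : ∀ x ∈ H.source, (H.trans' Ψ hHΨ) x = φ₂ (u (H x)) (H x) := fun x hx =>
    hΨu _ (hHt ▸ H.map_source hx)
  have hnear : ∀ δ > 0, ∀ᶠ x in 𝓝ˢ γ₁, x ∉ γ₁ → (H.trans' Ψ hHΨ) x ∈ c₂.chart.source ∧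
      ‖(c₂.chart ((H.trans' Ψ hHΨ) x)).1‖ < δ ∧ ∃ w : ℝ, |w| < δ ∧
        (c₂.chart ((H.trans' Ψ hHΨ) x)).2 = (c₁.chart x).2 + (w : UnitAddCircle) := by
    intro δ hδ
    set β := max |c₂.a| |c₂.b| with hβ
    -- the correction moves points by model times at most `2 * K`
    obtain ⟨r₁, hr₁, hr₁E⟩ := E.tends (Real.log δ - β * (2 * K))
    obtain ⟨r₂, hr₂, hr₂ω⟩ := hω0 δ hδ
    filter_upwards [hE.eventually_tubeImage (le_refl E.ℓ₁), hE.eventually_tubeImage hr₁,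
      hE.eventually_tubeImage (hr₂.trans hℓ)] with x hx hx₁ hx₂ hxγ
    obtain ⟨hxs, hxc, hxq₂, hxt₂⟩ := hx₂ hxγ
    have hxq₁ := (hx₁ hxγ).2.2.1
    have hxq : c₁.chart x ∈ puncturedTube ℓ := puncturedTube_mono hr₂ hxq₂
    have hxt : H x ∈ tubeImage c₁ H ℓ := ⟨hxt₂.1, hxt₂.2.1, puncturedTube_mono hr₂ hxt₂.2.2⟩
    obtain ⟨hyc, hyE⟩ := hE.chart_eq hℓ hxt
    have hyD := huD _ hxt
    rw [H.left_inv hxs] at hyE hyD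
    have hstay := (htube _ hxt).1.mem_stayTimes (abs_le.1 (huT (H x)))
    have hchart : c₂.chart (φ₂ (u (H x)) (H x)) =
        saddleFlow c₂.a c₂.b (D (c₁.chart x)) (E.toFun (c₁.chart x)) := by
      rw [SaddleChart.chart_flow hyc hstay, hyD, hyE]
    rw [happ x hxs, hchart]
    refine ⟨stayTimes_mem hstay, ?_, ω (c₁.chart x), hr₂ω _ hxq₂, ?_⟩
    · refine (norm_saddleFlow_le c₂.a c₂.b (β := β) (le_max_left _ _) (le_max_right _ _) _ _).trans_lt ?_
      have h1 := (hr₁E _ hxq₁).2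
      have h2 : Real.exp (β * |D (c₁.chart x)|) ≤ Real.exp (β * (2 * K)) :=
        Real.exp_le_exp.2 (mul_le_mul_of_nonneg_left (hDK _ hxq) (le_max_of_le_left (abs_nonneg _)))
      calc _ ≤ Real.exp (β * (2 * K)) * ‖(E.toFun (c₁.chart x)).1‖ := by gcongr
        _ < Real.exp (β * (2 * K)) * Real.exp (Real.log δ - β * (2 * K)) := by gcongr
        _ = δ := by rw [← Real.exp_add, add_sub_cancel, Real.exp_log hδ]
    · rw [saddleFlow_snd, hω _ hxq]
  have hsymm : ∀ O ∈ 𝓝ˢ γ₁, ∀ᶠ y in 𝓝ˢ γ₂, y ∉ γ₂ → (H.trans' Ψ hHΨ).symm y ∈ O := by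
    intro O hO
    obtain ⟨r', hr', hr'O⟩ := hE.symm.eventually_mem hO
    have h1 := hE.symm.eventually_tubeImage hr'
    filter_upwards [hflow h1, hW₂.mem_nhdsSet.2 hγW₂] with y hy hyW hyγ
    obtain ⟨t, ht, hty⟩ := hΨsymm y ⟨hyW, hyγ⟩
    have h2 := hy t (abs_le.1 ht) (hinv y hyγ t)
    change H.symm (Ψ.symm y) ∈ O
    rw [hty]
    exact hr'O h2.2.2.2
  obtain ⟨HN, hs, ht, hor, himg, hHN⟩ := (hH.trans hΨ hHΨ).exists_extension c₁ c₂ hγ₁ hγ₂ hcl₁ hcl₂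
    hW₁ hW₂ hγW₁ hγW₂ (K := H.trans' Ψ hHΨ) hHs hΨt hnear hsymm
  refine ⟨HN, hs, ht, hor, himg, fun x hx => ?_⟩
  have hxγ : x ∉ γ₁ := fun h => hx.2 (subset_of_mem_nhdsSet hN h)
  have hxs : x ∈ H.source := hHs ▸ ⟨hx.1, hxγ⟩
  rw [hHN x hxγ, happ x hxs, hu0, φ₂.map_zero_apply]
  rintro ⟨-, h1, h2⟩
  rw [H.left_inv hxs] at h1 h2
  refine hx.2 ?_
  rw [← c₁.chart.left_inv h1]
  refine (hεN _ (h2.2.trans_le ?_)).2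
  rw [← Real.exp_log hε]
  exact Real.exp_le_exp.2 hℓε

end Final

end

theorem mainTheorem3
    {M₁ : Type*} [TopologicalSpace M₁] [T2Space M₁] [ChartedSpace (EuclideanSpace ℝ (Fin 3)) M₁]
    {M₂ : Type*} [TopologicalSpace M₂] [T2Space M₂] [ChartedSpace (EuclideanSpace ℝ (Fin 3)) M₂]
    (φ₁ : Flow ℝ M₁) (φ₂ : Flow ℝ M₂) (γ₁ : Set M₁) (γ₂ : Set M₂)
    (hγ₁ : IsPeriodicOrbit φ₁ γ₁) (hγ₂ : IsPeriodicOrbit φ₂ γ₂)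
    (c₁ : SaddleChart φ₁ γ₁) (c₂ : SaddleChart φ₂ γ₂)
    (B₁ : LocalBirkhoffSection φ₁ γ₁) (B₂ : LocalBirkhoffSection φ₂ γ₂)
    (hB₁ : B₁.IsTame c₁) (hB₂ : B₂.IsTame c₂)
    (h : B₁.interior ≃ₜ B₂.interior) (hh : IsLocalConjugation B₁ B₂ h)
    (W₁ : Set M₁) (W₂ : Set M₂) (hW₁ : IsOpen W₁) (hW₂ : IsOpen W₂)
    (hγW₁ : γ₁ ⊆ W₁) (hγW₂ : γ₂ ⊆ W₂)
    (H : OpenPartialHomeomorph M₁ M₂)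
    (hH_source : H.source = W₁ \ γ₁) (hH_target : H.target = W₂ \ γ₂)
    (hH : IsLocalOrbitalEquivalence φ₁ φ₂ H)
    (hH_orient : PreservesOrientation c₁ c₂ H)
    (hHh : ∀ (x : M₁) (hx : x ∈ B₁.interior), x ∈ W₁ → H x = h ⟨x, hx⟩)
    (n₁ m₁ n₂ m₂ : ℤ)
    (hnm₁ : B₁.HasLinkingNumberAndMultiplicity c₁ n₁ m₁)
    (hnm₂ : B₂.HasLinkingNumberAndMultiplicity c₂ n₂ m₂)
    (hm : m₁ = m₂) (hn : n₁ = n₂)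
    (N : Set M₁) (hN : N ∈ 𝓝ˢ γ₁) (hNW : N ⊆ W₁) :
    ∃ HN : OpenPartialHomeomorph M₁ M₂,
      HN.source = W₁ ∧ HN.target = W₂ ∧
      IsLocalOrbitalEquivalence φ₁ φ₂ HN ∧ HN '' γ₁ = γ₂ ∧
      ∀ x ∈ W₁ \ N, HN x = H x := by
  subst hm hn
  have hW₁γ := hW₁.mem_nhdsSet.2 hγW₁
  have hW₂γ := hW₂.mem_nhdsSet.2 hγW₂
  have hsec : IsSectionEquiv B₁ B₂ H :=
    { orbital := hH
      source_mem := by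
        filter_upwards [hW₁γ] with x hx hxγ using hH_source ▸ ⟨hx, hxγ⟩
      target_mem := by
        filter_upwards [hW₂γ] with x hx hxγ using hH_target ▸ ⟨hx, hxγ⟩
      source_notMem := fun x hx => (hH_source ▸ hx : x ∈ W₁ \ γ₁).2
      target_notMem := fun x hx => (hH_target ▸ hx : x ∈ W₂ \ γ₂).2
      map_section := fun O hO => by
        filter_upwards [hh.1 O hO, hW₁γ] with x hx hxW hxB
        rw [hHh x hxB hxW]
        exact ⟨hx hxB, (h ⟨x, hxB⟩).2⟩
      symm_map_section := fun O hO => by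
        filter_upwards [LocalBirkhoffSection.eventually_symm_mem h hh.1 (inter_mem hO hW₁γ)]
          with y hy hyB
        obtain ⟨h1, h2⟩ := hy hyB
        have hxB : (h.symm ⟨y, hyB⟩ : M₁) ∈ B₁.interior := (h.symm ⟨y, hyB⟩).2
        have h3 : H (h.symm ⟨y, hyB⟩ : M₁) = y := by
          rw [hHh _ hxB h2, Subtype.coe_eta, h.apply_symm_apply]
        have h4 : H.symm y = (h.symm ⟨y, hyB⟩ : M₁) := by
          have h5 := H.left_inv (x := (h.symm ⟨y, hyB⟩ : M₁))
            (hH_source ▸ ⟨h2, B₁.notMem_of_mem_interior hxB⟩)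
          rwa [h3] at h5
        rw [h4]
        exact ⟨h1, hxB⟩ }
  obtain ⟨E, hE⟩ := hsec.exists_puncturedEquiv c₁ c₂ hγ₁ hγ₂
  obtain ⟨T⟩ := E.exists_tubeLift c₁.a_neg c₂.b_pos
  obtain ⟨T'⟩ := E.symm.exists_tubeLift c₂.a_neg c₁.b_pos
  obtain ⟨S₁⟩ := LocalBirkhoffSection.exists_stripLift hnm₁
  obtain ⟨S₂⟩ := LocalBirkhoffSection.exists_stripLift hnm₂
  have hpos := hE.isPositive hH_orient
  have hlong := T.long_eq_one T' hE hsec hγ₁ hγ₂ hB₁ hB₂ S₂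
  have hmerid := (T.merid_eq_one T' c₁.a_neg c₁.b_pos c₂.a_neg c₂.b_pos hlong hpos).1
  obtain ⟨htwist, K, hK⟩ := T.twist_eq_zero T' hE hsec hγ₂ hB₁ hB₂ S₁ S₂ hlong hpos
  obtain ⟨ℓ, hℓ, K', hK'⟩ := T.exists_shift_bound T' hE hsec hγ₁ hγ₂ hlong hmerid htwist hK
  exact T.exists_modification hE hγ₁ hγ₂ hW₁ hW₂ hγW₁ hγW₂ hH_source hH_target hH hlong htwist
    hℓ hK' hN
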